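/- Let $V$ be an infinite set of values. For an arity $n\ge 0$ let $\Sigma=V^n$ be the alphabet of letters, and for $m\ge 0$ let $S=V^m$ be the set of stores with $m$ registers. Guards and actions are given by $$G ::= \mathsf{eq}\,i\,j \mid \mathsf{neq}\,i\,j\mid \mathsf{true}\mid G\ \mathsf{and}\ G,\qquad A ::= \mathsf{nop}\mid \mathsf{set}\,i:=j\mid A;A \qquad (1\le i\le m,\ 1\le j\le n).$$ For a store $s$ and a letter $\ell$: $(s,\ell)\models \mathsf{eq}\,i\,j$ iff $s(i)=\ell(j)$, $(s,\ell)\models\mathsf{neq}\,i\,j$ iff $s(i)\neq\ell(j)$, and $\mathsf{true}$, $\mathsf{and}$ have their usual meaning; $\mathsf{nop}(\ell)(s)=s$, $(\mathsf{set}\,i:=j)(\ell)(s)=s[i\mapsto\ell(j)]$, and $(a_1;a_2)(\ell)=a_1(\ell)\circ a_2(\ell)$. A label is a pair $(g,a)\in\Lambda=G\times A$. A *TOPL automaton* over $V^n$ with $m$ registers is a tuple $\langle Q,q_0,s_0,\delta,F\rangle$ with $Q$ a finite set of states, $q_0\in Q$, $F\subseteq Q$, $s_0\in S$, and $\delta\subseteq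 Q\times\Lambda\times Q$ finite. There is a step $(q_1,s_1)\xrightarrow{\ell}(q_2,s_2)$ iff some $(q_1,(g,a),q_2)\in\delta$ satisfies $(s_1,\ell)\models g$ and $a(\ell)(s_1)=s_2$. Its language is the set of words $\ell_1\cdots\ell_k\in\Sigma^*$ labelling walks from $(q_0,s_0)$ to a configuration with state in $F$. An *hl-TOPL automaton* is defined in the same way, but with $\delta\subseteq Q\times\Lambda^*\times Q$ finite. It moves between pairs (configuration, word still to be processed). A standard transition $((q_1,s_1),ww')\overset{w}{\hookrightarrow}((q_2,s_2),w')$ exists iff there is $(q_1,(g_1,a_1)\cdots(g_d,a_d),q_2)\in\delta$ such that $w=\ell_1\cdots\ell_d$ and there are stores $s_1=t_0,t_1,\dots,t_d=s_2$ with $(t_{i-1},\ell_i)\models g_i$ and $t_i=a_i(\ell_i)(t_{i-1})$ for $1\le i\le d$. A skip transition $(x,\ell w)\overset{\ell}{\hookrightarrow}(x,w)$ exists iff no standard transition starts from $(x,\ell w)$. Its language is the set of words $w_1\cdots w_k$ labelling paths from some $((q_0,s_0),w)$ to some $((q,s),\varepsilon)$ with $q\in F$. As inputs of algorithms, automata and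 words are given by finite descriptions: guards and actions are written out, states are numbered, transitions and final states are listed, and values are given by natural numbers through an arbitrary fixed injective naming $\mathbb N\to V$ (in particular, if $V=\mathbb N$, values may be given as themselves). The numbers of registers and states are part of the input. **Theorem.** Each of the following holds for TOPL automata, and also for hl-TOPL automata. 1. The emptiness problem (given an automaton $\mathcal A$, of any arity, is $\mathcal L(\mathcal A)=\emptyset$?) and the membership problem (given an automaton $\mathcal A$, of any arity, and a word $w$ over its alphabet, is $w\in\mathcal L(\mathcal A)$?) are decidable. 2. For every arity $n\ge 1$, the following problems for automata over $V^n$ are undecidable: inclusion ($\mathcal L(\mathcal A)\subseteq\mathcal L(\mathcal B)$?), equivalence ($\mathcal L(\mathcal A)=\mathcal L(\mathcal B)$?) and universality ($\mathcal L(\mathcal A)=\Sigma^*$?). 3. For every $n\ge 0$, the class of languages over $V^n$ that are recognized by automata of the class (with any number of registers) is closed under union, intersection, concatenation and Kleene star. 4. For every $n\ge 1$, this class of languages is not closed under complementation. -/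

import Mathlib

namespace TOPL

/-- Letters: the alphabet over the set of values `V`, at arity `n`, is `V ^ n`. -/
abbrev Letter (V : Type*) (n : ℕ) := Fin n → V

/-- Stores with `m` registers: `V ^ m`. -/
abbrev Store (V : Type*) (m : ℕ) := Fin m → V

/-- Guards over letters of arity `n` and stores of size `m`:
`G ::= eq i j | neq i j | true | G and G`. -/
inductive Guard (n m : ℕ) : Type
  | eq (i : Fin m) (j : Fin n) : Guard n m
  | neq (i : Fin m) (j : Fin n) : Guard n m
  | triv : Guard n m
  | and (g₁ g₂ : Guard n m) : Guard n m

/-- Actions: `A ::= nop | set i := j | A ; A`. -/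
inductive Action (n m : ℕ) : Type
  | nop : Action n m
  | set (i : Fin m) (j : Fin n) : Action n m
  | seq (a₁ a₂ : Action n m) : Action n m

/-- The satisfaction relation `(s, ℓ) ⊨ g`. -/
def Guard.Sat {V : Type*} {n m : ℕ} (s : Store V m) (ℓ : Letter V n) : Guard n m → Prop
  | .eq i j => s i = ℓ j
  | .neq i j => s i ≠ ℓ j
  | .triv => True
  | .and g₁ g₂ => g₁.Sat s ℓ ∧ g₂.Sat s ℓ

/-- The store update performed by an action on reading the letter `ℓ`; composition is
`(a₁ ; a₂)(ℓ) = a₁(ℓ) ∘ a₂(ℓ)`. -/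
def Action.run {V : Type*} {n m : ℕ} (ℓ : Letter V n) : Action n m → Store V m → Store V m
  | .nop => id
  | .set i j => fun s => Function.update s i (ℓ j)
  | .seq a₁ a₂ => a₁.run ℓ ∘ a₂.run ℓ

/-- Labels: pairs of a guard and an action. -/
abbrev Label (n m : ℕ) := Guard n m × Action n m

/-- The common shape `⟨Q, q₀, s₀, δ, F⟩` of the two kinds of automata, with transitions
decorated by elements of `D`. -/
structure Automaton (V : Type*) (m : ℕ) (D : Type) where
  /-- the states -/
  Q : Type
  /-- there are finitely many states -/
  finite_Q : Finite Q
  /-- the initial state -/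
  q₀ : Q
  /-- the initial store -/
  s₀ : Store V m
  /-- the transition relation -/
  δ : Set (Q × D × Q)
  /-- there are finitely many transitions -/
  finite_δ : δ.Finite
  /-- the final states -/
  F : Set Q

/-- TOPL automata with `m` registers, operating on `n`-tuples. -/
abbrev LowAutomaton (V : Type*) (n m : ℕ) := Automaton V m (Label n m)

/-- High-level TOPL (hl-TOPL) automata with `m` registers, operating on `n`-tuples:
the transitions carry words of labels. -/
abbrev HighAutomaton (V : Type*) (n m : ℕ) := Automaton V m (List (Label n m))

/-- Configurations: a state and a store. -/
abbrev Automaton.Config {V : Type*} {m : ℕ} {D : Type} (A : Automaton V m D) :=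
  A.Q × Store V m

/-! ### The language of a TOPL automaton -/

/-- The configuration graph of a TOPL automaton. -/
def LowAutomaton.Step {V : Type*} {n m : ℕ} (A : LowAutomaton V n m)
    (x₁ : A.Config) (ℓ : Letter V n) (x₂ : A.Config) : Prop :=
  ∃ (g : Guard n m) (a : Action n m),
    (x₁.1, (g, a), x₂.1) ∈ A.δ ∧ g.Sat x₁.2 ℓ ∧ a.run ℓ x₁.2 = x₂.2

/-- Walks in the configuration graph, with the word that labels them. -/
inductive LowAutomaton.Walk {V : Type*} {n m : ℕ} (A : LowAutomaton V n m) :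
    A.Config → List (Letter V n) → A.Config → Prop
  | nil (x : A.Config) : LowAutomaton.Walk A x [] x
  | cons {x y z : A.Config} {ℓ : Letter V n} {w : List (Letter V n)} :
      LowAutomaton.Step A x ℓ y → LowAutomaton.Walk A y w z → LowAutomaton.Walk A x (ℓ :: w) z

/-- The language of a TOPL automaton. -/
def LowAutomaton.language {V : Type*} {n m : ℕ} (A : LowAutomaton V n m) :
    Language (Letter V n) :=
  {w | ∃ x : A.Config, LowAutomaton.Walk A (A.q₀, A.s₀) w x ∧ x.1 ∈ A.F}

/-! ### The language of a high-level TOPL automaton -/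

/-- `AcceptsWith s lab w s'`: the linear TOPL automaton with states `0, …, d`, initial state `0`,
final state `d`, initial store `s`, and transitions `(i - 1, lab i, i)`, can accept `w` with
store `s'`. -/
def AcceptsWith {V : Type*} {n m : ℕ} :
    Store V m → List (Label n m) → List (Letter V n) → Store V m → Prop
  | s, [], [], s' => s = s'
  | s, (g, a) :: lab, ℓ :: w, s' => g.Sat s ℓ ∧ AcceptsWith (a.run ℓ s) lab w s'
  | _, _, _, _ => False

/-- High-level configurations: a configuration and the word that is yet to be processed. -/
abbrev HighAutomaton.HConfig {V : Type*} {n m : ℕ} (A : HighAutomaton V n m) :=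
  A.Config × List (Letter V n)

/-- Standard transitions. -/
def HighAutomaton.Standard {V : Type*} {n m : ℕ} (A : HighAutomaton V n m)
    (y₁ : HighAutomaton.HConfig A) (w : List (Letter V n))
    (y₂ : HighAutomaton.HConfig A) : Prop :=
  y₁.2 = w ++ y₂.2 ∧ ∃ lab : List (Label n m),
    (y₁.1.1, lab, y₂.1.1) ∈ A.δ ∧ AcceptsWith y₁.1.2 lab w y₂.1.2

/-- Skip transitions: one letter is dropped when no standard transition is available. -/
def HighAutomaton.Skip {V : Type*} {n m : ℕ} (A : HighAutomaton V n m)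
    (y₁ : HighAutomaton.HConfig A) (w : List (Letter V n))
    (y₂ : HighAutomaton.HConfig A) : Prop :=
  (∃ ℓ : Letter V n, w = [ℓ] ∧ y₁.2 = ℓ :: y₂.2) ∧ y₁.1 = y₂.1 ∧
    ¬ ∃ (w' : List (Letter V n)) (y : HighAutomaton.HConfig A),
      HighAutomaton.Standard A y₁ w' y

/-- Paths in the high-level configuration graph, with the word that labels them. -/
inductive HighAutomaton.Path {V : Type*} {n m : ℕ} (A : HighAutomaton V n m) :
    HighAutomaton.HConfig A → List (Letter V n) → HighAutomaton.HConfig A → Prop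
  | nil (y : HighAutomaton.HConfig A) : HighAutomaton.Path A y [] y
  | cons {y₁ y₂ y₃ : HighAutomaton.HConfig A} {w w' : List (Letter V n)} :
      (HighAutomaton.Standard A y₁ w y₂ ∨ HighAutomaton.Skip A y₁ w y₂) →
      HighAutomaton.Path A y₂ w' y₃ → HighAutomaton.Path A y₁ (w ++ w') y₃

/-- The language of a high-level TOPL automaton: the words that label paths from an initial
high-level configuration to a final one. -/
def HighAutomaton.language {V : Type*} {n m : ℕ} (A : HighAutomaton V n m) :
    Language (Letter V n) :=
  {w | ∃ (v : List (Letter V n)) (x : A.Config),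
    HighAutomaton.Path A ((A.q₀, A.s₀), v) w (x, []) ∧ x.1 ∈ A.F}

/-- The languages over `V ^ n` of TOPL automata (with any number of registers). -/
def lowLanguages (V : Type*) (n : ℕ) : Set (Language (Letter V n)) :=
  {L | ∃ (m : ℕ) (A : LowAutomaton V n m), LowAutomaton.language A = L}

/-- The languages over `V ^ n` of hl-TOPL automata (with any number of registers). -/
def highLanguages (V : Type*) (n : ℕ) : Set (Language (Letter V n)) :=
  {L | ∃ (m : ℕ) (A : HighAutomaton V n m), HighAutomaton.language A = L}

/-! ### Automata and words as inputs of algorithms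

An algorithm receives an automaton as a finite description: guards and actions are written out in
prefix notation, states are numbered, the transitions and the final states are listed in any
order, and the values in the initial store are given by names, which are natural numbers. -/

/-- A guard in prefix notation, as a list of symbols. -/
def Guard.code {n m : ℕ} : Guard n m → List (ℕ × ℕ × ℕ)
  | .eq i j => [(0, i.val, j.val)]
  | .neq i j => [(1, i.val, j.val)]
  | .triv => [(2, 0, 0)]
  | .and g₁ g₂ => (3, 0, 0) :: (g₁.code ++ g₂.code)

/-- An action in prefix notation, as a list of symbols. -/
def Action.code {n m : ℕ} : Action n m → List (ℕ × ℕ × ℕ)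
  | .nop => [(0, 0, 0)]
  | .set i j => [(1, i.val, j.val)]
  | .seq a₁ a₂ => (2, 0, 0) :: (a₁.code ++ a₂.code)

/-- Written labels. -/
abbrev LabelCode := List (ℕ × ℕ × ℕ) × List (ℕ × ℕ × ℕ)

/-- A label, written out. -/
def labelCode {n m : ℕ} (l : Label n m) : LabelCode := (l.1.code, l.2.code)

/-- Descriptions of automata, where `C` is the type of written transition decorations:
arity, number of registers and number of states; initial state; initial store; transitions;
final states. -/
abbrev AutomatonCode (C : Type) :=
  (ℕ × ℕ × ℕ) × ℕ × List ℕ × List (ℕ × C × ℕ) × List ℕ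

/-- `A.HasCode name n enc c`: `c` describes the automaton `A`, where `name` assigns to each name
the value that it stands for, `n` is the arity, and `enc` writes out decorations. -/
def Automaton.HasCode {V : Type*} {m : ℕ} {D C : Type} (A : Automaton V m D)
    (name : ℕ → V) (n : ℕ) (enc : D → C) (c : AutomatonCode C) : Prop :=
  ∃ (k : ℕ) (e : A.Q ≃ Fin k) (s : Fin m → ℕ)
    (δ : List (A.Q × D × A.Q)) (F : List A.Q),
    (∀ i, name (s i) = A.s₀ i) ∧ (∀ t, t ∈ δ ↔ t ∈ A.δ) ∧ (∀ q, q ∈ F ↔ q ∈ A.F) ∧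
    c = ((n, m, k), (e A.q₀).val, List.ofFn s,
      δ.map (fun t => ((e t.1).val, enc t.2.1, (e t.2.2).val)),
      F.map (fun q => (e q).val))

/-- `c` describes a TOPL automaton over `V ^ n` with language `L`. -/
def LowDescribes {V : Type*} (name : ℕ → V) (n : ℕ) (c : AutomatonCode LabelCode)
    (L : Language (Letter V n)) : Prop :=
  ∃ (m : ℕ) (A : LowAutomaton V n m),
    A.HasCode name n labelCode c ∧ LowAutomaton.language A = L

/-- `c` describes an hl-TOPL automaton over `V ^ n` with language `L`. -/
def HighDescribes {V : Type*} (name : ℕ → V) (n : ℕ) (c : AutomatonCode (List LabelCode))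
    (L : Language (Letter V n)) : Prop :=
  ∃ (m : ℕ) (A : HighAutomaton V n m),
    A.HasCode name n (List.map labelCode) c ∧ HighAutomaton.language A = L

/-- `u` describes the word `w`: each letter is given by the list of names of its components. -/
def WordDescribes {V : Type*} (name : ℕ → V) {n : ℕ} (u : List (List ℕ))
    (w : List (Letter V n)) : Prop :=
  u.map (List.map name) = w.map List.ofFn

/-! ### Decision problems

Below, `D n c L` says that the input `c` describes an automaton of the class at hand, over
`n`-tuples, with language `L`. In the emptiness and membership problems the arity is part of the
input; the other problems are those for automata over `n`-tuples with `n` fixed (and `D` is the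
relation for that `n`). In all problems the number of registers is part of the input. -/

/-- There is an algorithm that decides whether the language of a given automaton is empty. -/
def EmptinessDecidable {V : Type*} {C : Type} [Primcodable C]
    (D : (n : ℕ) → AutomatonCode C → Language (Letter V n) → Prop) : Prop :=
  ∃ f : AutomatonCode C → Bool, Computable f ∧
    ∀ n c L, D n c L → (f c = true ↔ ∀ w, w ∉ L)

/-- There is an algorithm that decides whether a given automaton accepts a given word. -/
def MembershipDecidable {V : Type*} (name : ℕ → V) {C : Type} [Primcodable C]
    (D : (n : ℕ) → AutomatonCode C → Language (Letter V n) → Prop) : Prop :=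
  ∃ f : AutomatonCode C × List (List ℕ) → Bool, Computable f ∧
    ∀ n c L u w, D n c L → WordDescribes name u w → (f (c, u) = true ↔ w ∈ L)

/-- There is an algorithm that decides whether the language of a given automaton is included in
the language of another one. -/
def InclusionDecidable {V : Type*} {n : ℕ} {C : Type} [Primcodable C]
    (D : AutomatonCode C → Language (Letter V n) → Prop) : Prop :=
  ∃ f : AutomatonCode C × AutomatonCode C → Bool, Computable f ∧
    ∀ c₁ L₁ c₂ L₂, D c₁ L₁ → D c₂ L₂ → (f (c₁, c₂) = true ↔ ∀ w, w ∈ L₁ → w ∈ L₂)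

/-- There is an algorithm that decides whether two given automata have the same language. -/
def EquivalenceDecidable {V : Type*} {n : ℕ} {C : Type} [Primcodable C]
    (D : AutomatonCode C → Language (Letter V n) → Prop) : Prop :=
  ∃ f : AutomatonCode C × AutomatonCode C → Bool, Computable f ∧
    ∀ c₁ L₁ c₂ L₂, D c₁ L₁ → D c₂ L₂ → (f (c₁, c₂) = true ↔ L₁ = L₂)

/-- There is an algorithm that decides whether a given automaton accepts all words. -/
def UniversalityDecidable {V : Type*} {n : ℕ} {C : Type} [Primcodable C]
    (D : AutomatonCode C → Language (Letter V n) → Prop) : Prop :=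
  ∃ f : AutomatonCode C → Bool, Computable f ∧
    ∀ c L, D c L → (f c = true ↔ ∀ w, w ∈ L)

/-! ### Closure properties -/

/-- A class of languages is closed under union, intersection, concatenation and Kleene star. -/
def ClosedUnderRegularOperations {α : Type*} (R : Set (Language α)) : Prop :=
  (∀ L₁ ∈ R, ∀ L₂ ∈ R, L₁ + L₂ ∈ R) ∧
  (∀ L₁ ∈ R, ∀ L₂ ∈ R, L₁ ⊓ L₂ ∈ R) ∧
  (∀ L₁ ∈ R, ∀ L₂ ∈ R, L₁ * L₂ ∈ R) ∧
  (∀ L ∈ R, KStar.kstar L ∈ R)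

/-- A class of languages is closed under complementation. -/
def ClosedUnderComplement {α : Type*} (R : Set (Language α)) : Prop :=
  ∀ L ∈ R, Lᶜ ∈ R

end TOPL

namespace TOPL

variable {V : Type*} {n m : ℕ}

/-! ### Acceptance as an inductive predicate on high-level configurations -/

/-! Guards only compare registers with components of the letter, so whether a transition is enabled
depends only on the finite pattern of equalities between the store and the letter
(`Guard.holds_pattern`). This finiteness is the source of the positive results and of the failure of
complementation.

Comparison of the two models. A letter may be skipped only if no standard transition is enabled, and
this concerns only the next `d` letters, where `d` bounds the lengths of the labels. Hence an
hl-TOPL automaton can be run with a buffer of `d` letters (`LAcc`). The buffered letters are kept in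
additional registers, together with the pattern observed when each of them was read, and their
guards are evaluated later on the recorded patterns. The result is a register system with
spontaneous moves, which are then eliminated. Conversely, a sink that every letter can reach ensures
that nothing is ever skipped. So the two classes of languages coincide
(`highLanguages_eq_lowLanguages`), and the closure properties need a proof only for TOPL automata.

Closure. Union and concatenation put two systems on disjoint registers, and intersection is a
synchronous product. For the star the initial store has to be restored at each restart, so a second
copy of the registers keeps it. For complementation, an automaton can guess a value and wait for its
repetition, but no automaton recognizes the words without repetition: `m` registers forget one of `m
+ 1` distinct values, and the forgotten value then has the same pattern as a fresh one.

Undecidability. A halting computation of a stack machine is written as a data word in which the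
stacks are linked lists of values. Finitely many registers suffice to accept every word that is not
such a history: the automaton follows the tops of the stacks, guesses one push, saves its node,
letter and successor, and later catches a look at that node that disagrees. All words are accepted
iff the machine does not halt (`History.forall_acc_iff`). The machine is a fixed one with
undecidable halting set, and its input is loaded by additional states, so the automaton depends on
the input in a primitive recursive way. It is complete, so it has the same language when read as an
hl-TOPL automaton.

Decidability. Only the values in the store and in the buffer matter, and only up to an injective
renaming. A pool with at least `m + d * n` values therefore suffices for emptiness, which becomes
reachability in a graph whose reachable sets are finite (`exists_computable_reachable`). For
membership the search starts with the whole word in the buffer. The flag `b` of `Acc` covers both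
models, with and without skipping. -/

/-- Some transition of `A` is enabled in the configuration `(q, s)`, on a prefix of `u`. -/
def HighAutomaton.Enabled (A : HighAutomaton V n m) (q : A.Q) (s : Store V m)
    (u : List (Letter V n)) : Prop :=
  ∃ lab q' v s' u', (q, lab, q') ∈ A.δ ∧ AcceptsWith s lab v s' ∧ u = v ++ u'

/-- Acceptance of a word from a configuration; letters may be skipped only if `b` is set. -/
inductive HighAutomaton.Acc (A : HighAutomaton V n m) (b : Bool) :
    A.Q → Store V m → List (Letter V n) → Prop
  | fin {q : A.Q} {s : Store V m} : q ∈ A.F → HighAutomaton.Acc A b q s []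
  | std {q q' : A.Q} {s s' : Store V m} {lab : List (Label n m)} {v w : List (Letter V n)} :
      (q, lab, q') ∈ A.δ → AcceptsWith s lab v s' → HighAutomaton.Acc A b q' s' w →
      HighAutomaton.Acc A b q s (v ++ w)
  | skip {q : A.Q} {s : Store V m} {ℓ : Letter V n} {w : List (Letter V n)} :
      b = true → ¬ HighAutomaton.Enabled A q s (ℓ :: w) → HighAutomaton.Acc A b q s w →
      HighAutomaton.Acc A b q s (ℓ :: w)

theorem HighAutomaton.exists_standard_iff (A : HighAutomaton V n m)
    (y : HighAutomaton.HConfig A) :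
    (∃ w' y', HighAutomaton.Standard A y w' y') ↔ HighAutomaton.Enabled A y.1.1 y.1.2 y.2 := by
  constructor
  · rintro ⟨w', y', h, lab, h1, h2⟩
    exact ⟨lab, y'.1.1, w', y'.1.2, y'.2, h1, h2, h⟩
  · rintro ⟨lab, q', v, s', u', h1, h2, h3⟩
    exact ⟨v, ((q', s'), u'), h3, lab, h1, h2⟩

/-- Each step is labelled by exactly the prefix that it consumes. A path that leaves nothing to
process is therefore labelled by its whole initial word, so the two words in the definition of the
language coincide. -/
theorem HighAutomaton.Path.acc {A : HighAutomaton V n m} {y z : HighAutomaton.HConfig A}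
    {w : List (Letter V n)} (h : HighAutomaton.Path A y w z) (hz : z.2 = []) (hF : z.1.1 ∈ A.F) :
    w = y.2 ∧ HighAutomaton.Acc A true y.1.1 y.1.2 y.2 := by
  induction h with
  | nil y => rw [hz]; exact ⟨rfl, .fin hF⟩
  | cons h1 h2 ih =>
    obtain ⟨hw, h'⟩ := ih hz hF
    subst hw
    rcases h1 with ⟨h1, lab, h3, h4⟩ | ⟨⟨ℓ, rfl, h3⟩, h4, h5⟩
    · rw [h1]
      exact ⟨rfl, .std h3 h4 h'⟩
    · rw [HighAutomaton.exists_standard_iff, h3, h4] at h5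
      rw [h3, h4]
      exact ⟨rfl, .skip rfl h5 h'⟩

theorem HighAutomaton.Acc.path {A : HighAutomaton V n m} {q : A.Q} {s : Store V m}
    {w : List (Letter V n)} (h : HighAutomaton.Acc A true q s w) :
    ∃ x : A.Config, HighAutomaton.Path A ((q, s), w) w (x, []) ∧ x.1 ∈ A.F := by
  induction h with
  | fin h => exact ⟨_, .nil _, h⟩
  | std h1 h2 _ ih =>
    obtain ⟨x, h3, h4⟩ := ih
    exact ⟨x, .cons (.inl ⟨rfl, _, h1, h2⟩) h3, h4⟩
  | @skip q s ℓ w _ h2 _ ih =>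
    obtain ⟨x, h3, h4⟩ := ih
    refine ⟨x, .cons (w := [ℓ]) (y₂ := ((q, s), w)) (.inr ⟨⟨ℓ, rfl, rfl⟩, rfl, ?_⟩) h3, h4⟩
    rwa [HighAutomaton.exists_standard_iff]

theorem HighAutomaton.mem_language_iff (A : HighAutomaton V n m) (w : List (Letter V n)) :
    w ∈ HighAutomaton.language A ↔ HighAutomaton.Acc A true A.q₀ A.s₀ w := by
  constructor
  · rintro ⟨v, x, h1, h2⟩
    obtain ⟨rfl, h⟩ := h1.acc rfl h2
    exact h
  · intro h
    obtain ⟨x, h⟩ := h.path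
    exact ⟨w, x, h⟩

/-- A TOPL automaton, with its labels seen as words of length one. -/
def LowAutomaton.toHigh (A : LowAutomaton V n m) : HighAutomaton V n m where
  Q := A.Q
  finite_Q := A.finite_Q
  q₀ := A.q₀
  s₀ := A.s₀
  δ := (fun t => (t.1, [t.2.1], t.2.2)) '' A.δ
  finite_δ := A.finite_δ.image _
  F := A.F

theorem LowAutomaton.mem_toHigh_δ (A : LowAutomaton V n m) {q q' : A.Q}
    {lab : List (Label n m)} :
    (q, lab, q') ∈ A.toHigh.δ ↔ ∃ l, lab = [l] ∧ (q, l, q') ∈ A.δ := by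
  constructor
  · rintro ⟨⟨q, l, q'⟩, h, h'⟩
    cases h'
    exact ⟨l, rfl, h⟩
  · rintro ⟨l, rfl, h⟩
    exact ⟨_, h, rfl⟩

theorem acceptsWith_singleton {s s' : Store V m} {l : Label n m} {v : List (Letter V n)} :
    AcceptsWith s [l] v s' ↔ ∃ ℓ, v = [ℓ] ∧ l.1.Sat s ℓ ∧ l.2.run ℓ s = s' := by
  obtain ⟨g, a⟩ := l
  rcases v with _ | ⟨ℓ, _ | ⟨ℓ', v⟩⟩ <;> simp [AcceptsWith]

/-- Labels of length one consume one letter each, so the TOPL semantics is the high-level semantics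
with skipping forbidden. -/
theorem LowAutomaton.mem_language_iff (A : LowAutomaton V n m) (w : List (Letter V n)) :
    w ∈ LowAutomaton.language A ↔ HighAutomaton.Acc A.toHigh false A.q₀ A.s₀ w := by
  constructor
  · rintro ⟨x, h, hF⟩
    change HighAutomaton.Acc A.toHigh false (A.q₀, A.s₀).1 (A.q₀, A.s₀).2 w
    generalize (A.q₀, A.s₀) = y at h ⊢
    induction h with
    | nil x => exact .fin hF
    | cons h1 _ ih =>
      obtain ⟨g, a, h1, h2, h3⟩ := h1
      exact .std (v := [_]) (A.mem_toHigh_δ.2 ⟨_, rfl, h1⟩)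
        (acceptsWith_singleton.2 ⟨_, rfl, h2, h3⟩) (ih hF)
  · suffices ∀ (q : A.toHigh.Q) s, HighAutomaton.Acc A.toHigh false q s w →
        ∃ x : A.Config, LowAutomaton.Walk A (q, s) w x ∧ x.1 ∈ A.F from this _ _
    intro q s h
    induction h with
    | fin h => exact ⟨_, .nil _, h⟩
    | std h1 h2 _ ih =>
      obtain ⟨x, h3, h4⟩ := ih
      obtain ⟨⟨g, a⟩, rfl, h0⟩ := A.mem_toHigh_δ.1 h1
      obtain ⟨ℓ, rfl, h5, h6⟩ := acceptsWith_singleton.1 h2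
      exact ⟨x, .cons ⟨_, _, h0, h5, h6⟩ h3, h4⟩
    | skip h => cases h

/-! ### Acceptance with a bounded look-ahead -/

theorem AcceptsWith.length_eq {s s' : Store V m} {lab : List (Label n m)}
    {w : List (Letter V n)} (h : AcceptsWith s lab w s') : w.length = lab.length := by
  induction lab generalizing s w with
  | nil => cases w with
    | nil => rfl
    | cons => exact h.elim
  | cons l lab ih => cases w with
    | nil => obtain ⟨g, a⟩ := l; exact h.elim
    | cons ℓ w => obtain ⟨g, a⟩ := l; simp [ih h.2]

/-- Acceptance with a buffer of at most `d` letters: the word is first read into the buffer `u`, and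
a transition is taken only if the buffer has `d` letters or (when the flag is set) if the whole
word has been read. -/
inductive HighAutomaton.LAcc (A : HighAutomaton V n m) (b : Bool) (d : ℕ) :
    A.Q → Store V m → List (Letter V n) → Bool → List (Letter V n) → Prop
  | fin {q s} : q ∈ A.F → HighAutomaton.LAcc A b d q s [] true []
  | close {q s u} : HighAutomaton.LAcc A b d q s u true [] →
      HighAutomaton.LAcc A b d q s u false []
  | read {q s u ℓ w} : u.length < d → HighAutomaton.LAcc A b d q s (u ++ [ℓ]) false w →
      HighAutomaton.LAcc A b d q s u false (ℓ :: w)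
  | std {q q' s s' lab v u e w} : (e = true ∨ d ≤ (v ++ u).length) → (q, lab, q') ∈ A.δ →
      AcceptsWith s lab v s' → HighAutomaton.LAcc A b d q' s' u e w →
      HighAutomaton.LAcc A b d q s (v ++ u) e w
  | skip {q s ℓ u e w} : b = true → (e = true ∨ d ≤ (ℓ :: u).length) →
      ¬ HighAutomaton.Enabled A q s (ℓ :: u) → HighAutomaton.LAcc A b d q s u e w →
      HighAutomaton.LAcc A b d q s (ℓ :: u) e w

theorem HighAutomaton.Enabled.append {A : HighAutomaton V n m} {q : A.Q} {s : Store V m}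
    {u : List (Letter V n)} (h : A.Enabled q s u) (w : List (Letter V n)) :
    A.Enabled q s (u ++ w) := by
  obtain ⟨lab, q', v, s', u', h1, h2, rfl⟩ := h
  exact ⟨lab, q', v, s', u' ++ w, h1, h2, by simp⟩

/-- No label is longer than `d`, so letters after the first `d` have no influence. This makes the
negative condition of a skip checkable with finite memory. -/
theorem HighAutomaton.enabled_append_iff {A : HighAutomaton V n m} {d : ℕ}
    (hd : ∀ q lab q', (q, lab, q') ∈ A.δ → lab.length ≤ d) {q : A.Q} {s : Store V m}
    {u w : List (Letter V n)} (h : w = [] ∨ d ≤ u.length) :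
    A.Enabled q s (u ++ w) ↔ A.Enabled q s u := by
  refine ⟨?_, fun h => h.append w⟩
  rintro ⟨lab, q', v, s', u', h1, h2, h3⟩
  rcases h with rfl | h
  · exact ⟨lab, q', v, s', u', h1, h2, by simpa using h3⟩
  · have : v <+: u := by
      refine List.prefix_of_prefix_length_le ⟨u', h3.symm⟩ ⟨w, rfl⟩ ?_
      rw [h2.length_eq]
      exact (hd _ _ _ h1).trans h
    obtain ⟨t, rfl⟩ := this
    exact ⟨lab, q', v, s', t, h1, h2, rfl⟩

/-- A skip happens only when the buffer is full or holds all that is left, and then being enabled on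
the buffer is the same as being enabled on the remaining word. -/
theorem HighAutomaton.LAcc.acc {A : HighAutomaton V n m} {b : Bool} {d : ℕ}
    (hd : ∀ q lab q', (q, lab, q') ∈ A.δ → lab.length ≤ d)
    {q : A.Q} {s : Store V m} {u w : List (Letter V n)} {e : Bool}
    (h : A.LAcc b d q s u e w) : (e = true → w = []) ∧ A.Acc b q s (u ++ w) := by
  induction h with
  | fin h => exact ⟨fun _ => rfl, .fin h⟩
  | close _ ih => exact ⟨fun _ => rfl, ih.2⟩
  | read _ _ ih => exact ⟨by simp, by simpa using ih.2⟩
  | std _ h1 h2 _ ih => exact ⟨ih.1, by rw [List.append_assoc]; exact .std h1 h2 ih.2⟩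
  | @skip q s ℓ u e w hb h1 h2 _ ih =>
    refine ⟨ih.1, .skip hb ?_ ih.2⟩
    change ¬ A.Enabled q s (ℓ :: (u ++ w))
    rw [← List.cons_append, HighAutomaton.enabled_append_iff hd (h1.imp_left ih.1)]
    exact h2

/-- It suffices to consider buffers that are full or hold all that is left of the word. -/
theorem HighAutomaton.lacc_of_ready {A : HighAutomaton V n m} {b : Bool} {d : ℕ}
    {q : A.Q} {s : Store V m} {W : List (Letter V n)}
    (H : ∀ u e w, u ++ w = W → (e = true → w = []) → u.length ≤ d → (e = true ∨ d ≤ u.length) →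
      A.LAcc b d q s u e w)
    {u w : List (Letter V n)} {e : Bool} (h : u ++ w = W) (he : e = true → w = [])
    (hu : u.length ≤ d) : A.LAcc b d q s u e w := by
  induction w generalizing u e with
  | nil =>
    cases e with
    | true => exact H _ _ _ h he hu (.inl rfl)
    | false => exact .close (H _ _ _ h (fun _ => rfl) hu (.inl rfl))
  | cons ℓ w ih =>
    by_cases h' : e = true ∨ d ≤ u.length
    · exact H _ _ _ h he hu h'
    · push Not at h'
      obtain ⟨h1, h2⟩ := h'
      obtain rfl : e = false := by simpa using h1
      exact .read h2 (ih (by simpa using h) (by simp) (by simp; omega))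

/-- With the flag set the buffer may have any length; this case serves the membership problem, where
the whole word is buffered from the start. The bound `1 ≤ d` ensures that a buffer that is full is
not empty. -/
theorem HighAutomaton.Acc.lacc {A : HighAutomaton V n m} {b : Bool} {d : ℕ} (hd1 : 1 ≤ d)
    (hd : ∀ q lab q', (q, lab, q') ∈ A.δ → lab.length ≤ d)
    {q : A.Q} {s : Store V m} {W : List (Letter V n)} (h : A.Acc b q s W)
    {u w : List (Letter V n)} {e : Bool} (hW : u ++ w = W) (he : e = true → w = [])
    (hu : u.length ≤ d ∨ e = true) : A.LAcc b d q s u e w := by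
  have key : ∀ {q s W}, (∀ u e w, u ++ w = W → (e = true → w = []) →
      (u.length ≤ d ∨ e = true) → (e = true ∨ d ≤ u.length) → A.LAcc b d q s u e w) →
      ∀ {u w : List (Letter V n)} {e : Bool}, u ++ w = W → (e = true → w = []) →
      (u.length ≤ d ∨ e = true) → A.LAcc b d q s u e w := by
    intro q s W H u w e h1 h2 h3
    rcases h3 with h3 | h3
    · exact HighAutomaton.lacc_of_ready (fun u e w a b f c => H u e w a b (.inl f) c) h1 h2 h3
    · exact H _ _ _ h1 h2 (.inr h3) (.inl h3)
  induction h generalizing u e w with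
  | fin h =>
    refine key (fun u e w hW he _ hr => ?_) hW he hu
    obtain ⟨rfl, rfl⟩ := List.append_eq_nil_iff.1 hW
    obtain rfl : e = true := hr.resolve_right (by simp; omega)
    exact .fin h
  | @std q q' s s' lab v w' h1 h2 _ ih =>
    refine key (fun u e w hW he hu hr => ?_) hW he hu
    -- The buffer contains all of `v`: it either holds the whole remaining word or has at least `d`
    -- letters, and `v` is as long as a label.
    have : v <+: u := by
      rcases hr with hr | hr
      · rw [he hr, List.append_nil] at hW
        exact ⟨_, hW.symm⟩
      · refine List.prefix_of_prefix_length_le ⟨w', hW.symm⟩ ⟨w, rfl⟩ ?_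
        rw [h2.length_eq]
        exact (hd _ _ _ h1).trans hr
    obtain ⟨t, rfl⟩ := this
    rw [List.append_assoc, List.append_cancel_left_eq] at hW
    exact .std hr h1 h2 (ih hW he (hu.imp_left fun h => by simp at h; omega))
  | @skip q s ℓ w' hb h1 _ ih =>
    refine key (fun u e w hW he hu hr => ?_) hW he hu
    cases u with
    | nil =>
      have := he (hr.resolve_right (by simp; omega))
      simp [this] at hW
    | cons ℓ' u =>
      obtain ⟨rfl, rfl⟩ : ℓ' = ℓ ∧ u ++ w = w' := by simpa using hW
      exact .skip hb hr (fun h => h1 (h.append w))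
        (ih rfl he (hu.imp_left fun h => by simp at h; omega))

end TOPL

namespace TOPL

/-! ### Guards and actions through patterns -/

/-- The equalities between the registers and the components of a letter. -/
def pattern {V X : Type*} {n : ℕ} (s : X → V) (ℓ : Letter V n) : Set (X × Fin n) :=
  {p | s p.1 = ℓ p.2}

/-- The registers `x` with `wr x = some j` are set to the component `j` of the letter. -/
def writeTo {V X : Type*} {n : ℕ} (ℓ : Letter V n) (wr : X → Option (Fin n)) (s : X → V) : X → V :=
  fun x => (wr x).elim (s x) ℓ

section
variable {V : Type*} {n m : ℕ}

/-- Whether a guard holds depends only on the pattern of the store and the letter. -/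
def Guard.Holds (T : Set (Fin m × Fin n)) : Guard n m → Prop
  | .eq i j => (i, j) ∈ T
  | .neq i j => (i, j) ∉ T
  | .triv => True
  | .and g₁ g₂ => g₁.Holds T ∧ g₂.Holds T

theorem Guard.holds_pattern (s : Store V m) (ℓ : Letter V n) (g : Guard n m) :
    g.Holds (pattern s ℓ) ↔ g.Sat s ℓ := by
  induction g with
  | eq i j => rfl
  | neq i j => rfl
  | triv => rfl
  | and g₁ g₂ h₁ h₂ => exact and_congr h₁ h₂

/-- The registers written by an action. -/
def Action.writes : Action n m → Fin m → Option (Fin n)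
  | .nop => fun _ => none
  | .set i j => Function.update (fun _ => none) i (some j)
  | .seq a₁ a₂ => fun x => (a₁.writes x).or (a₂.writes x)

/-- In a sequence the second action runs first, so the writes of the first one take precedence; this
explains the order in `Option.or`. Written values come from the letter and never from the store, so
writes compose without interference. -/
theorem Action.run_eq (ℓ : Letter V n) (a : Action n m) (s : Store V m) :
    a.run ℓ s = writeTo ℓ a.writes s := by
  induction a generalizing s with
  | nop => rfl
  | set i j =>
    funext x
    by_cases h : x = i
    · subst h; simp [Action.run, writeTo, Action.writes]
    · simp [Action.run, writeTo, Action.writes, h]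
  | seq a₁ a₂ h₁ h₂ =>
    funext x
    simp only [Action.run, Function.comp_apply, h₁, h₂, writeTo, Action.writes]
    cases a₁.writes x <;> rfl

/-- The conjunction of a list of guards. -/
def Guard.conj : List (Guard n m) → Guard n m
  | [] => .triv
  | g :: l => .and g (Guard.conj l)

theorem Guard.sat_conj (s : Store V m) (ℓ : Letter V n) (l : List (Guard n m)) :
    (Guard.conj l).Sat s ℓ ↔ ∀ g ∈ l, g.Sat s ℓ := by
  induction l with
  | nil => simp [Guard.conj, Guard.Sat]
  | cons g l ih => simp [Guard.conj, Guard.Sat, ih]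

open Classical in
/-- The guard that prescribes the pattern. -/
noncomputable def Guard.ofPattern (T : Set (Fin m × Fin n)) : Guard n m :=
  Guard.conj ((Finset.univ : Finset (Fin m × Fin n)).toList.map
    fun p => if p ∈ T then .eq p.1 p.2 else .neq p.1 p.2)

theorem Guard.sat_ofPattern (T : Set (Fin m × Fin n)) (s : Store V m) (ℓ : Letter V n) :
    (Guard.ofPattern T).Sat s ℓ ↔ pattern s ℓ = T := by
  rw [Guard.ofPattern, Guard.sat_conj, Set.ext_iff]
  simp only [List.forall_mem_map, Finset.mem_toList, Finset.mem_univ, true_imp_iff]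
  refine forall_congr' fun p => ?_
  by_cases h : p ∈ T <;> simp [h, Guard.Sat, pattern]

/-- The action that performs given writes. -/
def Action.ofWrites (wr : Fin m → Option (Fin n)) : Action n m :=
  (List.finRange m).foldr
    (fun x a => (wr x).elim a fun j => .seq (.set x j) a) .nop

theorem Action.run_ofWrites (wr : Fin m → Option (Fin n)) (ℓ : Letter V n) (s : Store V m) :
    (Action.ofWrites wr).run ℓ s = writeTo ℓ wr s := by
  have key : ∀ (l : List (Fin m)) (x : Fin m),
      (l.foldr (fun x a => (wr x).elim a fun j => Action.seq (.set x j) a) .nop).run ℓ s x =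
        if x ∈ l then writeTo ℓ wr s x else s x := by
    intro l x
    induction l with
    | nil => rfl
    | cons y l ih =>
      rw [List.foldr_cons]
      by_cases hy : x = y
      · subst hy
        cases h : wr x with
        | none => simp [ih, writeTo, h]
        | some j => simp [Action.run, writeTo, h]
      · cases h : wr y with
        | none => simp [ih, hy]
        | some j => simp [Action.run, hy, ih]
  funext x
  rw [Action.ofWrites, key, if_pos (List.mem_finRange x)]

end

/-! ### Symbolic register systems -/

/-- Acceptance of a word from a configuration, for given transitions, spontaneous moves and final
states. -/
inductive Accepts {V : Type*} {n : ℕ} {Q X : Type}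
    (Δ : Q → Set (X × Fin n) → (X → Option (Fin n)) → Q → Prop) (ε : Q → Q → Prop) (F : Set Q) :
    Q → (X → V) → List (Letter V n) → Prop
  | fin {q s} : q ∈ F → Accepts Δ ε F q s []
  | eps {q q' s w} : ε q q' → Accepts Δ ε F q' s w → Accepts Δ ε F q s w
  | read {q q' s ℓ wr w} : Δ q (pattern s ℓ) wr q' → Accepts Δ ε F q' (writeTo ℓ wr s) w →
      Accepts Δ ε F q s (ℓ :: w)

/-- A register automaton whose transitions are given by the pattern that they require and the
writes that they perform, with spontaneous moves that leave the registers alone. -/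
structure RegisterSystem (V : Type*) (n : ℕ) where
  /-- the states -/
  Q : Type
  /-- the registers -/
  X : Type
  finite_Q : Finite Q
  finite_X : Finite X
  /-- the initial state -/
  q₀ : Q
  /-- the initial store -/
  s₀ : X → V
  /-- the transitions that read a letter -/
  Δ : Q → Set (X × Fin n) → (X → Option (Fin n)) → Q → Prop
  /-- the spontaneous moves -/
  ε : Q → Q → Prop
  /-- the final states -/
  F : Set Q

namespace RegisterSystem

variable {V : Type*} {n : ℕ}

/-- Acceptance of a word from a configuration of a system. -/
abbrev Acc (S : RegisterSystem V n) : S.Q → (S.X → V) → List (Letter V n) → Prop :=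
  Accepts S.Δ S.ε S.F

/-- The language of a system. -/
def language (S : RegisterSystem V n) : Language (Letter V n) := {w | S.Acc S.q₀ S.s₀ w}

theorem mem_language (S : RegisterSystem V n) (w : List (Letter V n)) :
    w ∈ S.language ↔ S.Acc S.q₀ S.s₀ w := Iff.rfl

/-- The TOPL automaton obtained by eliminating the spontaneous moves, where `e` numbers the
registers. -/
noncomputable def toLow (S : RegisterSystem V n) {m : ℕ} (e : S.X ≃ Fin m) :
    LowAutomaton V n m where
  Q := S.Q
  finite_Q := S.finite_Q
  q₀ := S.q₀
  s₀ := S.s₀ ∘ e.symm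
  δ := {t | ∃ q₁ T wr, Relation.ReflTransGen S.ε t.1 q₁ ∧ S.Δ q₁ T wr t.2.2 ∧
    t.2.1 = (Guard.ofPattern {p | (e.symm p.1, p.2) ∈ T}, Action.ofWrites (wr ∘ e.symm))}
  finite_δ := by
    have := S.finite_Q
    have := S.finite_X
    -- There are finitely many patterns and finitely many write functions, and the new label is
    -- determined by one of each.
    refine (Set.finite_range fun x : S.Q × Set (S.X × Fin n) × (S.X → Option (Fin n)) × S.Q =>
      ((x.1, (Guard.ofPattern {p : Fin m × Fin n | (e.symm p.1, p.2) ∈ x.2.1},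
        Action.ofWrites (x.2.2.1 ∘ e.symm)), x.2.2.2) : S.Q × Label n m × S.Q)).subset ?_
    rintro ⟨q, l, q'⟩ ⟨q₁, T, wr, h1, h2, rfl⟩
    exact ⟨(q, T, wr, q'), rfl⟩
  F := {q | ∃ q', Relation.ReflTransGen S.ε q q' ∧ q' ∈ S.F}

theorem acc_of_reflTransGen {S : RegisterSystem V n} {q q' : S.Q} {s : S.X → V}
    {w : List (Letter V n)} (h : Relation.ReflTransGen S.ε q q') (h' : S.Acc q' s w) :
    S.Acc q s w := by
  induction h using Relation.ReflTransGen.head_induction_on with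
  | refl => exact h'
  | head h _ ih => exact .eps h ih

theorem pattern_comp_symm {X : Type*} {m : ℕ} (e : X ≃ Fin m) (s : X → V) (ℓ : Letter V n)
    (T : Set (X × Fin n)) :
    pattern (s ∘ e.symm) ℓ = {p | (e.symm p.1, p.2) ∈ T} ↔ pattern s ℓ = T := by
  constructor
  · intro h
    ext ⟨x, j⟩
    have := Set.ext_iff.1 h (e x, j)
    simpa [pattern] using this
  · rintro rfl
    rfl

theorem language_toLow (S : RegisterSystem V n) {m : ℕ} (e : S.X ≃ Fin m) :
    LowAutomaton.language (S.toLow e) = S.language := by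
  ext w
  constructor
  · rintro ⟨x, h, hF⟩
    suffices ∀ y : (S.toLow e).Config, LowAutomaton.Walk (S.toLow e) y w x →
        S.Acc y.1 (y.2 ∘ e) w by
      have := this _ h
      have h2 : (S.toLow e).s₀ ∘ e = S.s₀ := by funext x; simp [toLow]
      rw [h2] at this
      exact this
    clear h
    intro y h
    induction h with
    | nil x =>
      obtain ⟨q', h1, h2⟩ := hF
      exact acc_of_reflTransGen h1 (.fin h2)
    | @cons x y z ℓ w h1 _ ih =>
      obtain ⟨g, a, ⟨q₁, T, wr, h1, h2, h3⟩, h4, h5⟩ := h1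
      obtain ⟨rfl, rfl⟩ : g = _ ∧ a = _ := by simpa using h3
      rw [Guard.sat_ofPattern] at h4
      rw [Action.run_ofWrites] at h5
      have h6 : pattern (x.2 ∘ e) ℓ = T := by
        rw [← pattern_comp_symm e, ← h4]
        congr 1
        funext i
        simp
      have h7 : writeTo ℓ wr (x.2 ∘ e) = y.2 ∘ e := by
        rw [← h5]
        funext i
        simp [writeTo]
      refine acc_of_reflTransGen h1 (.read (h6 ▸ h2) ?_)
      rw [h7]
      exact ih hF
  · intro h
    -- Spontaneous moves are collected until the next letter or the end of the word; `q₁` is the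
    -- state in which the collecting began.
    suffices ∀ (q : S.Q) s, S.Acc q s w → ∀ q₁, Relation.ReflTransGen S.ε q₁ q →
        ∃ x : (S.toLow e).Config, LowAutomaton.Walk (S.toLow e) (q₁, s ∘ e.symm) w x ∧
          x.1 ∈ (S.toLow e).F from this _ _ h _ .refl
    clear h
    intro q s h
    induction h with
    | fin h => exact fun q₁ h1 => ⟨_, .nil _, _, h1, h⟩
    | eps h1 _ ih => exact fun q₁ h2 => ih _ (h2.tail h1)
    | @read q q' s ℓ wr w h1 _ ih =>
      intro q₁ h2
      obtain ⟨x, h3, h4⟩ := ih _ .refl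
      refine ⟨x, .cons (y := (q', writeTo ℓ wr s ∘ e.symm)) ⟨_, _, ⟨q, _, wr, h2, h1, rfl⟩, ?_, ?_⟩ h3, h4⟩
      · rw [Guard.sat_ofPattern, pattern_comp_symm]
      · rw [Action.run_ofWrites]
        rfl

theorem language_mem_lowLanguages (S : RegisterSystem V n) : S.language ∈ lowLanguages V n := by
  have := S.finite_X
  obtain ⟨m, ⟨e⟩⟩ := Finite.exists_equiv_fin S.X
  exact ⟨m, S.toLow e, S.language_toLow e⟩

/-- The transitions of a TOPL automaton, given by patterns and writes. -/
def LowΔ {m : ℕ} (A : LowAutomaton V n m) (q : A.Q) (T : Set (Fin m × Fin n))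
    (wr : Fin m → Option (Fin n)) (q' : A.Q) : Prop :=
  ∃ g a, (q, (g, a), q') ∈ A.δ ∧ g.Holds T ∧ wr = a.writes

/-- A TOPL automaton as a system. -/
def ofLow {m : ℕ} (A : LowAutomaton V n m) : RegisterSystem V n where
  Q := A.Q
  X := Fin m
  finite_Q := A.finite_Q
  finite_X := inferInstance
  q₀ := A.q₀
  s₀ := A.s₀
  Δ := LowΔ A
  ε _ _ := False
  F := A.F

theorem language_ofLow {m : ℕ} (A : LowAutomaton V n m) :
    (ofLow A).language = LowAutomaton.language A := by
  ext w
  constructor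
  · intro h
    suffices ∀ (q : A.Q) (s : Store V m), Accepts (LowΔ A) (fun _ _ => False) A.F q s w →
        ∃ x : A.Config, LowAutomaton.Walk A (q, s) w x ∧ x.1 ∈ A.F from this _ _ h
    clear h
    intro q s h
    induction h with
    | fin h => exact ⟨_, .nil _, h⟩
    | eps h => exact h.elim
    | read h1 _ ih =>
      obtain ⟨g, a, h1, h2, rfl⟩ := h1
      obtain ⟨x, h3, h4⟩ := ih
      exact ⟨x, .cons ⟨g, a, h1, (g.holds_pattern _ _).1 h2, a.run_eq _ _⟩ h3, h4⟩
  · rintro ⟨x, h, hF⟩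
    change Accepts (LowΔ A) (fun _ _ => False) A.F (A.q₀, A.s₀).1 (A.q₀, A.s₀).2 w
    generalize (A.q₀, A.s₀) = y at h ⊢
    induction h with
    | nil x => exact .fin hF
    | cons h1 _ ih =>
      obtain ⟨g, a, h1, h2, h3⟩ := h1
      refine .read ⟨g, a, h1, (g.holds_pattern _ _).2 h2, rfl⟩ ?_
      have := ih hF
      rw [← h3, a.run_eq] at this
      exact this

/-- The arguments of a construction may be assumed to have no spontaneous moves, while its result is
free to use them. -/
theorem mem_lowLanguages_iff {L : Language (Letter V n)} :
    L ∈ lowLanguages V n ↔ ∃ S : RegisterSystem V n, (∀ q q', ¬ S.ε q q') ∧ S.language = L := by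
  constructor
  · rintro ⟨m, A, rfl⟩
    exact ⟨ofLow A, fun _ _ h => h, language_ofLow A⟩
  · rintro ⟨S, -, rfl⟩
    exact S.language_mem_lowLanguages

/-! ### Closure properties -/

/-! ### Union and concatenation: two systems on disjoint registers -/

section side

variable (S₁ S₂ : RegisterSystem V n)

/-- The transitions of two systems side by side, on disjoint sets of registers. -/
def SideΔ (q : Option (S₁.Q ⊕ S₂.Q)) (T : Set ((S₁.X ⊕ S₂.X) × Fin n))
    (wr : S₁.X ⊕ S₂.X → Option (Fin n)) (q' : Option (S₁.Q ⊕ S₂.Q)) : Prop :=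
  (∃ q₁ q₁' wr₁, q = some (.inl q₁) ∧ q' = some (.inl q₁') ∧
    wr = Sum.elim wr₁ (fun _ => none) ∧ S₁.Δ q₁ {p | (.inl p.1, p.2) ∈ T} wr₁ q₁') ∨
  (∃ q₂ q₂' wr₂, q = some (.inr q₂) ∧ q' = some (.inr q₂') ∧
    wr = Sum.elim (fun _ => none) wr₂ ∧ S₂.Δ q₂ {p | (.inr p.1, p.2) ∈ T} wr₂ q₂')

/-- Spontaneous moves from the initial state `none` to the states in `init`, and from the first
system to the second one. -/
def SideEps {Q₁ Q₂ : Type} (init : Set (Q₁ ⊕ Q₂)) (ε₁₂ : Q₁ → Q₂ → Prop)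
    (q q' : Option (Q₁ ⊕ Q₂)) : Prop :=
  (q = none ∧ ∃ i ∈ init, q' = some i) ∨
  (∃ q₁ q₂, q = some (.inl q₁) ∧ q' = some (.inr q₂) ∧ ε₁₂ q₁ q₂)

/-- Two systems side by side. -/
def side (init : Set (S₁.Q ⊕ S₂.Q)) (ε₁₂ : S₁.Q → S₂.Q → Prop) (F : Set (S₁.Q ⊕ S₂.Q)) :
    RegisterSystem V n where
  Q := Option (S₁.Q ⊕ S₂.Q)
  X := S₁.X ⊕ S₂.X
  finite_Q := by
    have := S₁.finite_Q
    have := S₂.finite_Q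
    infer_instance
  finite_X := by
    have := S₁.finite_X
    have := S₂.finite_X
    infer_instance
  q₀ := none
  s₀ := Sum.elim S₁.s₀ S₂.s₀
  Δ := SideΔ S₁ S₂
  ε := SideEps init ε₁₂
  F := some '' F

/-- Acceptance by two systems side by side. -/
abbrev SideAcc (init : Set (S₁.Q ⊕ S₂.Q)) (ε₁₂ : S₁.Q → S₂.Q → Prop) (F : Set (S₁.Q ⊕ S₂.Q)) :
    Option (S₁.Q ⊕ S₂.Q) → (S₁.X ⊕ S₂.X → V) → List (Letter V n) → Prop :=
  Accepts (SideΔ S₁ S₂) (SideEps init ε₁₂) (some '' F)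

variable {S₁ S₂} {init : Set (S₁.Q ⊕ S₂.Q)} {ε₁₂ : S₁.Q → S₂.Q → Prop} {F : Set (S₁.Q ⊕ S₂.Q)}
  {w : List (Letter V n)}

theorem sideAcc_inr (hF : ∀ q, q ∈ S₂.F → .inr q ∈ F) {q : S₂.Q} {s : S₂.X → V}
    (h : S₂.Acc q s w) (hε : ∀ q q', ¬ S₂.ε q q') (t : S₁.X → V) :
    SideAcc S₁ S₂ init ε₁₂ F (some (.inr q)) (Sum.elim t s) w := by
  induction h with
  | fin h => exact .fin ⟨_, hF _ h, rfl⟩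
  | eps h => exact (hε _ _ h).elim
  | @read q q' s ℓ wr w h1 _ ih =>
    refine .read (wr := Sum.elim (fun _ => none) wr) (q' := some (.inr q'))
      (.inr ⟨_, _, _, rfl, rfl, rfl, h1⟩) ?_
    convert ih using 1
    · funext x
      rcases x with x | x <;> rfl

theorem acc_of_side_inr (hF : ∀ q, .inr q ∈ F → q ∈ S₂.F) {q : S₂.Q} {s : S₁.X ⊕ S₂.X → V}
    (h : SideAcc S₁ S₂ init ε₁₂ F (some (.inr q)) s w) : S₂.Acc q (s ∘ .inr) w := by
  generalize hp : (some (.inr q) : Option (S₁.Q ⊕ S₂.Q)) = p at h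
  induction h generalizing q with
  | fin h =>
    subst hp
    obtain ⟨_, h1, h2⟩ := h
    cases h2
    exact .fin (hF _ h1)
  | eps h =>
    subst hp
    rcases h with ⟨h, -⟩ | ⟨q₁, q₂, h, -⟩ <;> cases h
  | read h1 _ ih =>
    subst hp
    rcases h1 with ⟨q₁, q₁', wr₁, h, -⟩ | ⟨q₁, q₁', wr₁, h, rfl, rfl, h4⟩
    · cases h
    · cases h
      exact .read h4 (ih rfl)

/-- Stated with a continuation: `hF` tells how the rest `w'` is accepted once the first system has
finished. For a union `w'` is empty; for a concatenation it is the word of the second system, whose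
registers still hold `t`. -/
theorem sideAcc_inl {w' : List (Letter V n)} {q : S₁.Q} {s : S₁.X → V} {t : S₂.X → V}
    (hF : ∀ q s, q ∈ S₁.F → SideAcc S₁ S₂ init ε₁₂ F (some (.inl q)) (Sum.elim s t) w')
    (h : S₁.Acc q s w) (hε : ∀ q q', ¬ S₁.ε q q') :
    SideAcc S₁ S₂ init ε₁₂ F (some (.inl q)) (Sum.elim s t) (w ++ w') := by
  induction h with
  | fin h => exact hF _ _ h
  | eps h => exact (hε _ _ h).elim
  | @read q q' s ℓ wr w h1 _ ih =>
    refine .read (wr := Sum.elim wr (fun _ => none)) (q' := some (.inl q'))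
      (.inl ⟨_, _, _, rfl, rfl, rfl, h1⟩) ?_
    convert ih using 1
    · funext x
      rcases x with x | x <;> rfl
    · rfl

/-- A run that begins on the first side ends there or crosses over once; the word is cut at that
moment. Nothing has been written to the second group of registers before the crossing, hence the
last equation. -/
theorem acc_of_side_inl {q : S₁.Q} {s : S₁.X ⊕ S₂.X → V}
    (hF : ∀ q, .inl q ∈ F ∨ (∃ q₂, ε₁₂ q q₂) → q ∈ S₁.F)
    (h : SideAcc S₁ S₂ init ε₁₂ F (some (.inl q)) s w) :
    ∃ w₁ w₂, S₁.Acc q (s ∘ .inl) w₁ ∧ w = w₁ ++ w₂ ∧ (w₂ = [] ∧ (∃ q, .inl q ∈ F) ∨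
      ∃ q' q₂ t, ε₁₂ q' q₂ ∧ SideAcc S₁ S₂ init ε₁₂ F (some (.inr q₂)) t w₂ ∧
        t ∘ .inr = s ∘ .inr) := by
  generalize hp : (some (.inl q) : Option (S₁.Q ⊕ S₂.Q)) = p at h
  induction h generalizing q with
  | fin h =>
    subst hp
    obtain ⟨_, h1, h2⟩ := h
    cases h2
    exact ⟨[], [], .fin (hF _ (.inl h1)), rfl, .inl ⟨rfl, _, h1⟩⟩
  | eps h h' =>
    subst hp
    rcases h with ⟨h, -⟩ | ⟨q₁, q₂, h, rfl, h2⟩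
    · cases h
    · cases h
      exact ⟨[], _, .fin (hF _ (.inr ⟨_, h2⟩)), rfl, .inr ⟨_, _, _, h2, h', rfl⟩⟩
  | read h1 _ ih =>
    subst hp
    rcases h1 with ⟨q₁, q₁', wr₁, h, rfl, rfl, h4⟩ | ⟨q₁, q₁', wr₁, h, -⟩
    · cases h
      obtain ⟨w₁, w₂, h5, rfl, h6⟩ := ih rfl
      exact ⟨_ :: w₁, w₂, .read h4 h5, rfl, h6⟩
    · cases h

theorem acc_side_none {s : S₁.X ⊕ S₂.X → V} :
    SideAcc S₁ S₂ init ε₁₂ F none s w ↔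
      ∃ i ∈ init, SideAcc S₁ S₂ init ε₁₂ F (some i) s w := by
  constructor
  · intro h
    cases h with
    | fin h => obtain ⟨_, -, h⟩ := h; cases h
    | eps h h' =>
      rcases h with ⟨-, i, h1, rfl⟩ | ⟨_, _, h, -⟩
      · exact ⟨i, h1, h'⟩
      · cases h
    | read h => rcases h with ⟨_, _, _, h, -⟩ | ⟨_, _, _, h, -⟩ <;> cases h
  · rintro ⟨i, h1, h2⟩
    exact .eps (.inl ⟨rfl, i, h1, rfl⟩) h2

theorem exists_language_eq_add (h₁ : ∀ q q', ¬ S₁.ε q q') (h₂ : ∀ q q', ¬ S₂.ε q q') :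
    ∃ S : RegisterSystem V n, S.language = S₁.language + S₂.language := by
  refine ⟨side S₁ S₂ {.inl S₁.q₀, .inr S₂.q₀} (fun _ _ => False) (Sum.elim S₁.F S₂.F), ?_⟩
  ext w
  rw [mem_language, Language.mem_add, mem_language, mem_language]
  refine acc_side_none.trans ⟨?_, ?_⟩
  · rintro ⟨_, rfl | rfl, h⟩
    · obtain ⟨w₁, w₂, h1, rfl, ⟨rfl, -⟩ | ⟨_, _, _, h, -⟩⟩ := acc_of_side_inl
        (fun q h => h.resolve_right (by simp)) h
      · rw [List.append_nil]; exact .inl h1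
      · exact h.elim
    · exact .inr (acc_of_side_inr (fun q h => h) h)
  · rintro (h | h)
    · refine ⟨_, .inl rfl, ?_⟩
      rw [← w.append_nil]
      exact sideAcc_inl (fun q s h => .fin ⟨_, h, rfl⟩) h h₁
    · exact ⟨_, .inr rfl, sideAcc_inr (fun q h => h) h h₂ _⟩

theorem exists_language_eq_mul (h₁ : ∀ q q', ¬ S₁.ε q q') (h₂ : ∀ q q', ¬ S₂.ε q q') :
    ∃ S : RegisterSystem V n, S.language = S₁.language * S₂.language := by
  refine ⟨side S₁ S₂ {.inl S₁.q₀} (fun q q' => q ∈ S₁.F ∧ q' = S₂.q₀) (Sum.elim (fun _ => False) S₂.F), ?_⟩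
  ext w
  rw [mem_language, Language.mem_mul]
  refine acc_side_none.trans ⟨?_, ?_⟩
  · rintro ⟨_, rfl, h⟩
    obtain ⟨w₁, w₂, h1, rfl, ⟨-, _, h⟩ | ⟨_, _, t, ⟨-, rfl⟩, h2, h3⟩⟩ := acc_of_side_inl
        (fun q h => (h.resolve_left id).choose_spec.1) h
    · exact h.elim
    · refine ⟨w₁, h1, w₂, ?_, rfl⟩
      have := acc_of_side_inr (fun q h => h) h2
      rwa [h3] at this
  · rintro ⟨w₁, h1, w₂, h2, rfl⟩
    exact ⟨_, rfl, sideAcc_inl (fun q s h => .eps (.inr ⟨_, _, rfl, rfl, h, rfl⟩)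
      (sideAcc_inr (fun q h => h) h2 h₂ _)) h1 h₁⟩

end side

/-! ### Intersection: the synchronous product -/

/-- The transitions of the synchronous product of two systems. -/
def ProductΔ (S₁ S₂ : RegisterSystem V n) (q : S₁.Q × S₂.Q) (T : Set ((S₁.X ⊕ S₂.X) × Fin n))
    (wr : S₁.X ⊕ S₂.X → Option (Fin n)) (q' : S₁.Q × S₂.Q) : Prop :=
  ∃ wr₁ wr₂, wr = Sum.elim wr₁ wr₂ ∧
    S₁.Δ q.1 {p | (.inl p.1, p.2) ∈ T} wr₁ q'.1 ∧ S₂.Δ q.2 {p | (.inr p.1, p.2) ∈ T} wr₂ q'.2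

/-- The synchronous product of two systems. -/
abbrev product (S₁ S₂ : RegisterSystem V n) : RegisterSystem V n where
  Q := S₁.Q × S₂.Q
  X := S₁.X ⊕ S₂.X
  finite_Q := by
    have := S₁.finite_Q
    have := S₂.finite_Q
    infer_instance
  finite_X := by
    have := S₁.finite_X
    have := S₂.finite_X
    infer_instance
  q₀ := (S₁.q₀, S₂.q₀)
  s₀ := Sum.elim S₁.s₀ S₂.s₀
  Δ := ProductΔ S₁ S₂
  ε _ _ := False
  F := S₁.F ×ˢ S₂.F

theorem exists_language_eq_inf {S₁ S₂ : RegisterSystem V n} (h₁ : ∀ q q', ¬ S₁.ε q q')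
    (h₂ : ∀ q q', ¬ S₂.ε q q') :
    ∃ S : RegisterSystem V n, S.language = S₁.language ⊓ S₂.language := by
  refine ⟨product S₁ S₂, ?_⟩
  ext w
  change Accepts (ProductΔ S₁ S₂) (fun _ _ => False) (S₁.F ×ˢ S₂.F)
    (S₁.q₀, S₂.q₀) (Sum.elim S₁.s₀ S₂.s₀) w ↔
    S₁.Acc S₁.q₀ S₁.s₀ w ∧ S₂.Acc S₂.q₀ S₂.s₀ w
  generalize S₁.q₀ = q₁, S₁.s₀ = s₁, S₂.q₀ = q₂, S₂.s₀ = s₂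
  induction w generalizing q₁ q₂ s₁ s₂ with
  | nil =>
    constructor
    · intro h
      cases h with
      | fin h => exact ⟨.fin h.1, .fin h.2⟩
      | eps h => exact h.elim
    · rintro ⟨h, h'⟩
      cases h with
      | fin h => cases h' with
        | fin h' => exact .fin (Set.mk_mem_prod h h')
        | eps h => exact (h₂ _ _ h).elim
      | eps h => exact (h₁ _ _ h).elim
  | cons ℓ w ih =>
    have key : ∀ wr₁ wr₂, writeTo ℓ (Sum.elim wr₁ wr₂) (Sum.elim s₁ s₂) =
        Sum.elim (writeTo ℓ wr₁ s₁) (writeTo ℓ wr₂ s₂) := by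
      intro wr₁ wr₂
      funext x
      rcases x with x | x <;> rfl
    constructor
    · intro h
      cases h with
      | eps h => exact h.elim
      | read h h' =>
        obtain ⟨wr₁, wr₂, rfl, h3, h4⟩ := h
        rw [key] at h'
        obtain ⟨h5, h6⟩ := (ih _ _ _ _).1 h'
        exact ⟨.read h3 h5, .read h4 h6⟩
    · rintro ⟨h, h'⟩
      cases h with
      | eps h => exact (h₁ _ _ h).elim
      | @read _ q₁' _ _ wr₁ _ h h5 => cases h' with
        | eps h => exact (h₂ _ _ h).elim
        | @read _ q₂' _ _ wr₂ _ h' h6 =>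
          refine .read (q' := (q₁', q₂')) ⟨wr₁, wr₂, rfl, h, h'⟩ ?_
          rw [key]
          exact (ih _ _ _ _).2 ⟨h5, h6⟩

/-! ### Kleene star: restarting from the initial store -/

section star

variable (S : RegisterSystem V n)

open Classical in
/-- The register that holds the value of `x`: the original one until `x` is first written. -/
noncomputable def starLoc (D : Set S.X) (x : S.X) : S.X ⊕ S.X := if x ∈ D then .inr x else .inl x

/-- The transitions of `S`, on states that record which registers have been written. -/
def StarΔ (p : Option (S.Q × Set S.X)) (T : Set ((S.X ⊕ S.X) × Fin n))
    (wr : S.X ⊕ S.X → Option (Fin n)) (p' : Option (S.Q × Set S.X)) : Prop :=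
  ∃ q D q' wr', p = some (q, D) ∧ p' = some (q', D ∪ {x | wr' x ≠ none}) ∧
    wr = Sum.elim (fun _ => none) wr' ∧ S.Δ q {p | (S.starLoc D p.1, p.2) ∈ T} wr' q'

/-- Spontaneous moves that start and end a run of `S`. -/
def StarEps (p p' : Option (S.Q × Set S.X)) : Prop :=
  (p = none ∧ p' = some (S.q₀, ∅)) ∨ (∃ q D, q ∈ S.F ∧ p = some (q, D) ∧ p' = none)

/-- A system that runs `S` again and again, restarting from the initial store. -/
def star : RegisterSystem V n where
  Q := Option (S.Q × Set S.X)
  X := S.X ⊕ S.X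
  finite_Q := by
    have := S.finite_Q
    have := S.finite_X
    infer_instance
  finite_X := by
    have := S.finite_X
    infer_instance
  q₀ := none
  s₀ := Sum.elim S.s₀ S.s₀
  Δ := S.StarΔ
  ε := S.StarEps
  F := {none}

/-- Acceptance by the iterated system. -/
abbrev StarAcc : Option (S.Q × Set S.X) → (S.X ⊕ S.X → V) → List (Letter V n) → Prop :=
  Accepts S.StarΔ S.StarEps {none}

/-- Only the `inr` copies are written, and a register is read from its `inr` copy from its first
write on. Seen through `starLoc`, the doubled store thus evolves like the store of `S`. -/
theorem starLoc_write (D : Set S.X) (wr : S.X → Option (Fin n)) (ℓ : Letter V n)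
    (s : S.X ⊕ S.X → V) :
    writeTo ℓ (Sum.elim (fun _ => none) wr) s ∘ S.starLoc (D ∪ {x | wr x ≠ none}) =
      writeTo ℓ wr (s ∘ S.starLoc D) := by
  funext x
  by_cases h : wr x = none
  · by_cases h' : x ∈ D <;> simp [writeTo, starLoc, h, h']
  · obtain ⟨j, h⟩ := Option.ne_none_iff_exists'.1 h
    simp [writeTo, starLoc, h]

theorem append_mem_kstar {α : Type*} {L : Language α} {v w : List α} (hv : v ∈ L)
    (hw : w ∈ KStar.kstar L) : v ++ w ∈ KStar.kstar L := by
  obtain ⟨l, rfl, hl⟩ := Language.mem_kstar.1 hw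
  exact Language.mem_kstar.2 ⟨v :: l, rfl, by simpa using ⟨hv, hl⟩⟩

/-- The hypothesis `hs` is invariant because the `inl` copies are never written. A restart with `D =
∅` therefore sees the initial store, whatever earlier rounds have left in the `inr` copies. -/
theorem star_acc {p : Option (S.Q × Set S.X)} {s : S.X ⊕ S.X → V} {w : List (Letter V n)}
    (h : S.StarAcc p s w) (hs : s ∘ .inl = S.s₀) :
    (p = none → w ∈ KStar.kstar S.language) ∧
    ∀ q D, p = some (q, D) → ∃ w₁ w₂, S.Acc q (s ∘ S.starLoc D) w₁ ∧
      w₂ ∈ KStar.kstar S.language ∧ w = w₁ ++ w₂ := by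
  induction h with
  | fin h =>
    obtain rfl : _ = none := h
    exact ⟨fun _ => Language.nil_mem_kstar _, fun _ _ h => by cases h⟩
  | @eps q q' s w h _ ih =>
    obtain ⟨ih1, ih2⟩ := ih hs
    rcases h with ⟨rfl, rfl⟩ | ⟨q, D, h, rfl, rfl⟩
    · refine ⟨fun _ => ?_, fun _ _ h => by cases h⟩
      obtain ⟨w₁, w₂, h1, h2, rfl⟩ := ih2 _ _ rfl
      refine append_mem_kstar ?_ h2
      have : s ∘ S.starLoc ∅ = S.s₀ := by
        rw [← hs]
        funext x
        simp [starLoc]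
      rwa [this] at h1
    · refine ⟨(by rintro ⟨⟩), ?_⟩
      rintro _ _ h'
      cases h'
      exact ⟨[], w, .fin h, ih1 rfl, rfl⟩
  | @read q q' s ℓ wr w h _ ih =>
    obtain ⟨q, D, q', wr', rfl, rfl, rfl, h3⟩ := h
    refine ⟨(by rintro ⟨⟩), ?_⟩
    rintro _ _ h'
    cases h'
    obtain ⟨w₁, w₂, h4, h5, rfl⟩ := (ih hs).2 _ _ rfl
    refine ⟨ℓ :: w₁, w₂, .read h3 ?_, h5, rfl⟩
    rw [← starLoc_write]
    exact h4

theorem starAcc_of_acc {S : RegisterSystem V n} (hε : ∀ q q', ¬ S.ε q q') {w' : List (Letter V n)}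
    (hw : ∀ s : S.X ⊕ S.X → V, s ∘ .inl = S.s₀ → S.StarAcc none s w')
    {q : S.Q} {s : S.X → V} {w : List (Letter V n)} (h : S.Acc q s w) (D : Set S.X)
    (t : S.X ⊕ S.X → V) (ht : t ∘ .inl = S.s₀) (hs : t ∘ S.starLoc D = s) :
    S.StarAcc (some (q, D)) t (w ++ w') := by
  induction h generalizing D t with
  | fin h => exact .eps (.inr ⟨_, _, h, rfl, rfl⟩) (hw _ ht)
  | eps h => exact (hε _ _ h).elim
  | read h _ ih =>
    subst hs
    exact .read ⟨_, _, _, _, rfl, rfl, rfl, h⟩ (ih _ _ ht (S.starLoc_write _ _ _ _))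

theorem exists_language_eq_kstar {S : RegisterSystem V n} (hε : ∀ q q', ¬ S.ε q q') :
    ∃ S' : RegisterSystem V n, S'.language = KStar.kstar S.language := by
  refine ⟨S.star, ?_⟩
  ext w
  constructor
  · intro h
    exact (S.star_acc h rfl).1 rfl
  · intro h
    obtain ⟨l, rfl, hl⟩ := Language.mem_kstar.1 h
    suffices ∀ s : S.X ⊕ S.X → V, s ∘ .inl = S.s₀ → S.StarAcc none s l.flatten from
      this _ rfl
    clear h
    induction l with
    | nil => exact fun s _ => .fin rfl
    | cons v l ih =>
      intro s hs
      refine .eps (.inl ⟨rfl, rfl⟩)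
        (starAcc_of_acc hε (ih fun y hy => hl _ (List.mem_cons_of_mem _ hy))
          (hl v List.mem_cons_self) ∅ s hs ?_)
      rw [← hs]
      funext x
      simp [starLoc]

end star

end RegisterSystem

theorem closedUnderRegularOperations_lowLanguages (V : Type*) (n : ℕ) :
    ClosedUnderRegularOperations (lowLanguages V n) := by
  refine ⟨?_, ?_, ?_, ?_⟩
  · rintro _ h₁ _ h₂
    obtain ⟨S₁, hε₁, rfl⟩ := RegisterSystem.mem_lowLanguages_iff.1 h₁
    obtain ⟨S₂, hε₂, rfl⟩ := RegisterSystem.mem_lowLanguages_iff.1 h₂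
    obtain ⟨S, h⟩ := RegisterSystem.exists_language_eq_add hε₁ hε₂
    exact h ▸ S.language_mem_lowLanguages
  · rintro _ h₁ _ h₂
    obtain ⟨S₁, hε₁, rfl⟩ := RegisterSystem.mem_lowLanguages_iff.1 h₁
    obtain ⟨S₂, hε₂, rfl⟩ := RegisterSystem.mem_lowLanguages_iff.1 h₂
    obtain ⟨S, h⟩ := RegisterSystem.exists_language_eq_inf hε₁ hε₂
    exact h ▸ S.language_mem_lowLanguages
  · rintro _ h₁ _ h₂
    obtain ⟨S₁, hε₁, rfl⟩ := RegisterSystem.mem_lowLanguages_iff.1 h₁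
    obtain ⟨S₂, hε₂, rfl⟩ := RegisterSystem.mem_lowLanguages_iff.1 h₂
    obtain ⟨S, h⟩ := RegisterSystem.exists_language_eq_mul hε₁ hε₂
    exact h ▸ S.language_mem_lowLanguages
  · rintro _ h₁
    obtain ⟨S₁, hε₁, rfl⟩ := RegisterSystem.mem_lowLanguages_iff.1 h₁
    obtain ⟨S, h⟩ := RegisterSystem.exists_language_eq_kstar hε₁
    exact h ▸ S.language_mem_lowLanguages

end TOPL

namespace TOPL

/-! ### From hl-TOPL automata to register systems -/

/-- A buffered letter: the registers that hold its components, and the pattern that was observed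
when it was read. -/
abbrev Cell (X : Type) (n : ℕ) := Letter X n × Set (X × Fin n)

section
variable {V : Type*} {n m : ℕ} {X : Type}

/-- The buffered letters, when the registers hold the values `r`. -/
def bufferValue (r : X → V) (u : List (Cell X n)) : List (Letter V n) := u.map fun c => r ∘ c.1

/-- The symbolic version of `AcceptsWith`, in which the guards are evaluated on the recorded
patterns. -/
def SymAcceptsWith : Store X m → List (Label n m) → List (Cell X n) → Store X m → Prop
  | s, [], [], s' => s = s'
  | s, (g, a) :: lab, c :: u, s' =>
    g.Holds {p | (s p.1, p.2) ∈ c.2} ∧ SymAcceptsWith (writeTo c.1 a.writes s) lab u s'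
  | _, _, _, _ => False

/-- The recorded patterns are right for the registers in `O` and for those of older cells. -/
def Valid (r : X → V) : Set X → List (Cell X n) → Prop
  | _, [] => True
  | O, c :: u => (∀ x ∈ O, ∀ j, (x, j) ∈ c.2 ↔ r x = r (c.1 j)) ∧ Valid r (O ∪ Set.range c.1) u

theorem Valid.mono {r : X → V} {O O' : Set X} {u : List (Cell X n)} (h : Valid r O u)
    (hO : O' ⊆ O) : Valid r O' u := by
  induction u generalizing O O' with
  | nil => trivial
  | cons c u ih =>
    exact ⟨fun x hx => h.1 x (hO hx), ih h.2 (Set.union_subset_union_left _ hO)⟩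

theorem range_writeTo_subset (c : Letter X n) (wr : Fin m → Option (Fin n)) (s : Store X m) :
    Set.range (writeTo c wr s) ⊆ Set.range s ∪ Set.range c := by
  rintro _ ⟨x, rfl⟩
  rw [writeTo]
  cases wr x with
  | none => exact .inl ⟨x, rfl⟩
  | some j => exact .inr ⟨j, rfl⟩

theorem comp_writeTo (r : X → V) (c : Letter X n) (wr : Fin m → Option (Fin n)) (s : Store X m) :
    r ∘ writeTo c wr s = writeTo (r ∘ c) wr (r ∘ s) := by
  funext x
  simp only [writeTo, Function.comp_apply]
  cases wr x <;> rfl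

theorem holds_iff_sat {r : X → V} {s : Store X m} {c : Cell X n}
    (h : ∀ x ∈ Set.range s, ∀ j, (x, j) ∈ c.2 ↔ r x = r (c.1 j)) (g : Guard n m) :
    g.Holds {p | (s p.1, p.2) ∈ c.2} ↔ g.Sat (r ∘ s) (r ∘ c.1) := by
  rw [← Guard.holds_pattern]
  have : {p : Fin m × Fin n | (s p.1, p.2) ∈ c.2} = pattern (r ∘ s) (r ∘ c.1) := by
    ext p
    exact h _ ⟨_, rfl⟩ _
  rw [this]

/-- When a cell is processed, the symbolic store points only to registers of the initial symbolic
store and of older cells. These are the registers for which `Valid` guarantees the recorded pattern,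
so the recorded guards are the true ones. -/
theorem SymAcceptsWith.acceptsWith {r : X → V} {s s' : Store X m} {lab : List (Label n m)}
    {v u : List (Cell X n)} (h : SymAcceptsWith s lab v s')
    (hv : Valid r (Set.range s) (v ++ u)) :
    AcceptsWith (r ∘ s) lab (bufferValue r v) (r ∘ s') ∧ Valid r (Set.range s') u := by
  induction lab generalizing s v with
  | nil => cases v with
    | nil => obtain rfl : s = s' := h; exact ⟨rfl, hv⟩
    | cons => exact h.elim
  | cons l lab ih => cases v with
    | nil => obtain ⟨g, a⟩ := l; exact h.elim
    | cons c v =>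
      obtain ⟨g, a⟩ := l
      obtain ⟨h1, h2⟩ := ih h.2 (hv.2.mono (range_writeTo_subset _ _ _))
      refine ⟨⟨(holds_iff_sat hv.1 g).1 h.1, ?_⟩, h2⟩
      rw [Action.run_eq, ← comp_writeTo]
      exact h1

theorem AcceptsWith.symAcceptsWith {r : X → V} {s : Store X m} {t : Store V m}
    {lab : List (Label n m)} {v u : List (Cell X n)}
    (h : AcceptsWith (r ∘ s) lab (bufferValue r v) t) (hv : Valid r (Set.range s) (v ++ u)) :
    ∃ s', SymAcceptsWith s lab v s' ∧ r ∘ s' = t := by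
  induction lab generalizing s v with
  | nil => cases v with
    | nil => exact ⟨s, rfl, h⟩
    | cons => exact h.elim
  | cons l lab ih => cases v with
    | nil => obtain ⟨g, a⟩ := l; exact h.elim
    | cons c v =>
      obtain ⟨g, a⟩ := l
      obtain ⟨h1, h2⟩ := h
      rw [Action.run_eq, ← comp_writeTo] at h2
      obtain ⟨s', h3, h4⟩ := ih h2 (hv.2.mono (range_writeTo_subset _ _ _))
      exact ⟨s', ⟨(holds_iff_sat hv.1 g).2 h1, h3⟩, h4⟩

/-- The registers of the cells of a buffer. -/
def cellRegisters (u : List (Cell X n)) : Set X := {x | ∃ c ∈ u, x ∈ Set.range c.1}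

/-- The new cell comes last, so its pattern must be right for `O` and for all registers of the
buffer. The conditions on older cells mention only registers on which `r` and `r'` agree. -/
theorem Valid.concat {r r' : X → V} {O : Set X} {u : List (Cell X n)} {c : Cell X n}
    (h : Valid r O u) (hr : ∀ x ∈ O ∪ cellRegisters u, r' x = r x)
    (hc : ∀ x ∈ O ∪ cellRegisters u, ∀ j, (x, j) ∈ c.2 ↔ r' x = r' (c.1 j)) :
    Valid r' O (u ++ [c]) := by
  induction u generalizing O with
  | nil => exact ⟨fun x hx => hc x (.inl hx), trivial⟩
  | cons c' u ih =>
    have hsub : O ∪ Set.range c'.1 ∪ cellRegisters u ⊆ O ∪ cellRegisters (c' :: u) := by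
      rintro x ((hx | hx) | ⟨c, hc, hx⟩)
      · exact .inl hx
      · exact .inr ⟨c', List.mem_cons_self, hx⟩
      · exact .inr ⟨c, List.mem_cons_of_mem _ hc, hx⟩
    refine ⟨fun x hx j => ?_, ih h.2 (fun x hx => hr x (hsub hx)) fun x hx => hc x (hsub hx)⟩
    rw [h.1 x hx j, hr x (.inl hx), hr (c'.1 j) (hsub (.inl (.inr ⟨j, rfl⟩)))]

theorem ncard_registers_le [Finite X] (s : Store X m) (u : List (Cell X n)) :
    (Set.range s ∪ cellRegisters u).ncard ≤ m + u.length * n := by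
  induction u with
  | nil =>
    have : (Set.range s ∪ cellRegisters ([] : List (Cell X n))) = s '' Set.univ := by
      ext x; simp [cellRegisters]
    rw [this]
    refine (Set.ncard_image_le).trans ?_
    simp [Set.ncard_univ]
  | cons c u ih =>
    have : Set.range s ∪ cellRegisters (c :: u) =
        (Set.range s ∪ cellRegisters u) ∪ c.1 '' Set.univ := by
      ext x
      simp only [cellRegisters, Set.mem_union, Set.mem_ofPred_eq, List.mem_cons, exists_eq_or_imp,
        Set.image_univ, or_assoc]
      exact or_congr_right or_comm
    rw [this]
    refine (Set.ncard_union_le _ _).trans ?_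
    have h2 : (c.1 '' Set.univ).ncard ≤ n := (Set.ncard_image_le).trans (by simp [Set.ncard_univ])
    simp only [List.length_cons]
    nlinarith

/-- The store and fewer than `d` cells occupy at most `m + (d - 1) * n` registers, which leaves `n`
for another letter. -/
theorem exists_fresh_registers [Finite X] {d : ℕ} (hX : m + d * n ≤ Nat.card X) (s : Store X m)
    {u : List (Cell X n)} (hu : u.length < d) :
    ∃ f : Fin n → X, Function.Injective f ∧ ∀ j, f j ∉ Set.range s ∪ cellRegisters u := by
  have h1 := ncard_registers_le s u
  have h2 : n ≤ Nat.card ((Set.range s ∪ cellRegisters u)ᶜ : Set X) := by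
    have := Set.ncard_add_ncard_compl (Set.range s ∪ cellRegisters u)
    rw [Nat.card_coe_set_eq]
    nlinarith
  have : Fintype ((Set.range s ∪ cellRegisters u)ᶜ : Set X) := Fintype.ofFinite _
  obtain ⟨f⟩ := Function.Embedding.nonempty_of_card_le (α := Fin n)
    (β := ((Set.range s ∪ cellRegisters u)ᶜ : Set X)) (by simpa [Nat.card_eq_fintype_card] using h2)
  exact ⟨fun j => f j, fun i j h => f.injective (Subtype.ext h), fun j => (f j).2⟩

end

/-! ### The buffered run as a register system -/

namespace HighAutomaton

variable {V : Type*} {n m : ℕ} (A : HighAutomaton V n m) (b : Bool) (d : ℕ) (X : Type)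

/-- The symbolic version of `Enabled`. -/
def SymEnabled {X : Type} (q : A.Q) (s : Store X m) (u : List (Cell X n)) : Prop :=
  ∃ lab q' v s' u', (q, lab, q') ∈ A.δ ∧ SymAcceptsWith s lab v s' ∧ u = v ++ u'

/-- States with a symbolic store and a buffer. -/
abbrev BufferState :=
  A.Q × Store X m × {u : List (Cell X n) // u.length ≤ d} × Bool

variable {A d X}

/-- Reading a letter into fresh registers. -/
def BufferΔ (p : A.BufferState d X) (T : Set (X × Fin n)) (wr : X → Option (Fin n))
    (p' : A.BufferState d X) : Prop :=
  p.2.2.2 = false ∧ p'.2.2.2 = false ∧ p'.1 = p.1 ∧ p'.2.1 = p.2.1 ∧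
  ∃ f : Fin n → X, (∀ j, f j ∉ Set.range p.2.1 ∪ cellRegisters p.2.2.1.1) ∧
    p'.2.2.1.1 = p.2.2.1.1 ++ [(f, T)] ∧ (∀ j, wr (f j) = some j) ∧
    ∀ x, x ∉ Set.range f → wr x = none

/-- Processing the buffer. -/
def BufferEps (p p' : A.BufferState d X) : Prop :=
  (p.2.2.2 = false ∧ p' = (p.1, p.2.1, p.2.2.1, true)) ∨
  (p'.2.2.2 = p.2.2.2 ∧ (p.2.2.2 = true ∨ d ≤ p.2.2.1.1.length) ∧
    ((∃ lab v, (p.1, lab, p'.1) ∈ A.δ ∧ SymAcceptsWith p.2.1 lab v p'.2.1 ∧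
        p.2.2.1.1 = v ++ p'.2.2.1.1) ∨
      (b = true ∧ p'.1 = p.1 ∧ p'.2.1 = p.2.1 ∧ ¬ A.SymEnabled p.1 p.2.1 p.2.2.1.1 ∧
        ∃ c, p.2.2.1.1 = c :: p'.2.2.1.1)))

variable {b}

/-- The final states. -/
def BufferF : Set (A.BufferState d X) :=
  {p | p.1 ∈ A.F ∧ p.2.2.1.1 = [] ∧ p.2.2.2 = true}

theorem enabled_iff_symEnabled {r : X → V} {q : A.Q} {s : Store X m} {u : List (Cell X n)}
    (h : Valid r (Set.range s) u) :
    A.Enabled q (r ∘ s) (bufferValue r u) ↔ A.SymEnabled q s u := by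
  constructor
  · rintro ⟨lab, q', v, t, u', h1, h2, h3⟩
    obtain ⟨v, u', rfl, rfl, rfl⟩ := List.map_eq_append_iff.1 h3
    obtain ⟨s', h4, -⟩ := h2.symAcceptsWith h
    exact ⟨lab, q', v, s', u', h1, h4, rfl⟩
  · rintro ⟨lab, q', v, s', u', h1, h2, rfl⟩
    exact ⟨lab, q', _, _, bufferValue r u', h1, (h2.acceptsWith h).1, List.map_append⟩

theorem writeTo_fresh {f : Fin n → X} {wr : X → Option (Fin n)} (h1 : ∀ j, wr (f j) = some j)
    (h2 : ∀ x, x ∉ Set.range f → wr x = none) (ℓ : Letter V n) (r : X → V) :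
    writeTo ℓ wr r ∘ f = ℓ ∧ ∀ x, x ∉ Set.range f → writeTo ℓ wr r x = r x := by
  refine ⟨?_, fun x hx => by simp [writeTo, h2 x hx]⟩
  funext j
  simp [writeTo, h1]

/-- Reading a letter into fresh registers preserves the store and the buffer. -/
theorem read_fresh {f : Fin n → X} {s : Store X m} {u : List (Cell X n)} {r r' : X → V}
    {ℓ : Letter V n} (hf : ∀ j, f j ∉ Set.range s ∪ cellRegisters u)
    (hr : r' ∘ f = ℓ ∧ ∀ x, x ∉ Set.range f → r' x = r x) (h : Valid r (Set.range s) u) :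
    r' ∘ s = r ∘ s ∧ bufferValue r' (u ++ [(f, pattern r ℓ)]) = bufferValue r u ++ [ℓ] ∧
      Valid r' (Set.range s) (u ++ [(f, pattern r ℓ)]) := by
  have key : ∀ x ∈ Set.range s ∪ cellRegisters u, r' x = r x := by
    refine fun x hx => hr.2 x ?_
    rintro ⟨j, rfl⟩
    exact hf j hx
  refine ⟨?_, ?_, h.concat key fun x hx j => ?_⟩
  · funext i
    exact key _ (.inl ⟨i, rfl⟩)
  · rw [bufferValue, List.map_append, bufferValue]
    congr 1
    · refine List.map_congr_left fun c hc => ?_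
      funext j
      exact key _ (.inr ⟨c, hc, j, rfl⟩)
    · simp [hr.1]
  · rw [key x hx, show r' (f j) = ℓ j from congrFun hr.1 j]
    rfl

theorem LAcc.eq_nil {q : A.Q} {s : Store V m} {u w : List (Letter V n)}
    (h : A.LAcc b d q s u true w) : w = [] := by
  generalize he : true = e at h
  induction h with
  | fin => rfl
  | close => rfl
  | read => cases he
  | std _ _ _ _ ih => exact ih he
  | skip _ _ _ _ ih => exact ih he

theorem length_bufferValue (r : X → V) (u : List (Cell X n)) :
    (bufferValue r u).length = u.length := List.length_map _

/-- The simulated store is `r ∘ s` and the simulated buffer is `bufferValue r u`. Processing the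
buffer changes only the symbolic data, so it can be spontaneous; only reading changes the actual
registers `r`. -/
theorem lacc_of_accepts {p : A.BufferState d X} {r : X → V} {w : List (Letter V n)}
    (h : Accepts BufferΔ (BufferEps b) BufferF p r w)
    (hv : Valid r (Set.range p.2.1) p.2.2.1.1) :
    A.LAcc b d p.1 (r ∘ p.2.1) (bufferValue r p.2.2.1.1) p.2.2.2 w := by
  induction h with
  | @fin p r h =>
    rw [h.2.1, h.2.2]
    exact .fin h.1
  | @eps p p' r w h _ ih =>
    rcases h with ⟨h1, rfl⟩ | ⟨h1, h2, ⟨lab, v, h3, h4, h5⟩ | ⟨hb, h3, h4, h5, c, h6⟩⟩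
    · have h3 := ih hv
      obtain rfl := h3.eq_nil
      rw [h1]
      exact .close h3
    · rw [h5] at hv
      obtain ⟨h6, h7⟩ := h4.acceptsWith hv
      have h8 := ih h7
      rw [h5, bufferValue, List.map_append]
      rw [h1] at h8
      refine .std (h2.imp_right fun h => ?_) h3 h6 h8
      simpa [h5, bufferValue] using h
    · rw [← enabled_iff_symEnabled hv, h6] at h5
      rw [h6] at hv
      have h8 := ih (by rw [h4]; exact hv.2.mono Set.subset_union_left)
      rw [h3, h4, h1] at h8
      rw [h6]
      refine .skip hb (h2.imp_right fun h => ?_) h5 h8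
      simpa [h6, bufferValue] using h
  | @read p p' r ℓ wr w h _ ih =>
    obtain ⟨h1, h2, h3, h4, f, h5, h6, h7, h8⟩ := h
    obtain ⟨h9, h10, h11⟩ := read_fresh h5 (writeTo_fresh h7 h8 ℓ r) hv
    rw [h6, h4] at ih
    have := ih h11
    rw [h2, h3, h9, h10] at this
    rw [h1]
    refine .read ?_ this
    have := p'.2.2.1.2
    rw [h6] at this
    simp only [List.length_append, List.length_singleton] at this
    rw [length_bufferValue]
    omega

theorem LAcc.accepts [Finite X] (hX : m + d * n ≤ Nat.card X) {q : A.Q} {t : Store V m}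
    {U w : List (Letter V n)} {e : Bool} (h : A.LAcc b d q t U e w) {s : Store X m}
    {u : List (Cell X n)} {r : X → V} (hs : r ∘ s = t) (hU : bufferValue r u = U)
    (hu : u.length ≤ d) (hv : Valid r (Set.range s) u) :
    Accepts BufferΔ (BufferEps b) BufferF ((q, s, ⟨u, hu⟩, e) : A.BufferState d X) r w := by
  induction h generalizing s u r with
  | fin h =>
    obtain rfl := List.map_eq_nil_iff.1 hU
    exact .fin ⟨h, rfl, rfl⟩
  | close _ ih => exact .eps (.inl ⟨rfl, rfl⟩) (ih hs hU hu hv)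
  | @read q t U ℓ w h1 _ ih =>
    subst hs hU
    rw [length_bufferValue] at h1
    obtain ⟨f, hf, hf'⟩ := exists_fresh_registers hX s h1
    let wr : X → Option (Fin n) := Function.extend f some (fun _ => none)
    have h7 : ∀ j, wr (f j) = some j := fun j => hf.extend_apply _ _ _
    have h8 : ∀ x, x ∉ Set.range f → wr x = none := fun x hx =>
      Function.extend_apply' _ _ _ hx
    obtain ⟨h9, h10, h11⟩ := read_fresh hf' (writeTo_fresh h7 h8 ℓ r) hv
    have hu' : (u ++ [(f, pattern r ℓ)]).length ≤ d := by simpa using h1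
    exact .read (q' := (q, s, ⟨_, hu'⟩, false))
      ⟨rfl, rfl, rfl, rfl, f, hf', rfl, h7, h8⟩ (ih h9 h10 hu' h11)
  | @std q q' t t' lab v U e w h1 h2 h3 _ ih =>
    subst hs
    obtain ⟨v, u', rfl, rfl, rfl⟩ := List.map_eq_append_iff.1 hU
    obtain ⟨s', h4, h5⟩ := h3.symAcceptsWith hv
    have hu' : u'.length ≤ d := by simp at hu; omega
    refine .eps (q' := (q', s', ⟨u', hu'⟩, e)) (.inr ⟨rfl, h1.imp_right fun h => ?_,
      .inl ⟨lab, v, h2, h4, rfl⟩⟩) (ih h5 rfl hu' (h4.acceptsWith hv).2)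
    simpa using h
  | @skip q t ℓ U e w hb h1 h2 _ ih =>
    subst hs
    rw [← hU, enabled_iff_symEnabled hv] at h2
    obtain ⟨c, u', rfl, rfl, rfl⟩ := List.map_eq_cons_iff.1 hU
    have hu' : u'.length ≤ d := by simp at hu; omega
    refine .eps (q' := (q, s, ⟨u', hu'⟩, e)) (.inr ⟨rfl, h1.imp_right fun h => ?_,
      .inr ⟨hb, rfl, rfl, h2, c, rfl⟩⟩) (ih rfl rfl hu' (hv.2.mono Set.subset_union_left))
    simpa using h

/-- A bound for the lengths of the labels of an automaton. -/
theorem exists_length_le (A : HighAutomaton V n m) :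
    ∃ d, 1 ≤ d ∧ ∀ q lab q', (q, lab, q') ∈ A.δ → lab.length ≤ d := by
  obtain ⟨d, hd⟩ := (A.finite_δ.image fun t => t.2.1.length).bddAbove
  exact ⟨d + 1, by omega, fun q lab q' h => (hd ⟨_, h, rfl⟩).trans (by simp)⟩

/-- The register system that runs `A` with a buffer. -/
def bufferSystem (A : HighAutomaton V n m) (d : ℕ) (X : Type) [Finite X] (s : Store X m)
    (r : X → V) : RegisterSystem V n where
  Q := A.BufferState d X
  X := X
  finite_Q := by
    have := A.finite_Q
    have : Finite {u : List (Cell X n) // u.length ≤ d} := List.finite_length_le _ _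
    infer_instance
  finite_X := inferInstance
  q₀ := (A.q₀, s, ⟨[], Nat.zero_le d⟩, false)
  s₀ := r
  Δ := BufferΔ
  ε := BufferEps true
  F := BufferF

theorem language_mem_lowLanguages [hV : Nonempty V] (A : HighAutomaton V n m) :
    HighAutomaton.language A ∈ lowLanguages V n := by
  obtain ⟨d, hd1, hd⟩ := A.exists_length_le
  let X := Fin (m + d * n)
  let s : Store X m := Fin.castAdd _
  -- The registers after the first `m` are unoccupied while the buffer is empty, so their initial
  -- value is arbitrary.
  let r : X → V := Fin.append A.s₀ fun _ => hV.some
  have hs : r ∘ s = A.s₀ := by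
    funext i
    simp [r, s]
  have : (A.bufferSystem d X s r).language = HighAutomaton.language A := by
    ext w
    rw [HighAutomaton.mem_language_iff]
    constructor
    · intro h
      have := lacc_of_accepts (r := r) (p := (A.q₀, s, ⟨[], Nat.zero_le d⟩, false)) h trivial
      change A.LAcc true d A.q₀ (r ∘ s) [] false w at this
      rw [hs] at this
      exact (this.acc hd).2
    · intro h
      have := h.lacc hd1 hd (u := []) (e := false) rfl (by simp) (by simp)
      exact this.accepts (u := []) (r := r) (by simp [X]) hs rfl (Nat.zero_le d) trivial
  rw [← this]
  exact RegisterSystem.language_mem_lowLanguages _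

/-! ### From TOPL automata to hl-TOPL automata -/

end HighAutomaton

/-- An hl-TOPL automaton that simulates a TOPL automaton; the state `none` is a sink that can
be reached at any time, so that no letter is ever skipped. -/
def LowAutomaton.complete {V : Type*} {n m : ℕ} (A : LowAutomaton V n m) :
    HighAutomaton V n m where
  Q := Option A.Q
  finite_Q := by
    have := A.finite_Q
    infer_instance
  q₀ := some A.q₀
  s₀ := A.s₀
  δ := (fun t => (some t.1, [t.2.1], some t.2.2)) '' A.δ ∪
    Set.range fun q => (q, [(.triv, .nop)], none)
  finite_δ := by
    have := A.finite_Q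
    exact (A.finite_δ.image _).union (Set.finite_range _)
  F := some '' A.F

/-- If every letter enables a transition of every state then no letter is skipped. -/
theorem HighAutomaton.Acc.of_complete {V : Type*} {n m : ℕ} {A : HighAutomaton V n m}
    (h : ∀ q : A.Q, ∃ q', (q, [(.triv, .nop)], q') ∈ A.δ) {b b' : Bool} {q : A.Q} {s : Store V m}
    {w : List (Letter V n)} (hw : A.Acc b q s w) : A.Acc b' q s w := by
  induction hw with
  | fin h => exact .fin h
  | std h1 h2 _ ih => exact .std h1 h2 ih
  | @skip q s ℓ w _ h2 _ _ =>
    obtain ⟨q', h3⟩ := h q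
    exact (h2 ⟨_, q', [ℓ], s, w, h3, ⟨trivial, rfl⟩, rfl⟩).elim

theorem LowAutomaton.language_complete {V : Type*} {n m : ℕ} (A : LowAutomaton V n m) :
    HighAutomaton.language A.complete = LowAutomaton.language A := by
  ext w
  rw [HighAutomaton.mem_language_iff, LowAutomaton.mem_language_iff]
  have hc : ∀ q : A.complete.Q, ∃ q', (q, [(.triv, .nop)], q') ∈ A.complete.δ :=
    fun q => ⟨none, .inr ⟨q, rfl⟩⟩
  constructor
  · intro h
    -- The sink is not final and cannot be left, so an accepting run uses only transitions of `A`.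
    suffices ∀ (q : A.complete.Q) s, HighAutomaton.Acc A.complete false q s w →
        ∃ q' : A.Q, (show Option A.Q from q) = some q' ∧ HighAutomaton.Acc A.toHigh false q' s w by
      obtain ⟨q', h1, h2⟩ := this _ _ (h.of_complete hc)
      cases h1
      exact h2
    clear h
    intro q s h
    induction h with
    | fin h =>
      obtain ⟨q', h1, h2⟩ := h
      exact ⟨q', h2.symm, .fin h1⟩
    | std h1 h2 _ ih =>
      obtain ⟨q', rfl, h3⟩ := ih
      rcases h1 with ⟨t, h4, h5⟩ | ⟨_, h5⟩
      · cases h5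
        exact ⟨_, rfl, .std ⟨_, h4, rfl⟩ h2 h3⟩
      · cases h5
    | skip h => cases h
  · intro h
    suffices ∀ (q : A.toHigh.Q) s, HighAutomaton.Acc A.toHigh false q s w →
        HighAutomaton.Acc A.complete false (some q) s w from (this _ _ h).of_complete hc
    clear h
    intro q s h
    induction h with
    | fin h => exact .fin ⟨_, h, rfl⟩
    | std h1 h2 _ ih =>
      obtain ⟨t, h3, h4⟩ := h1
      cases h4
      exact .std (.inl ⟨t, h3, rfl⟩) h2 ih
    | skip h => cases h

theorem highLanguages_eq_lowLanguages (V : Type*) [Nonempty V] (n : ℕ) :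
    highLanguages V n = lowLanguages V n := by
  ext L
  constructor
  · rintro ⟨m, A, rfl⟩
    exact A.language_mem_lowLanguages
  · rintro ⟨m, A, rfl⟩
    exact ⟨m, A.complete, A.language_complete⟩

end TOPL

namespace TOPL

/-! ### Failure of closure under complementation -/

section
variable {V : Type*} {n m : ℕ}

/-- Transitions of a system with one register that waits for a value to be repeated: the value is
guessed in state `0`, and its repetition is awaited in state `1`. -/
inductive RepeatΔ (j : Fin n) :
    Fin 3 → Set (Unit × Fin n) → (Unit → Option (Fin n)) → Fin 3 → Prop
  | wait (q : Fin 3) (T : Set (Unit × Fin n)) : RepeatΔ j q T (fun _ => none) q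
  | guess (T : Set (Unit × Fin n)) : RepeatΔ j 0 T (fun _ => some j) 1
  | found {T : Set (Unit × Fin n)} : ((), j) ∈ T → RepeatΔ j 1 T (fun _ => none) 2

/-- Acceptance by the system that waits for a repeated value. -/
abbrev RepeatAcc (j : Fin n) : Fin 3 → (Unit → V) → List (Letter V n) → Prop :=
  Accepts (RepeatΔ j) (fun _ _ => False) {2}

theorem repeatAcc_two (j : Fin n) (s : Unit → V) (w : List (Letter V n)) :
    RepeatAcc j 2 s w := by
  induction w generalizing s with
  | nil => exact .fin rfl
  | cons ℓ w ih => exact .read (.wait _ _) (ih _)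

theorem repeatAcc_one (j : Fin n) (s : Unit → V) (w : List (Letter V n)) :
    RepeatAcc j 1 s w ↔ s () ∈ w.map (· j) := by
  induction w generalizing s with
  | nil =>
    constructor
    · intro h
      cases h with
      | fin h => cases h
      | eps h => exact h.elim
    · intro h
      cases h
  | cons ℓ w ih =>
    rw [List.map_cons, List.mem_cons]
    constructor
    · intro h
      cases h with
      | eps h => exact h.elim
      | read h1 h2 =>
        cases h1 with
        | wait => exact .inr ((ih _).1 h2)
        | found h => exact .inl h
    · rintro (h | h)
      · exact .read (.found h) (repeatAcc_two _ _ _)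
      · exact .read (.wait _ _) ((ih _).2 h)

theorem repeatAcc_zero (j : Fin n) (s : Unit → V) (w : List (Letter V n)) :
    RepeatAcc j 0 s w ↔ ¬ (w.map (· j)).Nodup := by
  induction w generalizing s with
  | nil =>
    constructor
    · intro h
      cases h with
      | fin h => cases h
      | eps h => exact h.elim
    · intro h
      exact (h List.nodup_nil).elim
  | cons ℓ w ih =>
    rw [List.map_cons, List.nodup_cons, not_and_or, not_not]
    constructor
    · intro h
      cases h with
      | eps h => exact h.elim
      | read h1 h2 =>
        cases h1 with
        | wait => exact .inr ((ih _).1 h2)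
        | guess => exact .inl ((repeatAcc_one _ _ _).1 h2)
    · rintro (h | h)
      · exact .read (.guess _) ((repeatAcc_one _ _ _).2 h)
      · exact .read (.wait _ _) ((ih _).2 h)

/-- The words in which some value of the component `j` is repeated form the language of a TOPL
automaton. -/
theorem repeat_mem_lowLanguages [hV : Nonempty V] (j : Fin n) :
    ({w | ¬ (w.map (· j)).Nodup} : Language (Letter V n)) ∈ lowLanguages V n := by
  let S : RegisterSystem V n :=
    { Q := Fin 3, X := Unit, finite_Q := inferInstance, finite_X := inferInstance, q₀ := 0,
      s₀ := fun _ => hV.some, Δ := RepeatΔ j, ε := fun _ _ => False, F := {2} }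
  have : S.language = {w | ¬ (w.map (· j)).Nodup} := by
    ext w
    exact repeatAcc_zero j _ w
  rw [← this]
  exact S.language_mem_lowLanguages

/-! ### Words without repetition are not recognizable -/

theorem LowAutomaton.walk_concat_iff {A : LowAutomaton V n m} {x z : A.Config}
    {w : List (Letter V n)} {ℓ : Letter V n} :
    LowAutomaton.Walk A x (w ++ [ℓ]) z ↔
      ∃ y, LowAutomaton.Walk A x w y ∧ LowAutomaton.Step A y ℓ z := by
  induction w generalizing x with
  | nil =>
    constructor
    · intro h
      cases h with
      | cons h1 h2 => cases h2; exact ⟨x, .nil x, h1⟩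
    · rintro ⟨y, h1, h2⟩
      cases h1
      exact .cons h2 (.nil z)
  | cons ℓ' w ih =>
    constructor
    · intro h
      cases h with
      | cons h1 h2 =>
        obtain ⟨y, h3, h4⟩ := ih.1 h2
        exact ⟨y, .cons h1 h3, h4⟩
    · rintro ⟨y, h1, h2⟩
      cases h1 with
      | cons h3 h4 => exact .cons h3 (ih.2 ⟨y, h4, h2⟩)

/-- The values in the registers come from the initial store or from the word. -/
theorem LowAutomaton.Walk.store {A : LowAutomaton V n m} {x y : A.Config}
    {w : List (Letter V n)} (h : LowAutomaton.Walk A x w y) (i : Fin m) :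
    y.2 i ∈ Set.range x.2 ∨ ∃ ℓ ∈ w, ∃ j, y.2 i = ℓ j := by
  induction h with
  | nil x => exact .inl ⟨i, rfl⟩
  | @cons x y z ℓ w h1 _ ih =>
    obtain ⟨g, a, -, -, h2⟩ := h1
    rcases ih with ⟨i', h3⟩ | ⟨ℓ', h3, j, h4⟩
    · rw [← h3, ← h2, Action.run_eq, writeTo]
      cases a.writes i' with
      | none => exact .inl ⟨i', rfl⟩
      | some j => exact .inr ⟨ℓ, List.mem_cons_self, j, rfl⟩
    · exact .inr ⟨ℓ', List.mem_cons_of_mem _ h3, j, h4⟩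

/-- A constant letter whose value is in no register has the empty pattern, so two such letters
cannot be told apart. -/
theorem Guard.sat_const_of_notMem {s : Store V m} {v v' : V} (hv : v ∉ Set.range s)
    (hv' : v' ∉ Set.range s) {g : Guard n m} (h : g.Sat s fun _ => v) : g.Sat s fun _ => v' := by
  rw [← Guard.holds_pattern] at h ⊢
  have : pattern s (fun _ : Fin n => v) = pattern s fun _ => v' := by
    ext p
    exact ⟨fun h => (hv ⟨_, h⟩).elim, fun h => (hv' ⟨_, h⟩).elim⟩
  rwa [← this]

/-- Suppose that `m` registers recognize the words without repetition. After `m + 1` distinct values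
from outside the initial store, a further fresh value is accepted. By the pigeonhole principle one
of the earlier values is in no register; put in place of the fresh one, it is accepted by the same
last transition, although it is a repetition. -/
theorem not_closedUnderComplement_lowLanguages [Infinite V] (hn : 1 ≤ n) :
    ¬ ClosedUnderComplement (lowLanguages V n) := by
  intro h
  let j : Fin n := ⟨0, hn⟩
  obtain ⟨m, A, hA⟩ := h _ (repeat_mem_lowLanguages j)
  have hA' : ∀ w, w ∈ LowAutomaton.language A ↔ (w.map (· j)).Nodup := by
    intro w
    rw [hA]
    exact not_not
  have hinf : (Set.range A.s₀)ᶜ.Infinite := (Set.finite_range A.s₀).infinite_compl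
  let f : ℕ → V := fun i => hinf.natEmbedding _ i
  have hf : Function.Injective f := Subtype.val_injective.comp (hinf.natEmbedding _).injective
  have hf0 : ∀ i, f i ∉ Set.range A.s₀ := fun i => (hinf.natEmbedding _ i).2
  let w : List (Letter V n) := (List.range (m + 1)).map fun i _ => f i
  have hw : w.map (· j) = (List.range (m + 1)).map f := by simp [w]
  have h1 : w ++ [fun _ => f (m + 1)] ∈ LowAutomaton.language A := by
    rw [hA', List.map_append, hw]
    have : (List.range (m + 1)).map f ++ List.map (· j) [fun _ : Fin n => f (m + 1)] =
        (List.range (m + 2)).map f := by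
      rw [List.range_succ (n := m + 1), List.map_append]
      rfl
    rw [this]
    exact List.nodup_range.map hf
  obtain ⟨x, h1, hF⟩ := h1
  obtain ⟨y, h1, g, a, h2, h3, -⟩ := LowAutomaton.walk_concat_iff.1 h1
  have h4 : f (m + 1) ∉ Set.range y.2 := by
    rintro ⟨i, hi⟩
    rcases h1.store i with h4 | ⟨ℓ, h4, k, h5⟩
    · exact hf0 _ (hi ▸ h4)
    · obtain ⟨i', h6, rfl⟩ := List.mem_map.1 h4
      rw [hi] at h5
      have := hf h5
      rw [List.mem_range] at h6
      omega
  obtain ⟨i, hi, h5⟩ : ∃ i < m + 1, f i ∉ Set.range y.2 := by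
    by_contra! hcon
    have : Set.InjOn f (Set.Iio (m + 1)) := hf.injOn
    have h6 := Set.ncard_le_ncard (s := f '' Set.Iio (m + 1)) (t := Set.range y.2)
      (by rintro _ ⟨i, hi, rfl⟩; exact hcon i hi) (Set.finite_range _)
    rw [Set.ncard_image_of_injective _ hf, ← Set.image_univ] at h6
    have h7 := Set.ncard_image_le (f := y.2) (s := Set.univ)
    have h8 : (Set.Iio (m + 1)).ncard = m + 1 := by
      rw [← Finset.coe_Iio, Set.ncard_coe_finset]; simp
    simp only [Set.ncard_univ, Nat.card_eq_fintype_card, Fintype.card_fin] at h7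
    omega
  have h6 : w ++ [fun _ => f i] ∈ LowAutomaton.language A :=
    ⟨(x.1, a.run (fun _ => f i) y.2), LowAutomaton.walk_concat_iff.2
      ⟨y, h1, g, a, h2, Guard.sat_const_of_notMem h4 h5 h3, rfl⟩, hF⟩
  rw [hA', List.map_append, hw, List.nodup_append] at h6
  exact h6.2.2 (f i) (List.mem_map_of_mem (List.mem_range.2 hi)) (f i) (by simp) rfl

end

end TOPL

namespace TOPL

/-! ### Stack machines -/

/-- The operations of a stack machine, on stacks indexed by `K` over the alphabet `Γ`. -/
inductive StackOp (K Γ : Type) : Type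
  | nop
  | push (k : K) (a : Γ)
  | look (k : K) (a : Γ) (pop : Bool)
  | empty (k : K)

namespace StackOp

variable {K Γ : Type} [DecidableEq K]

/-- The effect of an operation on the stacks; `look` and `empty` can be blocked. -/
def Apply : StackOp K Γ → (K → List Γ) → (K → List Γ) → Prop
  | nop, S, S' => S' = S
  | push k a, S, S' => S' = Function.update S k (a :: S k)
  | look k a pop, S, S' => ∃ l, S k = a :: l ∧ S' = if pop then Function.update S k l else S
  | empty k, S, S' => S k = [] ∧ S' = S

end StackOp

/-- A stack machine with states in `P`, in which a transition is chosen by an element of `B`, can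
reach the state `h`. -/
inductive Halts {K Γ B P : Type} [DecidableEq K] (next : P → B → StackOp K Γ × P) (h : P) :
    P → (K → List Γ) → Prop
  | done {S} : Halts next h h S
  | step {p S S'} (b : B) : (next p b).1.Apply S S' → Halts next h (next p b).2 S' →
      Halts next h p S

theorem halts_map_iff {K Γ B P P' : Type} [DecidableEq K] {next : P → B → StackOp K Γ × P}
    {next' : P' → B → StackOp K Γ × P'} {f : P → P'} (hf : Function.Injective f)
    (hn : ∀ p b, next' (f p) b = ((next p b).1, f (next p b).2)) (h p : P) (S : K → List Γ) :
    Halts next' (f h) (f p) S ↔ Halts next h p S := by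
  constructor
  · intro H
    generalize hq : f p = q at H
    induction H generalizing p with
    | done => rw [hf hq]; exact .done
    | step b h1 _ ih =>
      subst hq
      rw [hn] at h1
      exact .step b h1 (ih _ (by rw [hn]))
  · intro H
    induction H with
    | done => exact .done
    | step b h1 _ ih => exact .step b (by rw [hn]; exact h1) (by rw [hn]; exact ih)

/-! ### An automaton that accepts what is not the history of a halting computation

A history is a word made of blocks of three values. The first one tells which transition is
taken. The stacks are linked lists in which a value stands for a node; a block that pushes the
letter `a` contains the current top and the new top, and a block that looks at the top contains
the current top and the next node. -/

/-- The registers: constants for the transitions, the tops of the stacks, and a node and its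
successor that have been saved. -/
inductive HistoryReg (K Γ : Type) : Type
  | const (b : Option Γ)
  | top (k : K)
  | succ
  | node
  deriving DecidableEq, Fintype

/-- The second component of the states of the automaton. The letter at the saved node, if any, is
recorded in `μ`; the flag tells that an item is being saved or checked. -/
inductive HistoryState (Γ : Type) : Type
  | err
  | sink
  | zeroth (μ : Option Γ)
  | first (b μ : Option Γ)
  | second (b μ : Option Γ) (flag : Bool)
  deriving DecidableEq, Fintype

set_option linter.unusedSectionVars false

namespace History

open HistoryReg HistoryState

variable {K Γ : Type} [Fintype Γ] [DecidableEq Γ]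

/-- A condition on a value: a conjunction of equalities and inequalities with registers. -/
abbrev Test (K Γ : Type) := List (Bool × HistoryReg K Γ)

/-- The value satisfies the condition. -/
def Test.Sat {V : Type*} (t : HistoryReg K Γ → V) (v : V) (g : Test K Γ) : Prop :=
  ∀ x ∈ g, (x.1 = true ↔ t x.2 = v)

/-- Errors on the first value of a block. -/
def bad₁ : StackOp K Γ → List (Bool × HistoryReg K Γ)
  | .nop => []
  | .push k _ => [(false, top k)]
  | .look k _ _ => [(false, top k), (true, const none)]
  | .empty k => [(false, const none), (false, top k)]

/-- Raising the flag on the first value of a block: a push is going to be saved, or the saved node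
is being looked at. -/
def flag : StackOp K Γ → Option Γ → List (Test K Γ × List (HistoryReg K Γ))
  | .push _ _, none => [([], [succ])]
  | .look _ _ _, some _ => [([(true, node)], [])]
  | _, _ => []

/-- Errors on the second value of a block. -/
def bad₂ : StackOp K Γ → Option Γ → Bool → List (Test K Γ)
  | .push _ _, _, _ => [[(true, const none)]]
  | .look _ a _, some a', true => if a = a' then [[(false, succ)]] else [[]]
  | _, _, _ => []

/-- The register set to the second value of a block. -/
def write : StackOp K Γ → List (HistoryReg K Γ)
  | .push k _ => [top k]
  | .look k _ true => [top k]
  | _ => []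

/-- Saving a push. -/
def save : StackOp K Γ → Option Γ → List (List (HistoryReg K Γ) × Γ)
  | .push k a, none => [([node, top k], a)]
  | _, _ => []

/-- The transitions of the automaton from a state, for the transition `b` of the machine, which
performs `op`. They consist of a condition, the registers to be written, whether the machine
moves on, and the new state. -/
noncomputable def out (b : Option Γ) (op : StackOp K Γ) (w : HistoryState Γ) :
    List ((Test K Γ × List (HistoryReg K Γ)) × Bool × HistoryState Γ) :=
  (([], []), false, sink) :: match w with
  | err => [(([], []), false, err)]
  | sink => []
  | zeroth μ => [(([(true, const b)], []), false, first b μ),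
      ((Finset.univ.toList.map fun b' => (false, const b'), []), false, err)]
  | first b' μ => if b' = b then
        (bad₁ op).map (fun x => (([x], []), false, err)) ++
        (([], []), false, second b μ false) ::
        (flag op μ).map (fun x => (x, false, second b μ true))
      else []
  | second b' μ fl => if b' = b then
        (bad₂ op μ fl).map (fun g => ((g, []), false, err)) ++
        if fl then (save op μ).map (fun x => (([], x.1), true, zeroth (some x.2)))
        else [(([], write op), true, zeroth μ)]
      else []

/-- The final states. -/
def Final (h p : ℕ) (w : HistoryState Γ) : Prop :=
  w ≠ sink ∧ ¬ (p = h ∧ ∃ μ, w = zeroth μ)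

/-- Setting registers to a value. -/
def assign {V R : Type*} [DecidableEq R] (v : V) (rs : List R) (t : R → V) : R → V :=
  fun r => if r ∈ rs then v else t r

variable {V : Type*} [DecidableEq K] (next : ℕ → Option Γ → StackOp K Γ × ℕ) (h : ℕ)

/-- Acceptance of a list of values. -/
def Acc : ℕ → HistoryState Γ → (HistoryReg K Γ → V) → List V → Prop
  | p, w, _, [] => Final h p w
  | p, w, t, v :: u => ∃ b g rs mv w', ((g, rs), mv, w') ∈ out b (next p b).1 w ∧ g.Sat t v ∧
      Acc (if mv then (next p b).2 else p) w' (assign v rs t) u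

variable {next h}

@[simp] theorem assign_nil {V R : Type*} [DecidableEq R] (v : V) (t : R → V) :
    assign v [] t = t := by
  funext r
  simp [assign]

@[simp] theorem Test.sat_nil (t : HistoryReg K Γ → V) (v : V) : Test.Sat t v [] := by
  simp [Test.Sat]

theorem acc_err (p : ℕ) (t : HistoryReg K Γ → V) (u : List V) : Acc next h p err t u := by
  induction u with
  | nil => simp [Acc, Final]
  | cons v u ih => exact ⟨none, [], [], false, err, by simp [out], by simp, by simpa using ih⟩

theorem not_acc_sink (p : ℕ) (t : HistoryReg K Γ → V) (u : List V) :
    ¬ Acc next h p sink t u := by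
  induction u generalizing t with
  | nil => simp [Acc, Final]
  | cons v u ih =>
    rintro ⟨b, g, rs, mv, w', h1, h2, h3⟩
    simp only [out, List.mem_singleton, Prod.mk.injEq] at h1
    obtain ⟨-, rfl, rfl⟩ := h1
    exact ih _ h3

/-- One letter of `Acc` is unfolded for each of the three positions in a block. The entry that leads
to the sink never contributes, and an error accepts at once by `acc_err`. -/
theorem acc_zeroth_iff {p : ℕ} {μ : Option Γ} {t : HistoryReg K Γ → V} {v : V} {u : List V} :
    Acc next h p (zeroth μ) t (v :: u) ↔
      (∃ b, t (const b) = v ∧ Acc next h p (first b μ) t u) ∨ ∀ b, t (const b) ≠ v := by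
  constructor
  · rintro ⟨b, g, rs, mv, w', h1, h2, h3⟩
    simp only [out, List.mem_cons, Prod.mk.injEq, List.not_mem_nil, or_false] at h1
    rcases h1 with ⟨-, rfl, rfl⟩ | ⟨⟨rfl, rfl⟩, rfl, rfl⟩ | ⟨⟨rfl, rfl⟩, rfl, rfl⟩
    · exact (not_acc_sink _ _ _ h3).elim
    · exact .inl ⟨b, by simpa [Test.Sat] using h2, by simpa using h3⟩
    · exact .inr (by simpa [Test.Sat] using h2)
  · rintro (⟨b, h1, h2⟩ | h1)
    · exact ⟨b, [(true, const b)], [], false, first b μ, by simp [out], by simpa [Test.Sat],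
        by simpa using h2⟩
    · exact ⟨none, Finset.univ.toList.map fun b' => (false, const b'), [], false, err,
        by simp [out], by simpa [Test.Sat] using h1, acc_err _ _ _⟩

theorem acc_first_iff {p : ℕ} {b μ : Option Γ} {t : HistoryReg K Γ → V} {v : V} {u : List V} :
    Acc next h p (first b μ) t (v :: u) ↔
      (∃ x ∈ bad₁ (next p b).1, (x.1 = true ↔ t x.2 = v)) ∨
      Acc next h p (second b μ false) t u ∨
      ∃ x ∈ flag (next p b).1 μ, x.1.Sat t v ∧
        Acc next h p (second b μ true) (assign v x.2 t) u := by
  constructor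
  · rintro ⟨b', g, rs, mv, w', h1, h2, h3⟩
    rw [out, List.mem_cons] at h1
    rcases h1 with h1 | h1
    · cases h1
      exact (not_acc_sink _ _ _ h3).elim
    · split_ifs at h1 with hb
      · subst hb
        simp only [List.mem_append, List.mem_map, List.mem_cons] at h1
        rcases h1 with ⟨x, h4, h5⟩ | h1 | ⟨x, h4, h5⟩
        · cases h5
          exact .inl ⟨x, h4, by simpa [Test.Sat] using h2⟩
        · cases h1
          exact .inr (.inl (by simpa using h3))
        · cases h5
          exact .inr (.inr ⟨_, h4, h2, by simpa using h3⟩)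
      · cases h1
  · rintro (⟨x, h1, h2⟩ | h1 | ⟨x, h1, h2, h3⟩)
    · exact ⟨b, [x], [], false, err, by simp [out, h1], by simpa [Test.Sat] using h2,
        acc_err _ _ _⟩
    · exact ⟨b, [], [], false, second b μ false, by simp [out], by simp, by simpa using h1⟩
    · exact ⟨b, x.1, x.2, false, second b μ true, by simp [out, h1], h2, by simpa using h3⟩

theorem acc_second_iff {p : ℕ} {b μ : Option Γ} {fl : Bool} {t : HistoryReg K Γ → V} {v : V}
    {u : List V} :
    Acc next h p (second b μ fl) t (v :: u) ↔
      (∃ g ∈ bad₂ (next p b).1 μ fl, g.Sat t v) ∨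
      (fl = false ∧ Acc next h (next p b).2 (zeroth μ) (assign v (write (next p b).1) t) u) ∨
      (fl = true ∧ ∃ x ∈ save (next p b).1 μ,
        Acc next h (next p b).2 (zeroth (some x.2)) (assign v x.1 t) u) := by
  constructor
  · rintro ⟨b', g, rs, mv, w', h1, h2, h3⟩
    rw [out, List.mem_cons] at h1
    rcases h1 with h1 | h1
    · cases h1
      exact (not_acc_sink _ _ _ h3).elim
    · by_cases hb : b = b'
      · subst hb
        rw [if_pos rfl, List.mem_append] at h1
        rcases h1 with h1 | h1
        · obtain ⟨x, h4, h5⟩ := List.mem_map.1 h1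
          cases h5
          exact .inl ⟨_, h4, h2⟩
        · cases fl with
          | false =>
            rw [if_neg (by simp), List.mem_singleton] at h1
            cases h1
            exact .inr (.inl ⟨rfl, h3⟩)
          | true =>
            rw [if_pos rfl, List.mem_map] at h1
            obtain ⟨x, h4, h5⟩ := h1
            cases h5
            exact .inr (.inr ⟨rfl, x, h4, h3⟩)
      · rw [if_neg hb] at h1
        cases h1
  · rintro (⟨g, h1, h2⟩ | ⟨rfl, h1⟩ | ⟨rfl, x, h1, h2⟩)
    · exact ⟨b, g, [], false, err, by simp [out, h1], h2, acc_err _ _ _⟩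
    · exact ⟨b, [], _, true, zeroth μ, by simp [out], by simp, h1⟩
    · exact ⟨b, [], x.1, true, zeroth (some x.2), by
        simp only [out, List.mem_cons, if_true, List.mem_append, List.mem_map]
        exact .inr (.inr ⟨x, h1, rfl⟩), by simp, h2⟩

/-! ### Histories of halting computations are rejected -/

/-- The registers are those of a history in which the stack contents `l` are represented by
`ι l`. -/
structure Represents (c : Option Γ → V) (ι : List Γ → V) (t : HistoryReg K Γ → V)
    (μ : Option Γ) (S : K → List Γ) : Prop where
  const : ∀ b, t (const b) = c b
  top : ∀ k, t (top k) = ι (S k)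
  saved : ∀ a, μ = some a → ∃ l, t succ = ι l ∧ t node = ι (a :: l)

/-- The history of a halting computation is not accepted. -/
theorem exists_not_acc_of_halts {c : Option Γ → V} (hc : Function.Injective c)
    {ι : List Γ → V} (hι : Function.Injective ι) (hz : c none = ι []) {p : ℕ} {S : K → List Γ}
    (H : Halts next h p S) :
    ∃ u, ∀ t μ, Represents c ι t μ S → ¬ Acc next h p (zeroth μ) t u := by
  induction H with
  | done => exact ⟨[], fun t μ _ hA => hA.2 ⟨rfl, μ, rfl⟩⟩
  | @step p S S' b h1 _ ih =>
    obtain ⟨u, ih⟩ := ih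
    -- Since `c` is injective, the first value `c b` is decoded as `b` only. The other two depend on
    -- the operation: the contents before and after a push, the contents and their tail for a look,
    -- and the end marker twice for the remaining operations.
    suffices ∃ v₁ v₂, ∀ t μ, Represents c ι t μ S →
        ¬ Acc next h p (first b μ) t (v₁ :: v₂ :: u) by
      obtain ⟨v₁, v₂, H⟩ := this
      refine ⟨c b :: v₁ :: v₂ :: u, fun t μ ht hA => ?_⟩
      rcases acc_zeroth_iff.1 hA with ⟨b', h2, h3⟩ | h2
      · rw [ht.const] at h2
        rw [hc h2] at h3
        exact H t μ ht h3
      · exact h2 b (ht.const b)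
    cases hop : (next p b).1 with
    | nop =>
      obtain rfl : S' = S := by simpa [hop, StackOp.Apply] using h1
      refine ⟨c none, c none, fun t μ ht hA => ih t μ ht ?_⟩
      simpa [acc_first_iff, acc_second_iff, hop, bad₁, flag, bad₂, write] using hA
    | empty k =>
      obtain ⟨h1, rfl⟩ : S k = [] ∧ S' = S := by simpa [hop, StackOp.Apply] using h1
      refine ⟨c none, c none, fun t μ ht hA => ih t μ ht ?_⟩
      simpa [acc_first_iff, acc_second_iff, hop, bad₁, flag, bad₂, write, ht.const, ht.top, h1,
        hz] using hA
    | push k a =>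
      obtain rfl : S' = Function.update S k (a :: S k) := by simpa [hop, StackOp.Apply] using h1
      refine ⟨ι (S k), ι (a :: S k), fun t μ ht hA => ?_⟩
      -- The end marker represents only the empty stack, so the new top is not mistaken for it.
      have hne : ι [] ≠ ι (a :: S k) := fun h => by cases hι h
      rcases acc_first_iff.1 hA with h2 | h2 | ⟨x, h2, -, h3⟩
      · simp [hop, bad₁, ht.top] at h2
      · rcases acc_second_iff.1 h2 with h3 | ⟨-, h3⟩ | ⟨h3, -⟩
        · simp [hop, bad₂, Test.Sat, ht.const, hz, hne] at h3
        · refine ih _ _ ⟨fun b => ?_, fun k' => ?_, fun a' ha' => ?_⟩ h3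
          · simp [hop, write, assign, ht.const]
          · by_cases hk : k' = k
            · subst hk; simp [hop, write, assign]
            · simp [hop, write, assign, hk, ht.top]
          · simpa [hop, write, assign] using ht.saved a' ha'
        · cases h3
      · cases μ with
        | some a' => simp [hop, flag] at h2
        | none =>
          obtain rfl : x = ([], [succ]) := by simpa [hop, flag] using h2
          rcases acc_second_iff.1 h3 with h3 | ⟨h3, -⟩ | ⟨-, x, h4, h3⟩
          · simp [hop, bad₂, Test.Sat, assign, ht.const, hz, hne] at h3
          · cases h3
          · obtain rfl : x = ([node, top k], a) := by simpa [hop, save] using h4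
            refine ih _ _ ⟨fun b => ?_, fun k' => ?_, fun a' ha' => ?_⟩ h3
            · simp [assign, ht.const]
            · by_cases hk : k' = k
              · subst hk; simp [assign]
              · simp [assign, hk, ht.top]
            · cases ha'
              exact ⟨S k, by simp [assign], by simp [assign]⟩
    | look k a pop =>
      obtain ⟨l, h0, h1⟩ : ∃ l, S k = a :: l ∧ S' = if pop then Function.update S k l else S := by
        simpa [hop, StackOp.Apply] using h1
      refine ⟨ι (a :: l), ι l, fun t μ ht hA => ?_⟩
      have hne : ι [] ≠ ι (a :: l) := fun h => by cases hι h
      rcases acc_first_iff.1 hA with h2 | h2 | ⟨x, h2, h3, h4⟩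
      · simp [hop, bad₁, ht.top, ht.const, hz, hne, h0] at h2
      · rcases acc_second_iff.1 h2 with h3 | ⟨-, h3⟩ | ⟨h3, -⟩
        · simp [hop, bad₂] at h3
        · subst h1
          cases pop with
          | false =>
            refine ih _ _ ?_ h3
            simpa [hop, write] using ht
          | true =>
            refine ih _ _ ⟨fun b => ?_, fun k' => ?_, fun a' ha' => ?_⟩ h3
            · simp [hop, write, assign, ht.const]
            · by_cases hk : k' = k
              · subst hk; simp [hop, write, assign]
              · simp [hop, write, assign, hk, ht.top]
            · simpa [hop, write, assign] using ht.saved a' ha'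
        · cases h3
      · cases μ with
        | none => simp [hop, flag] at h2
        | some a' =>
          obtain rfl : x = ([(true, node)], []) := by simpa [hop, flag] using h2
          obtain ⟨l', h5, h6⟩ := ht.saved a' rfl
          -- The saved node is the one being looked at. Injectivity of `ι` then identifies both
          -- letter and successor, so no error is found; since a look has nothing to save, the
          -- flagged run cannot finish its block except in the sink.
          have h7 : ι (a' :: l') = ι (a :: l) := by simpa [Test.Sat, h6] using h3
          obtain ⟨rfl, rfl⟩ : a' = a ∧ l' = l := by simpa using hι h7
          rcases acc_second_iff.1 h4 with h3 | ⟨h3, -⟩ | ⟨-, x, h4, h3⟩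
          · simp [hop, bad₂, Test.Sat, assign, h5] at h3
          · cases h3
          · simp [hop, save] at h4

/-! ### Rejected words are histories of halting computations -/

/-- The value `v` is the top of a linked list with nodes in `Φ`. -/
def Chain (Φ : Set (V × Γ × V)) (z : V) : List Γ → V → Prop
  | [], v => v = z
  | a :: l, v => ∃ x, (v, a, x) ∈ Φ ∧ Chain Φ z l x

theorem Chain.mono {Φ Φ' : Set (V × Γ × V)} (hΦ : Φ ⊆ Φ') {z : V} {l : List Γ} {v : V}
    (H : Chain Φ z l v) : Chain Φ' z l v := by
  induction l generalizing v with
  | nil => exact H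
  | cons a l ih =>
    obtain ⟨x, h1, h2⟩ := H
    exact ⟨x, hΦ h1, ih h2⟩

/-- The registers after saving the node `y` with successor `x`. -/
def saveNode (t : HistoryReg K Γ → V) (x y : V) : HistoryReg K Γ → V :=
  assign x [succ] (assign y [node] t)

/-- What is not accepted is the history of a halting computation. The set `Φ` consists of the nodes
that have been pushed, none of which leads to acceptance when it has been saved. -/
theorem halts_of_not_acc {p : ℕ} {t : HistoryReg K Γ → V} {u : List V} {S : K → List Γ}
    {Φ : Set (V × Γ × V)} (hA : ¬ Acc next h p (zeroth none) t u)
    (hΦ : ∀ φ ∈ Φ, φ.1 ≠ t (const none) ∧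
      ¬ Acc next h p (zeroth (some φ.2.1)) (saveNode t φ.2.2 φ.1) u)
    (hS : ∀ k, Chain Φ (t (const none)) (S k) (t (top k))) : Halts next h p S := by
  match u with
  | [] =>
    have : p = h := by
      by_contra hp
      exact hA ⟨by simp, by simp [hp]⟩
    exact this ▸ .done
  | [v₀] =>
    rw [acc_zeroth_iff] at hA
    push Not at hA
    obtain ⟨h1, b, h2⟩ := hA
    exact (h1 b h2 ⟨by simp, by simp⟩).elim
  | [v₀, v₁] =>
    rw [acc_zeroth_iff] at hA
    push Not at hA
    obtain ⟨h1, b, h2⟩ := hA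
    have := h1 b h2
    rw [acc_first_iff] at this
    push Not at this
    exact (this.2.1 ⟨by simp, by simp⟩).elim
  | v₀ :: v₁ :: v₂ :: u =>
    rw [acc_zeroth_iff] at hA
    push Not at hA
    obtain ⟨h1, b, h2⟩ := hA
    have hA := h1 b h2
    replace hΦ : ∀ φ ∈ Φ, φ.1 ≠ t (const none) ∧
        ¬ Acc next h p (first b (some φ.2.1)) (saveNode t φ.2.2 φ.1) (v₁ :: v₂ :: u) := by
      intro φ hφ
      refine ⟨(hΦ φ hφ).1, fun hA => (hΦ φ hφ).2 (acc_zeroth_iff.2 (.inl ⟨b, ?_, hA⟩))⟩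
      simpa [saveNode, assign] using h2
    rw [acc_first_iff, acc_second_iff] at hA
    push Not at hA
    obtain ⟨h3, ⟨h4, h5, -⟩, h6⟩ := hA
    replace h5 := h5 rfl
    have hΦ' : ∀ φ ∈ Φ, ¬ Acc next h (next p b).2 (zeroth (some φ.2.1))
        (assign v₂ (write (next p b).1) (saveNode t φ.2.2 φ.1)) u := fun φ hφ hA =>
      (hΦ φ hφ).2 (acc_first_iff.2 (.inr (.inl (acc_second_iff.2 (.inr (.inl ⟨rfl, hA⟩))))))
    -- A block without a flag writes only to tops of stacks, which are different from the two
    -- registers of the saved node.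
    have hwrite : ∀ x y, assign v₂ (write (next p b).1) (saveNode t x y) =
        saveNode (assign v₂ (write (next p b).1) t) x y := by
      intro x y
      funext r
      cases (next p b).1 with
      | look k a pop => cases pop <;> cases r <;> simp [saveNode, assign, write]
      | _ => cases r <;> simp [saveNode, assign, write]
    have hconst : assign v₂ (write (next p b).1) t (const none) = t (const none) := by
      cases (next p b).1 with
      | look k a pop => cases pop <;> simp [assign, write]
      | _ => simp [assign, write]
    simp only [hwrite] at hΦ'
    cases hop : (next p b).1 with
    | nop =>
      simp only [hop, write, assign_nil] at h5 hΦ'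
      refine .step b (S' := S) (by rw [hop]; rfl)
        (halts_of_not_acc h5 (fun φ hφ => ⟨(hΦ φ hφ).1, hΦ' φ hφ⟩) hS)
    | empty k =>
      simp only [hop, write, assign_nil] at h5 hΦ'
      simp only [hop, bad₁, List.mem_cons, List.not_mem_nil, or_false, forall_eq_or_imp,
        forall_eq] at h3
      -- A nonempty stack would have a pushed node on top, and no pushed node is the end marker.
      have h7 : S k = [] := by
        have h8 := hS k
        have h9 : t (top k) = t (const none) := by
          have h9 : t (const none) = v₁ := by simpa using h3.1
          have h10 : t (top k) = v₁ := by simpa using h3.2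
          rw [h9, h10]
        cases h10 : S k with
        | nil => rfl
        | cons a l =>
          rw [h10] at h8
          obtain ⟨x, h8, -⟩ := h8
          exact ((hΦ _ h8).1 h9).elim
      exact .step b (S' := S) (by simp [hop, StackOp.Apply, h7])
        (halts_of_not_acc h5 (fun φ hφ => ⟨(hΦ φ hφ).1, hΦ' φ hφ⟩) hS)
    | push k a =>
      simp only [hop, write] at h5 hΦ' hconst
      have h7 : t (top k) = v₁ := by
        have h7 := h3 (false, top k) (by simp [hop, bad₁])
        simpa using h7
      have h8 : v₂ ≠ t (const none) := by
        rintro rfl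
        exact h4 [(true, const none)] (by simp [hop, bad₂]) (by simp [Test.Sat])
      -- This concerns the run that guesses that the present push is the one to save; it justifies
      -- adding the new node to `Φ`.
      have h9 : ¬ Acc next h (next p b).2 (zeroth (some a))
          (saveNode (assign v₂ [top k] t) v₁ v₂) u := by
        have h10 := h6 ([], [succ]) (by simp [hop, flag]) (by simp)
        rw [acc_second_iff] at h10
        push Not at h10
        have h11 := h10.2.2 rfl ([node, top k], a) (by simp [hop, save])
        convert h11 using 2
        funext r
        cases r <;> simp [saveNode, assign]
      refine .step b (S' := Function.update S k (a :: S k)) (by rw [hop]; rfl)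
        (halts_of_not_acc (Φ := insert (v₂, a, v₁) Φ) h5 ?_ fun k' => ?_)
      · rintro φ (rfl | hφ)
        · exact ⟨by rwa [hconst], h9⟩
        · exact ⟨by rw [hconst]; exact (hΦ φ hφ).1, hΦ' φ hφ⟩
      · rw [hconst]
        by_cases hk : k' = k
        · subst hk
          simp only [Function.update_self]
          refine ⟨v₁, ?_, ?_⟩
          · simp [assign]
          · exact h7 ▸ (hS k').mono (Set.subset_insert _ _)
        · simp only [Function.update_of_ne hk]
          have : assign v₂ [top k] t (top k') = t (top k') := by simp [assign, hk]
          rw [this]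
          exact (hS k').mono (Set.subset_insert _ _)
    | look k a pop =>
      have h7 : t (top k) = v₁ ∧ t (const none) ≠ v₁ := by simpa [hop, bad₁] using h3
      obtain ⟨a', l, h8, h9⟩ : ∃ a' l, S k = a' :: l ∧ Chain Φ (t (const none)) (a' :: l) v₁ := by
        have h8 := hS k
        rw [h7.1] at h8
        cases hl : S k with
        | nil =>
          rw [hl] at h8
          exact (h7.2 h8.symm).elim
        | cons a' l => exact ⟨a', l, rfl, hl ▸ h8⟩
      obtain ⟨x, h10, h11⟩ := h9
      have h12 := (hΦ _ h10).2
      rw [acc_first_iff] at h12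
      push Not at h12
      have h13 := h12.2.2 ([(true, node)], []) (by simp [hop, flag])
        (by simp [Test.Sat, saveNode, assign])
      rw [acc_second_iff] at h13
      push Not at h13
      have h14 := h13.1
      -- The run that saved the push of `(v₁, a', x)` recognizes its node here and would accept if
      -- the letter or the successor were different. A value may have been pushed several times:
      -- every node in `Φ` with this value has to pass the same test.
      have h15 : a' = a ∧ x = v₂ := by
        by_cases haa : a = a'
        · subst haa
          simpa [hop, bad₂, Test.Sat, saveNode, assign] using h14
        · exact (h14 [] (by simp [hop, bad₂, haa]) (by simp)).elim
      obtain ⟨rfl, rfl⟩ := h15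
      refine .step b (S' := if pop then Function.update S k l else S)
        (by simp [hop, StackOp.Apply, h8])
        (halts_of_not_acc (Φ := Φ) h5 (fun φ hφ => ?_) fun k' => ?_)
      · rw [hconst]
        exact ⟨(hΦ φ hφ).1, hΦ' φ hφ⟩
      · rw [hconst]
        cases pop with
        | false => simpa [hop, write] using hS k'
        | true =>
          by_cases hk : k' = k
          · subst hk
            simpa [hop, write, assign] using h11
          · simpa [hop, write, assign, hk] using hS k'
termination_by u.length

end History
end TOPL

namespace TOPL

open Turing

/-! ### Stack machines from Turing machines with several stacks -/

namespace StackMachine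

set_option linter.unusedSectionVars false

variable {K Γ Λ σ : Type} [DecidableEq K]

/-- The small steps of a machine with several stacks; a state consists of the statement that is
being executed, or `none` after halting, and the local variables. -/
def next (M : Λ → TM2.Stmt (fun _ : K => Γ) Λ σ) (d : σ) :
    Option (TM2.Stmt (fun _ : K => Γ) Λ σ) × σ → Option Γ →
      StackOp K Γ × (Option (TM2.Stmt (fun _ : K => Γ) Λ σ) × σ)
  | (none, _), _ => (.nop, none, d)
  | (some (.push k f q), v), _ => (.push k (f v), some q, v)
  | (some (.peek k f q), v), b => (b.elim (.empty k) (fun a => .look k a false), some q, f v b)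
  | (some (.pop k f q), v), b => (b.elim (.empty k) (fun a => .look k a true), some q, f v b)
  | (some (.load f q), v), _ => (.nop, some q, f v)
  | (some (.branch f q₁ q₂), v), _ => (.nop, some (cond (f v) q₁ q₂), v)
  | (some (.goto l), v), _ => (.nop, some (M (l v)), v)
  -- The local variables are reset, so that there is a single halting state.
  | (some .halt, _), _ => (.nop, none, d)

variable {M : Λ → TM2.Stmt (fun _ : K => Γ) Λ σ} {d : σ}

/-- The execution of a statement is replayed by small steps; at a `peek` or `pop` the free choice is
set to what is actually on top. -/
theorem halts_of_stepAux (q : TM2.Stmt (fun _ : K => Γ) Λ σ) (v : σ) (S : K → List Γ)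
    (H : ∀ l, (TM2.stepAux q v S).l = some l →
      Halts (next M d) (none, d) (some (M l), (TM2.stepAux q v S).var) (TM2.stepAux q v S).stk) :
    Halts (next M d) (none, d) (some q, v) S := by
  induction q generalizing v S with
  | push k f q ih => exact .step none rfl (ih _ _ H)
  | peek k f q ih =>
    cases hS : S k with
    | nil => exact .step none (S' := S) ⟨hS, rfl⟩ (ih _ _ (by simpa [hS] using H))
    | cons a l => exact .step (some a) (S' := S) ⟨l, hS, rfl⟩ (ih _ _ (by simpa [hS] using H))
  | pop k f q ih =>
    cases hS : S k with
    | nil =>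
      have : Function.update S k [] = S := by rw [← hS, Function.update_eq_self]
      exact .step none (S' := S) ⟨hS, rfl⟩ (ih _ _ (by simpa [hS, this] using H))
    | cons a l => exact .step (some a) ⟨l, hS, rfl⟩ (ih _ _ (by simpa [hS] using H))
  | load f q ih => exact .step none rfl (ih _ _ H)
  | branch f q₁ q₂ ih₁ ih₂ =>
    refine .step none (S' := S) rfl ?_
    rw [TM2.stepAux] at H
    cases h : f v
    · rw [h] at H
      simpa [next, h] using ih₂ _ _ H
    · rw [h] at H
      simpa [next, h] using ih₁ _ _ H
  | goto l => exact .step none rfl (H _ rfl)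
  | halt => exact .step none (S' := S) rfl .done

/-- A wrong guess of the top blocks the machine, so a halting run must follow the deterministic
computation. -/
theorem dom_of_halts {q : TM2.Stmt (fun _ : K => Γ) Λ σ} {v : σ} {S : K → List Γ}
    (H : Halts (next M d) (none, d) (some q, v) S) :
    (StateTransition.eval (TM2.step M) (TM2.stepAux q v S)).Dom := by
  generalize hp : (some q, v) = p at H
  induction H generalizing q v with
  | done => cases hp
  | @step p S S' b h1 _ ih =>
    subst hp
    cases q with
    | push k f q =>
      obtain rfl : S' = _ := h1
      exact ih rfl
    | peek k f q =>
      cases b with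
      | none =>
        obtain ⟨h1, rfl⟩ : S k = [] ∧ S' = S := h1
        simpa [h1] using ih rfl
      | some a =>
        obtain ⟨l, h1, h2⟩ : ∃ l, S k = a :: l ∧ S' = S := h1
        subst h2
        simpa [h1] using ih rfl
    | pop k f q =>
      cases b with
      | none =>
        obtain ⟨h1, rfl⟩ : S k = [] ∧ S' = S := h1
        have : Function.update S' k [] = S' := by rw [← h1, Function.update_eq_self]
        simpa [h1, this] using ih rfl
      | some a =>
        obtain ⟨l, h1, h2⟩ : ∃ l, S k = a :: l ∧ S' = Function.update S k l := h1
        subst h2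
        simpa [h1] using ih rfl
    | load f q =>
      obtain rfl : S' = _ := h1
      exact ih (q := q) (v := f v) rfl
    | branch f q₁ q₂ =>
      obtain rfl : S' = _ := h1
      have := ih rfl
      rw [TM2.stepAux]
      cases h : f v <;> rw [h] at this <;> exact this
    | goto l =>
      obtain rfl : S' = _ := h1
      have := ih rfl
      rw [Part.dom_iff_mem] at this ⊢
      obtain ⟨y, hy⟩ := this
      obtain ⟨h2, h3⟩ := StateTransition.mem_eval.1 hy
      exact ⟨y, StateTransition.mem_eval.2 ⟨.head rfl h2, h3⟩⟩
    | halt =>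
      exact Part.dom_iff_mem.2 ⟨_, StateTransition.mem_eval.2 ⟨.refl, rfl⟩⟩

theorem halts_iff {l : Λ} {v : σ} {S : K → List Γ} :
    Halts (next M d) (none, d) (some (M l), v) S ↔
      (StateTransition.eval (TM2.step M) ⟨some l, v, S⟩).Dom := by
  constructor
  · intro h
    obtain ⟨y, hy⟩ := Part.dom_iff_mem.1 (dom_of_halts h)
    obtain ⟨h2, h3⟩ := StateTransition.mem_eval.1 hy
    exact Part.dom_iff_mem.2 ⟨y, StateTransition.mem_eval.2 ⟨.head rfl h2, h3⟩⟩
  · intro h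
    obtain ⟨y, hy⟩ := Part.dom_iff_mem.1 h
    obtain ⟨h2, h3⟩ := StateTransition.mem_eval.1 hy
    suffices ∀ x, StateTransition.Reaches (TM2.step M) x y → ∀ l, x.l = some l →
      Halts (next M d) (none, d) (some (M l), x.var) x.stk from this _ h2 _ rfl
    intro x hx
    induction hx using Relation.ReflTransGen.head_induction_on with
    | refl =>
      intro l hl
      obtain ⟨_, _, _⟩ := y
      cases hl
      cases h3
    | @head x x' h4 _ ih =>
      intro l hl
      obtain ⟨_, v, S⟩ := x
      cases hl
      obtain rfl : _ = x' := by simpa using h4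
      exact halts_of_stepAux _ _ _ ih

theorem some_mem_stmts {S : Finset Λ} {l : Λ} (hl : l ∈ S) : some (M l) ∈ TM2.stmts M S := by
  classical
  simp only [TM2.stmts, Finset.some_mem_insertNone, Finset.mem_biUnion]
  exact ⟨_, hl, TM2.stmts₁_self⟩

theorem none_mem_stmts {S : Finset Λ} : none ∈ TM2.stmts M S := by
  simp [TM2.stmts]

theorem next_mem (S : Finset Λ) [Inhabited Λ] (hS : TM2.Supports M S)
    (p : Option (TM2.Stmt (fun _ : K => Γ) Λ σ) × σ) (b : Option Γ) (hp : p.1 ∈ TM2.stmts M S) :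
    (next M d p b).2.1 ∈ TM2.stmts M S := by
  classical
  obtain ⟨_ | q, v⟩ := p
  · exact none_mem_stmts
  cases q with
  | push k f q => exact TM2.stmts_trans (by simp [TM2.stmts₁, TM2.stmts₁_self]) hp
  | peek k f q => cases b <;> exact TM2.stmts_trans (by simp [TM2.stmts₁, TM2.stmts₁_self]) hp
  | pop k f q => cases b <;> exact TM2.stmts_trans (by simp [TM2.stmts₁, TM2.stmts₁_self]) hp
  | load f q => exact TM2.stmts_trans (by simp [TM2.stmts₁, TM2.stmts₁_self]) hp
  | branch f q₁ q₂ =>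
    refine TM2.stmts_trans ?_ hp
    cases f v <;> simp [TM2.stmts₁, TM2.stmts₁_self]
  | goto l =>
    have := TM2.stmts_supportsStmt hS hp v
    exact some_mem_stmts this
  | halt => exact none_mem_stmts

/-! ### A fixed machine with undecidable halting -/

/-- The restriction of a machine to a finite set of states, which are numbered. -/
theorem exists_fin {B P : Type} (nx : P → B → StackOp K Γ × P) (F : Set P) (hF : F.Finite)
    (h : ∀ p b, p ∈ F → (nx p b).2 ∈ F) : ∃ (N : ℕ) (e : F ≃ Fin N)
      (nx' : Fin N → B → StackOp K Γ × Fin N), ∀ (h p : F) (S : K → List Γ),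
        Halts nx' (e h) (e p) S ↔ Halts nx h p S := by
  have := hF.to_subtype
  obtain ⟨N, ⟨e⟩⟩ := Finite.exists_equiv_fin F
  let nx₁ : F → B → StackOp K Γ × F := fun p b => ((nx p b).1, ⟨(nx p b).2, h p b p.2⟩)
  refine ⟨N, e, fun p b => ((nx₁ (e.symm p) b).1, e (nx₁ (e.symm p) b).2), fun h p S => ?_⟩
  rw [halts_map_iff (next := nx₁) e.injective (by simp)]
  rw [halts_map_iff (next := nx₁) (next' := nx) Subtype.val_injective (fun p b => rfl)]

-- A single program that runs the code with number `k` on input `0` is compiled to a machine with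
-- finite support. Its halting on `k` is the halting problem, so the machine can stay fixed while
-- only the initial contents of the main stack vary.
open Turing.PartrecToTM2 in
theorem exists_not_computablePred : ∃ (N : ℕ)
    (nx : Fin N → Option Γ' → StackOp K' Γ' × Fin N) (p h : Fin N),
    ¬ ComputablePred fun k : ℕ => Halts nx h p (K'.elim (trList [k]) [] [] []) := by
  have hpart : Nat.Partrec' (n := 1)
      (fun v => Nat.Partrec.Code.eval (Denumerable.ofNat Nat.Partrec.Code v.head) 0) := by
    apply Nat.Partrec'.of_part
    exact Nat.Partrec.Code.eval_part.comp
      ((Computable.ofNat _).comp (Primrec.vector_head.to_comp)) (Computable.const 0)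
  obtain ⟨c, hc⟩ := ToPartrec.Code.exists_code hpart
  let _ : Inhabited Λ' := ⟨trNormal c Cont'.halt⟩
  have hsupp := tr_supports c Cont'.halt
  let F : Set (Option (TM2.Stmt (fun _ : K' => Γ') Λ' (Option Γ')) × Option Γ') :=
    {p | p.1 ∈ TM2.stmts tr (codeSupp c Cont'.halt)}
  have hF : F.Finite := ((Finset.finite_toSet (TM2.stmts tr (codeSupp c Cont'.halt))).prod
    (Set.finite_univ (α := Option Γ'))).subset fun p hp => ⟨hp, trivial⟩
  obtain ⟨N, e, nx, hnx⟩ := exists_fin (next tr none) F hF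
    (fun p b hp => next_mem _ hsupp p b hp)
  refine ⟨N, nx, e ⟨(some (tr (trNormal c Cont'.halt)), none), ?_⟩,
    e ⟨(none, none), none_mem_stmts⟩, fun H => ?_⟩
  · exact some_mem_stmts hsupp.1
  · have key : ∀ k : ℕ, Halts nx (e ⟨(none, none), none_mem_stmts⟩)
        (e ⟨(some (tr (trNormal c Cont'.halt)), none), some_mem_stmts hsupp.1⟩)
        (K'.elim (trList [k]) [] [] []) ↔
        (Nat.Partrec.Code.eval (Denumerable.ofNat Nat.Partrec.Code k) 0).Dom := by
      intro k
      refine ((hnx _ _ _).trans halts_iff).trans ?_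
      have h1 := tr_eval c [k]
      have h2 := hc (k ::ᵥ List.Vector.nil)
      rw [show (k ::ᵥ List.Vector.nil).1 = [k] from rfl] at h2
      rw [h2] at h1
      change (StateTransition.eval (TM2.step tr) (init c [k])).Dom ↔ _
      rw [h1]
      rfl
    simp only [key] at H
    refine ComputablePred.halting_problem 0 ?_
    obtain ⟨f, hf, hf'⟩ := ComputablePred.computable_iff.1 H
    refine ComputablePred.computable_iff.2 ⟨fun c => f (Encodable.encode c),
      hf.comp Computable.encode, ?_⟩
    funext c
    have := congrFun hf' (Encodable.encode c)
    simpa using this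

end StackMachine
end TOPL

namespace TOPL

/-! ### Loading the input of a stack machine -/

section Loading

set_option linter.unusedSectionVars false

variable {K Γ B : Type} [DecidableEq K] {N : ℕ}

/-- The machine that pushes the word `l` and then runs a given machine. -/
def loading (nx : Fin N → B → StackOp K Γ × Fin N) (p₀ : Fin N) (k₀ : K) (l : List Γ) (p : ℕ)
    (b : B) : StackOp K Γ × ℕ :=
  if hp : p < N then ((nx ⟨p, hp⟩ b).1, (nx ⟨p, hp⟩ b).2)
  else if p = N then (.nop, p₀)
  -- State `N + 1 + i` pushes the letter `i` of the word and moves down to `N + i`. Starting from `N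
  -- + l.length`, the last letter is pushed first, so the word ends up on the stack with its head on
  -- top.
  else (l[p - (N + 1)]?).elim (.nop, p₀.1) fun a => (.push k₀ a, p - 1)

variable {nx : Fin N → B → StackOp K Γ × Fin N} {p₀ : Fin N} {k₀ : K} {l : List Γ}

theorem loading_lt {p : ℕ} {b : B} (hp : p < N + l.length + 1) :
    (loading nx p₀ k₀ l p b).2 < N + l.length + 1 := by
  rw [loading]
  split_ifs with h1 h2
  · exact (nx ⟨p, h1⟩ b).2.2.trans_le (by omega)
  · exact p₀.2.trans_le (by omega)
  · cases l[p - (N + 1)]? with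
    | none => exact p₀.2.trans_le (by omega)
    | some a => simp only [Option.elim]; omega

theorem Halts.step_iff {P : Type} [Nonempty B] {next : P → B → StackOp K Γ × P} {h p p' : P}
    {op : StackOp K Γ} {S S' : K → List Γ} (hp : p ≠ h) (hn : ∀ b, next p b = (op, p'))
    (hop : ∀ S'', op.Apply S S'' ↔ S'' = S') : Halts next h p S ↔ Halts next h p' S' := by
  constructor
  · intro H
    cases H with
    | done => exact (hp rfl).elim
    | step b h1 h2 =>
      rw [hn] at h1 h2
      rwa [← (hop _).1 h1]
  · intro H
    obtain ⟨b⟩ := ‹Nonempty B›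
    exact .step b (by rw [hn]; exact (hop _).2 rfl) (by rw [hn]; exact H)

theorem halts_loading_iff [Nonempty B] (h : Fin N) (S : K → List Γ) :
    Halts (loading nx p₀ k₀ l) h (N + l.length) S ↔
      Halts nx h p₀ (Function.update S k₀ (l ++ S k₀)) := by
  suffices ∀ j ≤ l.length, ∀ S, Halts (loading nx p₀ k₀ l) h (N + j) S ↔
      Halts nx h p₀ (Function.update S k₀ (l.take j ++ S k₀)) by
    simpa using this _ le_rfl S
  intro j
  induction j with
  | zero =>
    intro _ S
    rw [Halts.step_iff (p := N + 0) (op := .nop) (S' := S) (p' := p₀) (by have := h.2; omega)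
      (fun b => by simp [loading]) (fun _ => Iff.rfl)]
    rw [halts_map_iff (next := nx) Fin.val_injective (fun p b => by simp [loading])]
    simp
  | succ j ih =>
    intro hj S
    rw [Halts.step_iff (p := N + (j + 1)) (op := .push k₀ l[j]) (p' := N + j)
      (by have := h.2; omega) (fun b => ?_) (fun _ => Iff.rfl), ih (by omega)]
    · rw [Function.update_self, Function.update_idem, List.take_succ_eq_append_getElem (by omega),
        List.append_assoc]
      rfl
    · rw [loading, dif_neg (by omega), if_neg (by omega), show N + (j + 1) - (N + 1) = j by omega,
        List.getElem?_eq_getElem (show j < l.length by omega)]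
      rfl

end Loading

/-! ### The automaton and its description -/

namespace History

set_option linter.unusedSectionVars false

open HistoryReg HistoryState

variable {V : Type*} {K Γ : Type} [Fintype K] [DecidableEq K] [Fintype Γ] [DecidableEq Γ] {n : ℕ}

/-- The numbering of the registers. -/
noncomputable def regEquiv : HistoryReg K Γ ≃ Fin (Fintype.card (HistoryReg K Γ)) :=
  Fintype.equivFin _

/-- The numbering of the second components of states. -/
noncomputable def stateEquiv : HistoryState Γ ≃ Fin (Fintype.card (HistoryState Γ)) :=
  Fintype.equivFin _

/-- The guard that tests the component `j` of a letter. -/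
noncomputable def Test.guard (j : Fin n) (g : Test K Γ) :
    Guard n (Fintype.card (HistoryReg K Γ)) :=
  Guard.conj (g.map fun x => if x.1 then .eq (regEquiv x.2) j else .neq (regEquiv x.2) j)

/-- The action that sets registers to the component `j` of a letter. -/
noncomputable def setAll (j : Fin n) : List (HistoryReg K Γ) →
    Action n (Fintype.card (HistoryReg K Γ))
  | [] => .nop
  | r :: rs => .seq (.set (regEquiv r) j) (setAll j rs)

theorem Test.sat_guard {j : Fin n} {g : Test K Γ} {s : Store V (Fintype.card (HistoryReg K Γ))}
    {ℓ : Letter V n} : (g.guard j).Sat s ℓ ↔ g.Sat (s ∘ regEquiv) (ℓ j) := by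
  rw [Test.guard, Guard.sat_conj]
  simp only [List.mem_map, forall_exists_index, and_imp, forall_apply_eq_imp_iff₂, Test.Sat]
  refine forall₂_congr fun x _ => ?_
  obtain ⟨_ | _, r⟩ := x <;> simp [Guard.Sat]

theorem run_setAll {j : Fin n} {rs : List (HistoryReg K Γ)} {ℓ : Letter V n}
    {s : Store V (Fintype.card (HistoryReg K Γ))} :
    (setAll j rs).run ℓ s ∘ regEquiv = assign (ℓ j) rs (s ∘ regEquiv) := by
  induction rs with
  | nil => simp [setAll, Action.run]
  | cons r rs ih =>
    funext r'
    have := congrFun ih r'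
    by_cases hr : r' = r
    · simp [setAll, Action.run, assign, hr]
    · simpa [setAll, Action.run, assign, hr, Function.update_apply] using this

variable (nx : ℕ → Option Γ → StackOp K Γ × ℕ) (h : ℕ) (M : ℕ)

/-- The transitions from the states with first component `p`. -/
noncomputable def transitions (j : Fin n) (hM : ∀ p < M, ∀ b, (nx p b).2 < M) (p : Fin M) :
    List ((Fin M × HistoryState Γ) × Label n (Fintype.card (HistoryReg K Γ)) ×
      (Fin M × HistoryState Γ)) :=
  Finset.univ.toList.flatMap fun b => Finset.univ.toList.flatMap fun w =>
    (out b (nx p b).1 w).map fun x => ((p, w), (x.1.1.guard j, setAll j x.1.2),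
      (if x.2.1 then ⟨(nx p b).2, hM p p.2 b⟩ else p), x.2.2)

open Classical in
/-- The final states with first component `p`. -/
noncomputable def finals (p : ℕ) : List (HistoryState Γ) :=
  Finset.univ.toList.filter fun w => decide (Final h p w)

/-- The automaton that accepts what is not the history of a halting computation. -/
noncomputable def automaton (j : Fin n) (hM : ∀ p < M, ∀ b, (nx p b).2 < M) (start : Fin M)
    (s : HistoryReg K Γ → V) : LowAutomaton V n (Fintype.card (HistoryReg K Γ)) where
  Q := Fin M × HistoryState Γ
  finite_Q := inferInstance
  q₀ := (start, zeroth none)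
  s₀ := s ∘ regEquiv.symm
  δ := {t | t ∈ (List.finRange M).flatMap (transitions nx M j hM)}
  finite_δ := List.finite_toSet _
  F := {q | q ∈ (List.finRange M).flatMap fun p : Fin M => (finals h p).map fun w => (p, w)}

variable {nx h M}

theorem mem_transitions {j : Fin n} {hM : ∀ p < M, ∀ b, (nx p b).2 < M} {p p' : Fin M}
    {w w' : HistoryState Γ} {l : Label n (Fintype.card (HistoryReg K Γ))} :
    ((p, w), l, (p', w')) ∈ (List.finRange M).flatMap (transitions nx M j hM) ↔
      ∃ b g rs mv, ((g, rs), mv, w') ∈ out b (nx p b).1 w ∧ l = (g.guard j, setAll j rs) ∧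
        p'.1 = if mv then (nx p b).2 else p := by
  simp only [transitions, List.mem_flatMap, List.mem_map, List.mem_finRange, true_and,
    Finset.mem_toList, Finset.mem_univ]
  constructor
  · rintro ⟨p, b, w, ⟨⟨g, rs⟩, mv, w'⟩, h1, h2⟩
    cases h2
    exact ⟨b, g, rs, mv, h1, rfl, by cases mv <;> simp⟩
  · rintro ⟨b, g, rs, mv, h1, rfl, h2⟩
    refine ⟨p, b, w, ⟨⟨g, rs⟩, mv, w'⟩, h1, ?_⟩
    have : p' = if mv then ⟨(nx p b).2, hM p p.2 b⟩ else p := by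
      apply Fin.ext
      rw [h2]
      cases mv <;> simp
    rw [this]

theorem mem_finals {p : ℕ} {w : HistoryState Γ} : w ∈ finals h p ↔ Final h p w := by
  classical
  simp [finals]

theorem mem_language_automaton {j : Fin n} {hM : ∀ p < M, ∀ b, (nx p b).2 < M} {start : Fin M}
    {s : HistoryReg K Γ → V} {u : List (Letter V n)} :
    u ∈ LowAutomaton.language (automaton nx h M j hM start s) ↔
      Acc nx h start (zeroth none) s (u.map (· j)) := by
  suffices ∀ (p : Fin M) (w : HistoryState Γ) (s' : Store V (Fintype.card (HistoryReg K Γ))),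
      (∃ x : (automaton nx h M j hM start s).Config,
        LowAutomaton.Walk (automaton nx h M j hM start s) ((p, w), s') u x ∧
          x.1 ∈ (automaton nx h M j hM start s).F) ↔
      Acc nx h p w (s' ∘ regEquiv) (u.map (· j)) by
    refine (this start (zeroth none) (s ∘ regEquiv.symm)).trans ?_
    rw [Function.comp_assoc, Equiv.symm_comp_self, Function.comp_id]
  induction u with
  | nil =>
    intro p w s'
    constructor
    · rintro ⟨x, h1, h2⟩
      cases h1
      obtain ⟨p', -, h3⟩ := List.mem_flatMap.1 h2
      obtain ⟨w', h3, h4⟩ := List.mem_map.1 h3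
      cases h4
      exact mem_finals.1 h3
    · intro h1
      refine ⟨_, .nil _, List.mem_flatMap.2 ⟨p, List.mem_finRange p, List.mem_map.2 ⟨w, ?_, rfl⟩⟩⟩
      exact mem_finals.2 h1
  | cons ℓ u ih =>
    intro p w s'
    constructor
    · rintro ⟨x, h1, h2⟩
      cases h1 with
      | @cons _ y _ _ _ h3 h4 =>
        obtain ⟨⟨p', w'⟩, s''⟩ := y
        obtain ⟨g, a, h5, h6, h7⟩ := h3
        obtain ⟨b, g', rs, mv, h8, h9, h10⟩ := mem_transitions.1 h5
        cases h9
        subst h7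
        refine ⟨b, g', rs, mv, w', h8, Test.sat_guard.1 h6, ?_⟩
        rw [← h10, ← run_setAll]
        exact (ih _ _ _).1 ⟨x, h4, h2⟩
    · rintro ⟨b, g, rs, mv, w', h1, h2, h3⟩
      have hlt : (if mv then (nx p b).2 else p) < M := by
        split_ifs
        · exact hM p p.2 b
        · exact p.2
      rw [← run_setAll] at h3
      obtain ⟨x, h4, h5⟩ := (ih ⟨_, hlt⟩ _ _).2 h3
      exact ⟨x, .cons ⟨_, _, mem_transitions.2 ⟨b, g, rs, mv, h1, rfl, rfl⟩, Test.sat_guard.2 h2,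
        rfl⟩ h4, h5⟩

/-- The names of the initial values. -/
noncomputable def initial : HistoryReg K Γ → ℕ
  | const (some a) => Fintype.equivFin Γ a + 1
  | _ => 0

/-- Stack contents are represented by the names of their encodings. What is needed is injectivity
and that the empty stack has the value of `const none`: `[]` is encoded by `0`, which is also the
initial name in every register other than the constants of letters. Further coincidences between
constants and nodes do no harm. -/
theorem forall_acc_iff {name : ℕ → V} (hname : Function.Injective name) {p : ℕ} :
    (∀ u, Acc nx h p (zeroth none) (name ∘ initial) u) ↔ ¬ Halts nx h p fun _ => [] := by
  constructor
  · intro H1 H2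
    let _ : Encodable Γ := Encodable.ofCountable Γ
    have hc : Function.Injective fun b : Option Γ =>
        (name ∘ initial (K := K)) (const b) := by
      intro b b' h
      have h := hname h
      cases b <;> cases b' <;> simp_all [initial, Fin.val_inj]
    obtain ⟨u, hu⟩ := exists_not_acc_of_halts hc
      (ι := fun l : List Γ => name (Encodable.encode l))
      (fun l l' h => Encodable.encode_injective (hname h)) (by simp [initial]) H2
    exact hu _ none ⟨fun _ => rfl, fun k => by simp [initial], fun a h => by cases h⟩ (H1 u)
  · intro H1 u
    by_contra H2
    exact H1 (halts_of_not_acc (Φ := ∅) H2 (by simp) fun k => rfl)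

/-- The written transitions that come from the transition `b` of the machine, which performs `op`
and moves to `p'`. -/
noncomputable def writtenTransitions (j : Fin n) (b : Option Γ) (op : StackOp K Γ) (p p' : ℕ) :
    List (ℕ × LabelCode × ℕ) :=
  (Finset.univ.toList.flatMap fun w => (out b op w).map fun x =>
    ((stateEquiv w).1, labelCode (x.1.1.guard j, setAll j x.1.2), x.2.1,
      (stateEquiv x.2.2).1)).map fun x =>
    (x.1 + Fintype.card (HistoryState Γ) * p, x.2.1,
      x.2.2.2 + Fintype.card (HistoryState Γ) * if x.2.2.1 then p' else p)

variable (nx h M)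

/-- The description of the automaton. -/
noncomputable def code (j : Fin n) (start : ℕ) : AutomatonCode LabelCode :=
  ((n, Fintype.card (HistoryReg K Γ), M * Fintype.card (HistoryState Γ)),
    (stateEquiv (zeroth none : HistoryState Γ)).1 + Fintype.card (HistoryState Γ) * start,
    List.ofFn fun i => initial ((regEquiv (K := K) (Γ := Γ)).symm i),
    (List.range M).flatMap fun p => Finset.univ.toList.flatMap fun b =>
      writtenTransitions j b (nx p b).1 p (nx p b).2,
    (List.range M).flatMap fun p => (finals (Γ := Γ) h p).map fun w =>
      (stateEquiv w).1 + Fintype.card (HistoryState Γ) * p)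

variable {nx h M}

variable (M Γ) in
/-- The numbering of the states. -/
noncomputable def pairEquiv : Fin M × HistoryState Γ ≃ Fin (M * Fintype.card (HistoryState Γ)) :=
  ((Equiv.refl (Fin M)).prodCongr stateEquiv).trans finProdFinEquiv

/-- The description is arranged so that the state numbers of the machine enter only by arithmetic,
on top of lists that depend only on the operation. This form is the one in which computability can
be seen. -/
theorem code_eq (j : Fin n) (hM : ∀ p < M, ∀ b, (nx p b).2 < M) (start : Fin M) :
    code nx h M j start =
      ((n, Fintype.card (HistoryReg K Γ), M * Fintype.card (HistoryState Γ)),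
        (pairEquiv Γ M (start, zeroth none)).1,
        List.ofFn fun i => initial ((regEquiv (K := K) (Γ := Γ)).symm i),
        ((List.finRange M).flatMap (transitions nx M j hM)).map
          (fun t => ((pairEquiv Γ M t.1).1, labelCode t.2.1, (pairEquiv Γ M t.2.2).1)),
        ((List.finRange M).flatMap fun p : Fin M => (finals h p).map fun w => (p, w)).map
          fun q => (pairEquiv Γ M q).1) := by
  have hrange : List.range M = (List.finRange M).map Fin.val := by simp
  simp only [code]
  congr 4
  · rw [List.map_flatMap, hrange, List.flatMap_map]
    congr 1
    funext p
    simp only [transitions, writtenTransitions, List.map_flatMap, List.map_map]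
    congr 1
    funext b
    congr 1
    funext w
    congr 1
    funext x
    obtain ⟨⟨g, rs⟩, mv, w'⟩ := x
    cases mv <;> simp [Function.comp, pairEquiv, finProdFinEquiv]
  · rw [List.map_flatMap, hrange, List.flatMap_map]
    congr 1
    funext p
    rw [List.map_map]
    congr 1

theorem hasCode_automaton (name : ℕ → V) {j : Fin n} {hM : ∀ p < M, ∀ b, (nx p b).2 < M}
    {start : Fin M} : (automaton nx h M j hM start (name ∘ initial)).HasCode name n labelCode
      (code nx h M j start) :=
  ⟨_, pairEquiv Γ M, fun i => initial (regEquiv.symm i), _, _, fun _ => rfl, fun _ => Iff.rfl,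
    fun _ => Iff.rfl, code_eq j hM start⟩

end History

/-! ### Complete automata read as hl-TOPL automata -/

/-- Every state of the automaton has a transition without condition and without effect. -/
def LowAutomaton.IsComplete {V : Type*} {n m : ℕ} (A : LowAutomaton V n m) : Prop :=
  ∀ q, ∃ q', (q, (.triv, .nop), q') ∈ A.δ

theorem History.isComplete_automaton {V : Type*} {K Γ : Type} [Fintype K] [DecidableEq K]
    [Fintype Γ] [DecidableEq Γ] {n : ℕ} {nx : ℕ → Option Γ → StackOp K Γ × ℕ} {h M : ℕ} {j : Fin n}
    {hM : ∀ p < M, ∀ b, (nx p b).2 < M} {start : Fin M} {s : HistoryReg K Γ → V} :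
    LowAutomaton.IsComplete (automaton nx h M j hM start s) := by
  rintro ⟨p, w⟩
  exact ⟨(p, .sink), mem_transitions.2 ⟨none, [], [], false, by simp [out], rfl, rfl⟩⟩

/-- The description in which labels are replaced by words of length one. -/
def singletonLabels (c : AutomatonCode LabelCode) : AutomatonCode (List LabelCode) :=
  (c.1, c.2.1, c.2.2.1, c.2.2.2.1.map fun t => (t.1, [t.2.1], t.2.2), c.2.2.2.2)

theorem LowAutomaton.toHigh_hasCode {V : Type*} {n m : ℕ} {A : LowAutomaton V n m} {name : ℕ → V}
    {c : AutomatonCode LabelCode} (h : A.HasCode name n labelCode c) :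
    A.toHigh.HasCode name n (List.map labelCode) (singletonLabels c) := by
  obtain ⟨k, e, s, δ, F, h1, h2, h3, rfl⟩ := h
  refine ⟨k, e, s, δ.map fun t => (t.1, [t.2.1], t.2.2), F, h1, fun t => ?_, h3, ?_⟩
  · simp only [List.mem_map, h2]
    rfl
  · simp only [singletonLabels, List.map_map]
    rfl

/-- Every letter enables a transition in every state, so a skip never occurs. -/
theorem LowAutomaton.IsComplete.language_toHigh {V : Type*} {n m : ℕ} {A : LowAutomaton V n m}
    (h : A.IsComplete) : HighAutomaton.language A.toHigh = LowAutomaton.language A := by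
  have h' : ∀ q : A.toHigh.Q, ∃ q', (q, [(.triv, .nop)], q') ∈ A.toHigh.δ := by
    intro q
    obtain ⟨q', h⟩ := h q
    exact ⟨q', A.mem_toHigh_δ.2 ⟨_, rfl, h⟩⟩
  ext w
  rw [HighAutomaton.mem_language_iff, LowAutomaton.mem_language_iff]
  exact ⟨fun h => h.of_complete h', fun h => h.of_complete h'⟩

end TOPL

namespace TOPL

open Turing.PartrecToTM2

/-! ### The reduction is computable -/

/-- The binary expansion, defined through `Num`, is put in the form of a recursion on halves, as
required for course-of-values recursion. -/
theorem trNat_eq (k : ℕ) : trNat k =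
    if k = 0 then [] else (if k % 2 = 1 then Γ'.bit1 else Γ'.bit0) :: trNat (k / 2) := by
  obtain ⟨x, rfl⟩ : ∃ x : Num, (x : ℕ) = k := ⟨k, Num.to_of_nat k⟩
  have key : ∀ p : PosNum, trNat (p : ℕ) = trPosNum p := by
    intro p
    have : ((p : ℕ) : Num) = Num.pos p := Num.of_to_nat (Num.pos p)
    rw [trNat, this]
    rfl
  cases x with
  | zero => simp
  | pos p =>
    have hp : (p : ℕ) ≠ 0 := (PosNum.cast_pos p).ne'
    change trNat (p : ℕ) = if (p : ℕ) = 0 then [] else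
      (if (p : ℕ) % 2 = 1 then Γ'.bit1 else Γ'.bit0) :: trNat ((p : ℕ) / 2)
    rw [key, if_neg hp]
    cases p with
    | one => simp [trPosNum]
    | bit0 p =>
      rw [PosNum.cast_bit0, show ((p : ℕ) + p) / 2 = p by omega, if_neg (by omega), key]
      rfl
    | bit1 p =>
      rw [PosNum.cast_bit1, show ((p : ℕ) + p + 1) / 2 = p by omega, if_pos (by omega), key]
      rfl

theorem primrec_trNat [Primcodable Γ'] : Primrec trNat := by
  have : Primrec₂ fun (_ : Unit) k => trNat k := by
    refine Primrec.nat_strong_rec _ (g := fun _ L => if L.length = 0 then some [] else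
      (L[L.length / 2]?).map
        ((if L.length % 2 = 1 then Γ'.bit1 else Γ'.bit0) :: ·)) ?_ fun _ n => ?_
    · have hlen : Primrec fun x : Unit × List (List Γ') => x.2.length :=
        Primrec.list_length.comp Primrec.snd
      refine Primrec.ite (PrimrecRel.comp Primrec.eq hlen (Primrec.const 0)) (Primrec.const _) ?_
      refine Primrec.option_map (Primrec.list_getElem?.comp Primrec.snd
        (Primrec.nat_div.comp hlen (Primrec.const 2))) ?_
      refine Primrec.list_cons.comp₂ ?_ Primrec₂.right
      exact (Primrec.ite (PrimrecRel.comp Primrec.eq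
        (Primrec.nat_mod.comp hlen (Primrec.const 2)) (Primrec.const 1))
        (Primrec.const _) (Primrec.const _)).comp Primrec.fst
    · by_cases hn : n = 0
      · simp [hn]
      · have : n / 2 < n := by omega
        rw [trNat_eq n]
        simp [hn, this]
  exact this.comp (Primrec.const ()) Primrec.id

theorem primrec_trList_singleton [Primcodable Γ'] : Primrec fun k : ℕ => trList [k] := by
  have := Primrec.list_append.comp primrec_trNat (Primrec.const [Γ'.cons])
  exact this.of_eq fun k => by simp

namespace History

set_option linter.unusedSectionVars false

variable {K Γ : Type} [Fintype K] [DecidableEq K] [Fintype Γ] [DecidableEq Γ] {n N : ℕ}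

/-- Only the loading states depend on `k`. The states up to `N` contribute a fixed finite table, and
each loading state depends on `k` only through one letter, hence through a function on a finite
type. -/
theorem primrec_code [Primcodable Γ] (nx : Fin N → Option Γ → StackOp K Γ × Fin N)
    (p₀ h : Fin N) (k₀ : K) (j : Fin n) {l : ℕ → List Γ} (hl : Primrec l) :
    Primrec fun k => code (loading nx p₀ k₀ (l k)) h (N + (l k).length + 1) j
      (N + (l k).length) := by
  have hM : Primrec fun k => N + (l k).length + 1 :=
    Primrec.succ.comp (Primrec.nat_add.comp (Primrec.const N) (Primrec.list_length.comp hl))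
  have hrange : Primrec fun k => List.range (N + (l k).length + 1) := Primrec.list_range.comp hM
  refine .pair (.pair (.const n) (.pair (.const _) (Primrec.nat_mul.comp hM (.const _)))) <|
    .pair (Primrec.nat_add.comp (.const _) (Primrec.nat_mul.comp (.const _)
      (Primrec.nat_add.comp (.const N) (Primrec.list_length.comp hl)))) <|
    .pair (.const _) (.pair ?_ ?_)
  -- The rows up to `N` are the same for every word, so they are computed with the empty one.
  · let table : List (List (ℕ × LabelCode × ℕ)) := (List.range (N + 1)).map fun p =>
      Finset.univ.toList.flatMap fun b => writtenTransitions j b (loading nx p₀ k₀ [] p b).1 p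
        (loading nx p₀ k₀ [] p b).2
    let push : Γ → List (ℕ × LabelCode × Bool × ℕ) := fun a =>
      Finset.univ.toList.flatMap fun b => Finset.univ.toList.flatMap fun w =>
        (out b (.push k₀ a) w).map fun x =>
          ((stateEquiv w).1, labelCode (x.1.1.guard j, setAll j x.1.2), x.2.1,
            (stateEquiv x.2.2).1)
    have hpush : Primrec push := Primrec.dom_finite _
    have key : Primrec fun k => (List.range (N + (l k).length + 1)).flatMap fun p =>
        if p < N + 1 then table.getD p []
        else ((((l k)[p - (N + 1)]?).map push).getD []).map fun x =>
          (x.1 + Fintype.card (HistoryState Γ) * p, x.2.1,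
            x.2.2.2 + Fintype.card (HistoryState Γ) * if x.2.2.1 then p - 1 else p) := by
      refine Primrec.list_flatMap hrange (Primrec.ite
        (PrimrecRel.comp Primrec.nat_lt Primrec.snd (.const _))
        ((Primrec.list_getD []).comp (.const _) .snd) (Primrec.list_map ?_ ?_))
      · exact Primrec.option_getD.comp (Primrec.option_map (Primrec.list_getElem?.comp
          (hl.comp .fst) (Primrec.nat_sub.comp .snd (.const _))) (hpush.comp .snd)) (.const [])
      · refine Primrec.pair (Primrec.nat_add.comp (Primrec.fst.comp .snd)
          (Primrec.nat_mul.comp (.const _) (Primrec.snd.comp .fst))) <| .pair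
            (Primrec.fst.comp (Primrec.snd.comp .snd)) <| Primrec.nat_add.comp
              (Primrec.snd.comp (Primrec.snd.comp (Primrec.snd.comp .snd))) <|
              Primrec.nat_mul.comp (.const _) ?_
        exact Primrec.ite (PrimrecRel.comp Primrec.eq
          (Primrec.fst.comp (Primrec.snd.comp (Primrec.snd.comp .snd))) (.const true))
          (Primrec.nat_sub.comp (Primrec.snd.comp .fst) (.const 1)) (Primrec.snd.comp .fst)
    refine key.of_eq fun k => ?_
    rw [List.flatMap_def, List.flatMap_def]
    congr 1
    refine List.map_congr_left fun p hp => ?_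
    rw [List.mem_range] at hp
    by_cases hpN : p < N + 1
    · rw [if_pos hpN]
      have : ∀ b, loading nx p₀ k₀ (l k) p b = loading nx p₀ k₀ [] p b := by
        intro b
        unfold loading
        by_cases h1 : p < N
        · rw [dif_pos h1, dif_pos h1]
        · rw [dif_neg h1, dif_neg h1, if_pos (by omega), if_pos (by omega)]
      simp only [this]
      simp [table, List.getD_eq_getElem?_getD, hpN]
    · rw [if_neg hpN]
      have h1 : (l k)[p - (N + 1)]? = some (l k)[p - (N + 1)] :=
        List.getElem?_eq_getElem (by omega)
      have : ∀ b, loading nx p₀ k₀ (l k) p b = (.push k₀ (l k)[p - (N + 1)], p - 1) := by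
        intro b
        unfold loading
        rw [dif_neg (by omega), if_neg (by omega), h1]
        rfl
      simp only [this, h1, Option.map_some, Option.getD_some, push, writtenTransitions,
        List.map_flatMap]
  · let C : ℕ → List ℕ := fun p => (finals (Γ := Γ) h p).map fun w => (stateEquiv w).1
    -- All states of the machine other than `h` have the same final second components; `h + 1`
    -- serves as a sample.
    have key : Primrec fun k => (List.range (N + (l k).length + 1)).flatMap fun p =>
        (if p = h.1 then C h else C (h + 1)).map fun w =>
          w + Fintype.card (HistoryState Γ) * p := by
      refine Primrec.list_flatMap hrange (Primrec.list_map (Primrec.ite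
        (PrimrecRel.comp Primrec.eq .snd (.const _)) (.const _) (.const _)) ?_)
      exact Primrec.nat_add.comp .snd (Primrec.nat_mul.comp (.const _) (Primrec.snd.comp .fst))
    refine key.of_eq fun k => ?_
    congr 1
    funext p
    have : (if p = h.1 then C h else C (h + 1)) = C p := by
      by_cases hp : p = h.1
      · rw [if_pos hp, hp]
      · rw [if_neg hp]
        simp only [C, finals, Final, hp]
        simp
    rw [this, List.map_map]
    rfl

end History

/-! ### Undecidable problems -/

theorem primrec_singletonLabels : Primrec singletonLabels := by
  refine .pair .fst (.pair (Primrec.fst.comp .snd) (.pair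
    (Primrec.fst.comp (Primrec.snd.comp .snd)) (.pair ?_
      (Primrec.snd.comp (Primrec.snd.comp (Primrec.snd.comp .snd))))))
  refine Primrec.list_map (Primrec.fst.comp (Primrec.snd.comp (Primrec.snd.comp .snd)))
    (Primrec.pair (Primrec.fst.comp .snd) (.pair (Primrec.list_cons.comp
      (Primrec.fst.comp (Primrec.snd.comp .snd)) (.const []))
      (Primrec.snd.comp (Primrec.snd.comp .snd))))

/-- Undecidability of inclusion, equivalence and universality, if these problems are those of
deciding whether a machine does not halt. -/
theorem undecidable_of_reduction {V : Type*} {n : ℕ} {C : Type} [Primcodable C]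
    {D : AutomatonCode C → Language (Letter V n) → Prop} {P : ℕ → Prop} (hP : ¬ ComputablePred P)
    {c : ℕ → AutomatonCode C} (hc : Computable c) {L : ℕ → Language (Letter V n)}
    (hD : ∀ k, D (c k) (L k)) (hL : ∀ k, (∀ w, w ∈ L k) ↔ ¬ P k) {c₀ : AutomatonCode C}
    (h₀ : D c₀ Set.univ) :
    ¬ InclusionDecidable D ∧ ¬ EquivalenceDecidable D ∧ ¬ UniversalityDecidable D := by
  have key : ∀ f : ℕ → Bool, Computable f → ¬ ∀ k, f k = true ↔ ∀ w, w ∈ L k := by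
    intro f hf H
    refine hP (ComputablePred.computable_iff.2 ⟨fun k => !f k,
      Primrec.not.to_comp.comp hf, ?_⟩)
    funext k
    have := (H k).trans (hL k)
    cases h : f k <;> simp_all
  refine ⟨?_, ?_, ?_⟩
  · rintro ⟨f, hf, H⟩
    refine key (fun k => f (c₀, c k)) (hf.comp ((Computable.const _).pair hc)) fun k => ?_
    rw [H _ _ _ _ h₀ (hD k)]
    exact ⟨fun h w => h w trivial, fun h w _ => h w⟩
  · rintro ⟨f, hf, H⟩
    refine key (fun k => f (c k, c₀)) (hf.comp (hc.pair (Computable.const _))) fun k => ?_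
    rw [H _ _ _ _ (hD k) h₀]
    exact ⟨fun h w => h ▸ trivial, fun h => Set.eq_univ_of_forall h⟩
  · rintro ⟨f, hf, H⟩
    exact key (fun k => f (c k)) (hf.comp hc) fun k => H _ _ (hD k)

/-- The automaton that accepts every word. -/
def fullAutomaton (V : Type*) (n : ℕ) : LowAutomaton V n 0 where
  Q := Fin 1
  finite_Q := inferInstance
  q₀ := 0
  s₀ := Fin.elim0
  δ := {t | t ∈ [((0 : Fin 1), ((.triv, .nop) : Label n 0), (0 : Fin 1))]}
  finite_δ := List.finite_toSet _
  F := {q | q ∈ [(0 : Fin 1)]}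

theorem language_fullAutomaton (V : Type*) (n : ℕ) :
    LowAutomaton.language (fullAutomaton V n) = Set.univ := by
  have key : ∀ (w : List (Letter V n)) (x : (fullAutomaton V n).Config), x.1 = (0 : Fin 1) →
      ∃ y : (fullAutomaton V n).Config, LowAutomaton.Walk (fullAutomaton V n) x w y ∧
        y.1 ∈ (fullAutomaton V n).F := by
    intro w
    induction w with
    | nil =>
      rintro ⟨q, s⟩ rfl
      exact ⟨_, .nil _, List.mem_singleton.2 rfl⟩
    | cons ℓ w ih =>
      rintro ⟨q, s⟩ rfl
      obtain ⟨y, h1, h2⟩ := ih ((0 : Fin 1), s) rfl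
      exact ⟨y, .cons ⟨.triv, .nop, List.mem_singleton.2 rfl, trivial, rfl⟩ h1, h2⟩
  exact Set.eq_univ_of_forall fun w => key w _ rfl

theorem undecidable {V : Type*} (name : ℕ → V) (hname : Function.Injective name) {n : ℕ}
    (hn : 1 ≤ n) :
    (¬ InclusionDecidable (LowDescribes name n) ∧ ¬ EquivalenceDecidable (LowDescribes name n) ∧
      ¬ UniversalityDecidable (LowDescribes name n)) ∧
    (¬ InclusionDecidable (HighDescribes name n) ∧
      ¬ EquivalenceDecidable (HighDescribes name n) ∧
      ¬ UniversalityDecidable (HighDescribes name n)) := by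
  have : Fintype K' := ⟨{.main, .rev, .aux, .stack}, by intro x; cases x <;> simp⟩
  let _ : Primcodable Γ' := Primcodable.ofEquiv _ (Fintype.equivFin Γ')
  obtain ⟨N, nx, p, h, hP⟩ := StackMachine.exists_not_computablePred
  let l : ℕ → List Γ' := fun k => trList [k]
  let c : ℕ → AutomatonCode LabelCode := fun k => History.code (loading nx p .main (l k)) h
    (N + (l k).length + 1) ⟨0, hn⟩ (N + (l k).length)
  have hc : Primrec c := History.primrec_code nx p h .main ⟨0, hn⟩ primrec_trList_singleton
  let A : ∀ k, LowAutomaton V n _ := fun k => History.automaton (loading nx p .main (l k)) h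
    (N + (l k).length + 1) ⟨0, hn⟩ (fun _ hp _ => loading_lt hp)
    ⟨N + (l k).length, Nat.lt_succ_self _⟩ (name ∘ History.initial)
  have hA : ∀ k, (∀ w, w ∈ LowAutomaton.language (A k)) ↔
      ¬ Halts nx h p (K'.elim (trList [k]) [] [] []) := by
    intro k
    simp only [A, History.mem_language_automaton]
    have h1 : ∀ P : List V → Prop, (∀ w : List (Letter V n), P (w.map (· ⟨0, hn⟩))) ↔ ∀ u, P u := by
      refine fun P => ⟨fun H u => ?_, fun H w => H _⟩
      have := H (u.map fun v _ => v)
      rwa [List.map_map, show ((fun ℓ : Letter V n => ℓ ⟨0, hn⟩) ∘ fun (v : V) (_ : Fin n) => v) =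
        id from rfl, List.map_id] at this
    rw [h1 fun u => _]
    rw [History.forall_acc_iff hname]
    refine not_congr ?_
    refine (halts_loading_iff h _).trans ?_
    have : Function.update (fun _ => []) K'.main (l k ++ []) = K'.elim (trList [k]) [] [] [] := by
      funext x
      cases x <;> simp [l, K'.elim]
    rw [this]
  have hfull : (fullAutomaton V n).HasCode name n labelCode
      ((n, 0, 1), 0, [], [(0, labelCode ((.triv, .nop) : Label n 0), 0)], [0]) :=
    ⟨1, Equiv.refl (Fin 1), Fin.elim0, _, _, fun i => i.elim0, fun _ => Iff.rfl,
      fun _ => Iff.rfl, rfl⟩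
  have hcomplete : LowAutomaton.IsComplete (fullAutomaton V n) := by
    intro q
    obtain rfl : q = (0 : Fin 1) := Subsingleton.elim (α := Fin 1) _ _
    exact ⟨_, List.mem_singleton.2 rfl⟩
  refine ⟨undecidable_of_reduction hP hc.to_comp
    (fun k => ⟨_, A k, History.hasCode_automaton name, rfl⟩) hA
    ⟨_, _, hfull, language_fullAutomaton V n⟩,
    undecidable_of_reduction hP (c := fun k => singletonLabels (c k)) ?_
    (fun k => ⟨_, (A k).toHigh, LowAutomaton.toHigh_hasCode (History.hasCode_automaton name),
      LowAutomaton.IsComplete.language_toHigh History.isComplete_automaton⟩) hA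
    ⟨_, _, LowAutomaton.toHigh_hasCode hfull,
      hcomplete.language_toHigh.trans (language_fullAutomaton V n)⟩⟩
  exact (primrec_singletonLabels.comp hc).to_comp

end TOPL

namespace TOPL

/-! ### Reachability in effectively given graphs with finite components -/

section Reachability

open Relation

set_option linter.unusedSectionVars false

variable {α β : Type} [Primcodable α] [Primcodable β]

/-- The list of the vertices that are at distance at most `k`. -/
def explore (succ : β → List β) (x : β) (k : ℕ) : List β :=
  (fun L => L ++ L.flatMap succ)^[k] [x]

theorem explore_succ (succ : β → List β) (x : β) (k : ℕ) :
    explore succ x (k + 1) = explore succ x k ++ (explore succ x k).flatMap succ :=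
  Function.iterate_succ_apply' _ _ _

theorem reflTransGen_of_mem_explore {succ : β → List β} {x y : β} {k : ℕ}
    (h : y ∈ explore succ x k) : ReflTransGen (fun a b => b ∈ succ a) x y := by
  induction k generalizing y with
  | zero =>
    obtain rfl := List.mem_singleton.1 h
    exact .refl
  | succ k ih =>
    rw [explore_succ, List.mem_append, List.mem_flatMap] at h
    rcases h with h | ⟨z, h1, h2⟩
    · exact ih h
    · exact (ih h1).tail h2

/-- Once a round finds no new vertex, the explored set is closed under successors and so contains
all that is reachable. -/
theorem mem_explore_of_reflTransGen {succ : β → List β} {x y : β} {k : ℕ}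
    (hk : explore succ x (k + 1) ⊆ explore succ x k)
    (h : ReflTransGen (fun a b => b ∈ succ a) x y) : y ∈ explore succ x k := by
  induction h with
  | refl =>
    clear hk
    induction k with
    | zero => exact List.mem_singleton.2 rfl
    | succ k ih => exact explore_succ succ x k ▸ List.mem_append_left _ ih
  | tail _ h2 ih =>
    apply hk
    rw [explore_succ]
    exact List.mem_append_right _ (List.mem_flatMap.2 ⟨_, ih, h2⟩)

/-- Otherwise the explored sets would grow strictly for ever inside a finite set. -/
theorem exists_explore_subset {succ : β → List β} {x : β}
    (h : {y | ReflTransGen (fun a b => b ∈ succ a) x y}.Finite) :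
    ∃ k, explore succ x (k + 1) ⊆ explore succ x k := by
  by_contra! H
  have hmono : ∀ k, {y | y ∈ explore succ x k} ⊂ {y | y ∈ explore succ x (k + 1)} := by
    intro k
    refine ⟨fun y hy => ?_, fun h => H k fun y hy => h hy⟩
    change y ∈ explore succ x (k + 1)
    rw [explore_succ]
    exact List.mem_append_left _ hy
  have hcard : ∀ k, k ≤ {y | y ∈ explore succ x k}.ncard := by
    intro k
    induction k with
    | zero => exact Nat.zero_le _
    | succ k ih => exact ih.trans_lt (Set.ncard_lt_ncard (hmono k) (List.finite_toSet _))
  have hle : ∀ k, k ≤ {y | ReflTransGen (fun a b => b ∈ succ a) x y}.ncard := fun k =>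
    (hcard k).trans (Set.ncard_le_ncard (fun y hy => reflTransGen_of_mem_explore hy) h)
  exact absurd (hle _) (Nat.not_succ_le_self _)

/-- Finiteness only ensures that the unbounded search for a stable round terminates; no bound on the
number of rounds has to be computed. -/
theorem exists_computable_reachable {init : α → β} {succ : α → β → List β} {fin : α → β → Prop}
    (hinit : Primrec init) (hsucc : Primrec₂ succ) (hfin : PrimrecRel fin)
    (h : ∀ a, {y | ReflTransGen (fun x y => y ∈ succ a x) (init a) y}.Finite) :
    ∃ f : α → Bool, Computable f ∧
      ∀ a, f a = true ↔ ∃ y, ReflTransGen (fun x y => y ∈ succ a x) (init a) y ∧ fin a y := by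
  classical
  have hexp : Primrec₂ fun a k => explore (succ a) (init a) k := by
    refine Primrec.nat_iterate Primrec.snd
      (Primrec.list_cons.comp (hinit.comp .fst) (.const [])) ?_
    exact Primrec.list_append.comp .snd (Primrec.list_flatMap .snd
      (hsucc.comp (Primrec.fst.comp (Primrec.fst.comp .fst)) .snd))
  have hstable : PrimrecRel fun a k =>
      explore (succ a) (init a) (k + 1) ⊆ explore (succ a) (init a) k := by
    have h1 : PrimrecRel fun (y : β) (L : List β) => ∃ z ∈ L, z = y :=
      PrimrecRel.swap (PrimrecRel.exists_mem_list Primrec.eq)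
    have h2 := h1.forall_mem_list
    refine (PrimrecRel.comp h2 (hexp.comp Primrec.fst (Primrec.succ.comp Primrec.snd))
      (hexp.comp Primrec.fst Primrec.snd)).of_eq fun x => ?_
    simp [List.subset_def]
  have hany : PrimrecRel fun a k => ∃ y ∈ explore (succ a) (init a) k, fin a y := by
    have h1 := hfin.swap.exists_mem_list
    exact PrimrecRel.comp h1 (hexp.comp Primrec.fst Primrec.snd) Primrec.fst
  let stable : α → ℕ → Bool := fun a k =>
    decide (explore (succ a) (init a) (k + 1) ⊆ explore (succ a) (init a) k)
  have hdom : ∀ a, (Nat.rfind (stable a : ℕ →. Bool)).Dom := by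
    intro a
    obtain ⟨k, hk⟩ := exists_explore_subset (h a)
    obtain ⟨l, hl, -⟩ := Nat.rfind_min' (p := stable a) (m := k) (by simpa [stable] using hk)
    exact Part.dom_iff_mem.2 ⟨l, hl⟩
  have hrfind : Partrec fun a => Nat.rfind (stable a : ℕ →. Bool) :=
    Partrec.rfind (Computable.partrec (Primrec.to_comp (PrimrecPred.decide hstable)))
  let g : α → ℕ := fun a => (Nat.rfind (stable a : ℕ →. Bool)).get (hdom a)
  have hg : Computable g := Partrec.of_eq_tot hrfind fun a => Part.get_mem (hdom a)
  have hg' : ∀ a, explore (succ a) (init a) (g a + 1) ⊆ explore (succ a) (init a) (g a) := by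
    intro a
    have := Nat.rfind_spec (Part.get_mem (hdom a))
    simpa [stable] using this
  refine ⟨fun a => decide (∃ y ∈ explore (succ a) (init a) (g a), fin a y), ?_, fun a => ?_⟩
  · have : Computable₂ fun a k => decide (∃ y ∈ explore (succ a) (init a) k, fin a y) :=
      Primrec.to_comp (PrimrecPred.decide hany)
    exact this.comp Computable.id hg
  · rw [decide_eq_true_iff]
    constructor
    · rintro ⟨y, h1, h2⟩
      exact ⟨y, reflTransGen_of_mem_explore h1, h2⟩
    · rintro ⟨y, h1, h2⟩
      exact ⟨y, mem_explore_of_reflTransGen (hg' a) h1, h2⟩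

end Reachability

/-! ### Running written automata -/

namespace Written

/-- Satisfaction of a written guard. -/
def Holds (s ℓ : List ℕ) (g : List (ℕ × ℕ × ℕ)) : Prop :=
  -- In prefix notation a guard can be read as a flat list of comparisons: the symbols for truth and
  -- conjunction have tags `2` and `3` and impose nothing.
  ∀ x ∈ g, ¬ (x.1 = 0 ∧ ¬ s.getD x.2.1 0 = ℓ.getD x.2.2 0) ∧
    ¬ (x.1 = 1 ∧ s.getD x.2.1 0 = ℓ.getD x.2.2 0)

instance (s ℓ : List ℕ) (g : List (ℕ × ℕ × ℕ)) : Decidable (Holds s ℓ g) := by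
  unfold Holds; infer_instance

/-- The effect of a written action. -/
def perform (ℓ : List ℕ) (a : List (ℕ × ℕ × ℕ)) (s : List ℕ) : List ℕ :=
  -- Folding from the right runs the second part of a sequence first, as the composition of actions
  -- prescribes.
  a.foldr (fun x s => if x.1 = 1 then s.set x.2.1 (ℓ.getD x.2.2 0) else s) s

/-- Reading a letter with a written label. -/
def advance (o : Option (List ℕ × List (List ℕ))) (l : LabelCode) :
    Option (List ℕ × List (List ℕ)) :=
  o.bind fun p => p.2.head?.bind fun ℓ =>
    if Holds p.1 ℓ l.1 then some (perform ℓ l.2 p.1, p.2.tail) else none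

/-- Reading a word with a word of written labels. -/
def run (lab : List LabelCode) (s : List ℕ) (u : List (List ℕ)) :
    Option (List ℕ × List (List ℕ)) :=
  lab.foldl advance (some (s, u))

/-- States, stores, buffers and flags. -/
abbrev Node := ℕ × List ℕ × List (List ℕ) × Bool

/-- The automaton and whether letters can be skipped. -/
abbrev Input := Bool × AutomatonCode (List LabelCode)

variable (a : Input)

/-- The written transitions. -/
abbrev trans : List (ℕ × List LabelCode × ℕ) := a.2.2.2.2.1

/-- A length that is exceeded by that of no label. -/
def depth : ℕ := ((trans a).flatMap fun t => t.2.1).length + 1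

/-- Enough values. -/
def pool : List ℕ := a.2.2.2.1 ++ List.range (a.2.1.2.1 + depth a * a.2.1.1)

/-- All letters over the pool. -/
def letters : List (List ℕ) :=
  (fun L => L.flatMap fun l => (pool a).map fun v => v :: l)^[a.2.1.1] [[]]

/-- The successors by standard transitions. -/
def standard (x : Node) : List Node :=
  (trans a).flatMap fun t => if t.1 = x.1 then
    ((run t.2.1 x.2.1 x.2.2.1).map fun r => (t.2.2, r.1, r.2, x.2.2.2)).toList else []

/-- The successors. -/
def succ (x : Node) : List Node :=
  (if x.2.2.2 = true ∨ depth a ≤ x.2.2.1.length then standard a x ++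
    if a.1 = true ∧ standard a x = [] ∧ x.2.2.1 ≠ [] then
      [(x.1, x.2.1, x.2.2.1.tail, x.2.2.2)] else [] else []) ++
  if x.2.2.2 = false then (x.1, x.2.1, x.2.2.1, true) ::
    (if x.2.2.1.length < depth a then
      (letters a).map fun ℓ => (x.1, x.2.1, x.2.2.1 ++ [ℓ], false) else []) else []

/-- The final nodes. -/
def Final (x : Node) : Prop :=
  (∃ q ∈ a.2.2.2.2.2, q = x.1) ∧ x.2.2.1 = [] ∧ x.2.2.2 = true

/-! #### Computability -/

theorem primrec_holds : PrimrecPred fun x : (List ℕ × List ℕ) × List (ℕ × ℕ × ℕ) =>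
    Holds x.1.1 x.1.2 x.2 := by
  have h1 : PrimrecRel fun (x : ℕ × ℕ × ℕ) (y : List ℕ × List ℕ) =>
      ¬ (x.1 = 0 ∧ ¬ y.1.getD x.2.1 0 = y.2.getD x.2.2 0) ∧
        ¬ (x.1 = 1 ∧ y.1.getD x.2.1 0 = y.2.getD x.2.2 0) := by
    have h2 : PrimrecPred fun z : (ℕ × ℕ × ℕ) × List ℕ × List ℕ =>
        z.2.1.getD z.1.2.1 0 = z.2.2.getD z.1.2.2 0 :=
      PrimrecRel.comp Primrec.eq
        ((Primrec.list_getD 0).comp (Primrec.fst.comp .snd)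
          (Primrec.fst.comp (Primrec.snd.comp .fst)))
        ((Primrec.list_getD 0).comp (Primrec.snd.comp .snd)
          (Primrec.snd.comp (Primrec.snd.comp .fst)))
    have h3 : ∀ k, PrimrecPred fun z : (ℕ × ℕ × ℕ) × List ℕ × List ℕ => z.1.1 = k := fun k =>
      PrimrecRel.comp Primrec.eq (Primrec.fst.comp .fst) (.const k)
    exact ((h3 0).and h2.not).not.and ((h3 1).and h2).not
  exact PrimrecRel.comp h1.forall_mem_list Primrec.snd Primrec.fst

theorem primrec_perform : Primrec fun x : (List ℕ × List (ℕ × ℕ × ℕ)) × List ℕ =>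
    perform x.1.1 x.1.2 x.2 := by
  refine Primrec.list_foldr (h := fun (x : (List ℕ × List (ℕ × ℕ × ℕ)) × List ℕ)
    (y : (ℕ × ℕ × ℕ) × List ℕ) => if y.1.1 = 1 then
    y.2.set y.1.2.1 (x.1.1.getD y.1.2.2 0) else y.2) (Primrec.snd.comp .fst) .snd ?_
  refine Primrec.ite (PrimrecRel.comp Primrec.eq (Primrec.fst.comp (Primrec.fst.comp .snd))
    (.const 1)) ?_ (Primrec.snd.comp .snd)
  exact Primrec.list_set.comp (Primrec.snd.comp .snd) (.pair
    (Primrec.fst.comp (Primrec.snd.comp (Primrec.fst.comp .snd)))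
    ((Primrec.list_getD 0).comp (Primrec.fst.comp (Primrec.fst.comp .fst))
      (Primrec.snd.comp (Primrec.snd.comp (Primrec.fst.comp .snd)))))

theorem primrec_advance : Primrec₂ advance := by
  refine Primrec.option_bind .fst ?_
  refine Primrec.option_bind (Primrec.list_head?.comp (Primrec.snd.comp .snd)) ?_
  refine Primrec.ite (primrec_holds.comp (.pair (.pair
    (Primrec.fst.comp (Primrec.snd.comp .fst)) .snd)
    (Primrec.fst.comp (Primrec.snd.comp (Primrec.fst.comp .fst))))) ?_ (.const none)
  exact Primrec.option_some.comp (.pair (primrec_perform.comp (.pair (.pair .snd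
    (Primrec.snd.comp (Primrec.snd.comp (Primrec.fst.comp .fst))))
    (Primrec.fst.comp (Primrec.snd.comp .fst)))) (Primrec.list_tail.comp
    (Primrec.snd.comp (Primrec.snd.comp .fst))))

theorem primrec_run : Primrec fun x : List LabelCode × List ℕ × List (List ℕ) =>
    run x.1 x.2.1 x.2.2 := by
  refine Primrec.list_foldl (h := fun _ y => advance y.1 y.2) .fst
    (Primrec.option_some.comp .snd) ?_
  exact primrec_advance.comp (Primrec.fst.comp .snd) (Primrec.snd.comp .snd)

theorem primrec_trans : Primrec trans :=
  Primrec.fst.comp (Primrec.snd.comp (Primrec.snd.comp (Primrec.snd.comp .snd)))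

theorem primrec_depth : Primrec depth :=
  Primrec.succ.comp (Primrec.list_length.comp (Primrec.list_flatMap primrec_trans
    (Primrec.fst.comp (Primrec.snd.comp .snd))))

theorem primrec_pool : Primrec pool :=
  Primrec.list_append.comp (Primrec.fst.comp (Primrec.snd.comp (Primrec.snd.comp .snd)))
    (Primrec.list_range.comp (Primrec.nat_add.comp
      (Primrec.fst.comp (Primrec.snd.comp (Primrec.fst.comp .snd)))
      (Primrec.nat_mul.comp primrec_depth (Primrec.fst.comp (Primrec.fst.comp .snd)))))

theorem primrec_letters : Primrec letters := by
  refine Primrec.nat_iterate (Primrec.fst.comp (Primrec.fst.comp .snd)) (.const _) ?_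
  exact Primrec.list_flatMap .snd (Primrec.list_map (primrec_pool.comp (Primrec.fst.comp .fst))
    (Primrec.list_cons.comp .snd (Primrec.snd.comp .fst)))

theorem primrec_standard : Primrec₂ standard := by
  refine Primrec.list_flatMap (primrec_trans.comp .fst) ?_
  refine Primrec.ite (PrimrecRel.comp Primrec.eq (Primrec.fst.comp .snd)
    (Primrec.fst.comp (Primrec.snd.comp .fst))) ?_ (.const [])
  refine Primrec.optionToList.comp (Primrec.option_map (primrec_run.comp (.pair
    (Primrec.fst.comp (Primrec.snd.comp .snd)) (.pair
      (Primrec.fst.comp (Primrec.snd.comp (Primrec.snd.comp .fst)))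
      (Primrec.fst.comp (Primrec.snd.comp (Primrec.snd.comp (Primrec.snd.comp .fst))))))) ?_)
  exact Primrec.pair (Primrec.snd.comp (Primrec.snd.comp (Primrec.snd.comp .fst)))
    (.pair (Primrec.fst.comp .snd) (.pair (Primrec.snd.comp .snd)
      (Primrec.snd.comp (Primrec.snd.comp (Primrec.snd.comp (Primrec.snd.comp
        (Primrec.fst.comp .fst)))))))

theorem primrec_succ : Primrec₂ succ := by
  have hq : Primrec fun x : Input × Node => x.2.1 := Primrec.fst.comp .snd
  have hs : Primrec fun x : Input × Node => x.2.2.1 := Primrec.fst.comp (Primrec.snd.comp .snd)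
  have hu : Primrec fun x : Input × Node => x.2.2.2.1 :=
    Primrec.fst.comp (Primrec.snd.comp (Primrec.snd.comp .snd))
  have he : Primrec fun x : Input × Node => x.2.2.2.2 :=
    Primrec.snd.comp (Primrec.snd.comp (Primrec.snd.comp .snd))
  have hd : Primrec fun x : Input × Node => depth x.1 := primrec_depth.comp .fst
  have hstd : Primrec fun x : Input × Node => standard x.1 x.2 := primrec_standard
  refine Primrec.list_append.comp ?_ ?_
  · refine Primrec.ite (PrimrecPred.or (PrimrecRel.comp Primrec.eq he (.const true))
      (PrimrecRel.comp Primrec.nat_le hd (Primrec.list_length.comp hu))) ?_ (.const [])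
    refine Primrec.list_append.comp hstd (Primrec.ite ?_ ?_ (.const []))
    · exact PrimrecPred.and (PrimrecRel.comp Primrec.eq (Primrec.fst.comp .fst) (.const true))
        (PrimrecPred.and (PrimrecRel.comp Primrec.eq hstd (.const []))
          (PrimrecPred.not (PrimrecRel.comp Primrec.eq hu (.const []))))
    · exact Primrec.list_cons.comp (.pair hq (.pair hs (.pair (Primrec.list_tail.comp hu) he)))
        (.const [])
  · refine Primrec.ite (PrimrecRel.comp Primrec.eq he (.const false)) ?_ (.const [])
    refine Primrec.list_cons.comp (.pair hq (.pair hs (.pair hu (.const true)))) ?_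
    refine Primrec.ite (PrimrecRel.comp Primrec.nat_lt (Primrec.list_length.comp hu) hd) ?_
      (.const [])
    refine Primrec.list_map (primrec_letters.comp .fst) (Primrec.pair (hq.comp .fst) (.pair
      (hs.comp .fst) (.pair (Primrec.list_append.comp (hu.comp .fst)
        (Primrec.list_cons.comp .snd (.const []))) (.const false))))

theorem primrec_final : PrimrecRel Final := by
  refine PrimrecPred.and ?_ (PrimrecPred.and
    (PrimrecRel.comp Primrec.eq (Primrec.fst.comp (Primrec.snd.comp (Primrec.snd.comp .snd)))
      (.const []))
    (PrimrecRel.comp Primrec.eq (Primrec.snd.comp (Primrec.snd.comp (Primrec.snd.comp .snd)))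
      (.const true)))
  exact PrimrecRel.comp (PrimrecRel.exists_mem_list Primrec.eq)
    (Primrec.snd.comp (Primrec.snd.comp (Primrec.snd.comp (Primrec.snd.comp
      (Primrec.snd.comp .fst)))))
    (Primrec.fst.comp .snd)

/-! #### Finiteness -/

theorem finite_lists {α : Type*} {P : Set α} (hP : P.Finite) (N : ℕ) :
    {l : List α | l.length ≤ N ∧ ∀ v ∈ l, v ∈ P}.Finite := by
  have := hP.to_subtype
  refine ((List.finite_length_le P N).image (List.map Subtype.val)).subset ?_
  rintro l ⟨h1, h2⟩
  lift l to List P using h2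
  exact ⟨l, by simpa using h1, rfl⟩

theorem perform_mem {P : Set ℕ} (h0 : 0 ∈ P) {ℓ s : List ℕ} (hℓ : ∀ v ∈ ℓ, v ∈ P)
    (hs : ∀ v ∈ s, v ∈ P) (g : List (ℕ × ℕ × ℕ)) :
    (perform ℓ g s).length = s.length ∧ ∀ v ∈ perform ℓ g s, v ∈ P := by
  induction g with
  | nil => exact ⟨rfl, hs⟩
  | cons x g ih =>
    simp only [perform, List.foldr_cons] at ih ⊢
    split_ifs
    · refine ⟨by simpa using ih.1, fun v hv => ?_⟩
      rcases List.mem_or_eq_of_mem_set hv with hv | rfl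
      · exact ih.2 v hv
      · rw [List.getD_eq_getElem?_getD]
        cases h : ℓ[x.2.2]? with
        | none => exact h0
        | some w => exact hℓ _ (List.mem_of_getElem? h)
    · exact ih

theorem run_mem {P : Set ℕ} (h0 : 0 ∈ P) {s s' : List ℕ} {u u' : List (List ℕ)}
    (hs : ∀ v ∈ s, v ∈ P) (hu : ∀ ℓ ∈ u, ∀ v ∈ ℓ, v ∈ P) {lab : List LabelCode}
    (h : run lab s u = some (s', u')) :
    s'.length = s.length ∧ (∀ v ∈ s', v ∈ P) ∧ u' <:+ u := by
  induction lab generalizing s u with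
  | nil =>
    cases h
    exact ⟨rfl, hs, List.suffix_rfl⟩
  | cons l lab ih =>
    rw [run, List.foldl_cons] at h
    have hnone : ∀ lab, List.foldl advance none lab = none := by
      intro lab
      induction lab with
      | nil => rfl
      | cons l lab ih => exact ih
    cases u with
    | nil =>
      rw [show advance (some (s, [])) l = none from rfl, hnone] at h
      cases h
    | cons ℓ u =>
      by_cases hl : Holds s ℓ l.1
      · rw [show advance (some (s, ℓ :: u)) l = some (perform ℓ l.2 s, u) from if_pos hl] at h
        have h1 := perform_mem h0 (hu ℓ (by simp)) hs l.2
        obtain ⟨h2, h3, h4⟩ := ih h1.2 (fun ℓ' h => hu ℓ' (by simp [h])) h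
        exact ⟨h2.trans h1.1, h3, h4.trans (List.suffix_cons ℓ u)⟩
      · rw [show advance (some (s, ℓ :: u)) l = none from if_neg hl, hnone] at h
        cases h

theorem mem_standard {x y : Node} : y ∈ standard a x ↔ ∃ lab, (x.1, lab, y.1) ∈ trans a ∧
    run lab x.2.1 x.2.2.1 = some (y.2.1, y.2.2.1) ∧ y.2.2.2 = x.2.2.2 := by
  obtain ⟨q, s, u, e⟩ := y
  simp only [standard, List.mem_flatMap]
  constructor
  · rintro ⟨⟨q', lab, q''⟩, h1, h2⟩
    split_ifs at h2 with h3
    · simp only [Option.mem_toList, Option.map_eq_some_iff, Prod.mk.injEq] at h2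
      obtain ⟨⟨s', u'⟩, h4, rfl, rfl, rfl, rfl⟩ := h2
      exact ⟨lab, h3 ▸ h1, h4, rfl⟩
    · cases h2
  · rintro ⟨lab, h1, h2, rfl⟩
    exact ⟨_, h1, by simp [h2]⟩

/-- This is needed for every input, even one that describes no automaton, because the search has to
be total. States are the initial one or targets of transitions. Values come from the starting node,
from the available letters, or are the default `0` of a lookup out of range. Buffers never exceed
the larger of `depth a` and the initial buffer length. -/
theorem finite_reachable (x : Node) :
    {y | Relation.ReflTransGen (fun x y => y ∈ succ a x) x y}.Finite := by
  let L : Set (List ℕ) := {ℓ | ℓ ∈ x.2.2.1 ++ letters a}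
  have hL : L.Finite := List.finite_toSet _
  let P : Set ℕ := {v | v ∈ 0 :: x.2.1 ++ (x.2.2.1 ++ letters a).flatten}
  have hP : P.Finite := List.finite_toSet _
  have h0 : 0 ∈ P := by simp [P]
  let Q : Set ℕ := {q | q ∈ x.1 :: (trans a).map fun t => t.2.2}
  have hQ : Q.Finite := List.finite_toSet _
  refine ((hQ.prod ((finite_lists hP x.2.1.length).prod
    ((finite_lists hL (max (depth a) x.2.2.1.length)).prod
      (Set.finite_univ (α := Bool))))).subset ?_)
  intro y hy
  induction hy with
  | refl =>
    refine ⟨by simp [Q], ⟨le_rfl, fun v hv => ?_⟩, ⟨le_max_right _ _, fun ℓ hℓ => ?_⟩, trivial⟩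
    · exact List.mem_append_left _ (List.mem_cons_of_mem _ hv)
    · exact List.mem_append_left _ hℓ
  | @tail y z _ h ih =>
    obtain ⟨h1, ⟨h2, h3⟩, ⟨h4, h5⟩, -⟩ := ih
    have hu : ∀ ℓ ∈ y.2.2.1, ∀ v ∈ ℓ, v ∈ P := fun ℓ hℓ v hv =>
      List.mem_append_right _ (List.mem_flatten.2 ⟨ℓ, h5 ℓ hℓ, hv⟩)
    simp only [succ, List.mem_append] at h
    rcases h with h | h
    · split_ifs at h with h6 h7
      · rcases List.mem_append.1 h with h | h
        · obtain ⟨lab, h8, h9, -⟩ := (mem_standard a).1 h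
          obtain ⟨h10, h11, h12⟩ := run_mem h0 h3 hu h9
          exact ⟨List.mem_cons_of_mem _ (List.mem_map.2 ⟨_, h8, rfl⟩), ⟨h10.trans_le h2, h11⟩,
            ⟨h12.length_le.trans h4, fun ℓ hℓ => h5 ℓ (h12.subset hℓ)⟩, trivial⟩
        · obtain rfl := List.mem_singleton.1 h
          exact ⟨h1, ⟨h2, h3⟩, ⟨by simp only [List.length_tail]; omega,
            fun ℓ hℓ => h5 ℓ (List.mem_of_mem_tail hℓ)⟩, trivial⟩
      · rw [List.append_nil] at h
        obtain ⟨lab, h8, h9, -⟩ := (mem_standard a).1 h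
        obtain ⟨h10, h11, h12⟩ := run_mem h0 h3 hu h9
        exact ⟨List.mem_cons_of_mem _ (List.mem_map.2 ⟨_, h8, rfl⟩), ⟨h10.trans_le h2, h11⟩,
          ⟨h12.length_le.trans h4, fun ℓ hℓ => h5 ℓ (h12.subset hℓ)⟩, trivial⟩
      · cases h
    · split_ifs at h with h6 h7
      · rcases List.mem_cons.1 h with rfl | h
        · exact ⟨h1, ⟨h2, h3⟩, ⟨h4, h5⟩, trivial⟩
        · obtain ⟨ℓ, h8, rfl⟩ := List.mem_map.1 h
          refine ⟨h1, ⟨h2, h3⟩, ⟨?_, fun ℓ' hℓ => ?_⟩, trivial⟩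
          · simp only [List.length_append, List.length_singleton]
            omega
          · rcases List.mem_append.1 hℓ with hℓ | hℓ
            · exact h5 _ hℓ
            · obtain rfl := List.mem_singleton.1 hℓ
              exact List.mem_append_right _ h8
      · obtain rfl := List.mem_singleton.1 h
        exact ⟨h1, ⟨h2, h3⟩, ⟨h4, h5⟩, trivial⟩
      · cases h

end Written

end TOPL

namespace TOPL

namespace Written

variable {V : Type*} {n m : ℕ}

/-! #### Correctness for labels -/

/-- A tuple, written out. -/
def tuple {k : ℕ} (θ : V → ℕ) (s : Fin k → V) : List ℕ := List.ofFn fun i => θ (s i)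

theorem getD_tuple {k : ℕ} (θ : V → ℕ) (s : Fin k → V) (i : Fin k) :
    (tuple θ s).getD i 0 = θ (s i) := by
  simp [tuple, List.getD_eq_getElem?_getD]

/-- Only equality is ever tested, so it is enough that the renaming `θ` is injective on the values
at hand. -/
theorem holds_iff {θ : V → ℕ} {X : Set V} (hθ : Set.InjOn θ X) {s : Store V m}
    {ℓ : Letter V n} (hs : ∀ i, s i ∈ X) (hℓ : ∀ j, ℓ j ∈ X) (g : Guard n m) :
    Holds (tuple θ s) (tuple θ ℓ) g.code ↔ g.Sat s ℓ := by
  induction g with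
  | eq i j =>
    simp only [Holds, Guard.code, Guard.Sat, List.mem_singleton, forall_eq, getD_tuple,
      hθ.eq_iff (hs i) (hℓ j)]
    simp
  | neq i j =>
    simp only [Holds, Guard.code, Guard.Sat, List.mem_singleton, forall_eq, getD_tuple,
      hθ.eq_iff (hs i) (hℓ j)]
    simp
  | triv => simp [Holds, Guard.code, Guard.Sat]
  | and g₁ g₂ ih₁ ih₂ =>
    rw [Guard.Sat, ← ih₁, ← ih₂]
    simp only [Holds, Guard.code, List.mem_cons, List.mem_append, or_imp, forall_and,
      forall_eq]
    simp only [Nat.succ_ne_zero, OfNat.ofNat_ne_one, false_and, not_false_eq_true, true_and]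
    tauto

theorem perform_tuple (θ : V → ℕ) (s : Store V m) (ℓ : Letter V n) (a : Action n m) :
    perform (tuple θ ℓ) a.code (tuple θ s) = tuple θ (a.run ℓ s) := by
  induction a generalizing s with
  | nop => simp [perform, Action.code, Action.run]
  | set i j =>
    simp only [perform, Action.code, Action.run, List.foldr_cons, List.foldr_nil, if_true,
      getD_tuple]
    apply List.ext_getElem
    · simp [tuple]
    · intro k h1 h2
      simp only [tuple, List.getElem_set, List.getElem_ofFn, Function.update_apply, Fin.ext_iff]
      by_cases h : i.val = k
      · simp [h]
      · simp [h, Ne.symm h]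
  | seq a₁ a₂ ih₁ ih₂ =>
    have : perform (tuple θ ℓ) (Action.seq a₁ a₂).code (tuple θ s) =
        perform (tuple θ ℓ) a₁.code (perform (tuple θ ℓ) a₂.code (tuple θ s)) := by
      simp [perform, Action.code]
    rw [this, ih₂, ih₁]
    rfl

theorem _root_.TOPL.Action.run_mem {X : Set V} {s : Store V m} {ℓ : Letter V n}
    (hs : ∀ i, s i ∈ X) (hℓ : ∀ j, ℓ j ∈ X) (a : Action n m) (i : Fin m) :
    a.run ℓ s i ∈ X := by
  induction a generalizing s i with
  | nop => exact hs i
  | set i' j =>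
    by_cases h : i = i'
    · subst h; simpa [Action.run] using hℓ j
    · simpa [Action.run, h] using hs i
  | seq a₁ a₂ ih₁ ih₂ => exact ih₁ (fun i => ih₂ hs i) i

theorem _root_.TOPL.AcceptsWith.mem {X : Set V} {s s' : Store V m} {lab : List (Label n m)}
    {v : List (Letter V n)} (h : AcceptsWith s lab v s') (hs : ∀ i, s i ∈ X)
    (hv : ∀ ℓ ∈ v, ∀ j, ℓ j ∈ X) : ∀ i, s' i ∈ X := by
  induction lab generalizing s v with
  | nil =>
    cases v with
    | nil => obtain rfl : s = s' := h; exact hs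
    | cons => exact h.elim
  | cons l lab ih =>
    obtain ⟨g, a⟩ := l
    cases v with
    | nil => exact h.elim
    | cons ℓ v =>
      exact ih h.2 (Action.run_mem hs (hv ℓ (by simp)) a) fun ℓ' h => hv ℓ' (by simp [h])

theorem run_cons {θ : V → ℕ} {X : Set V} (hθ : Set.InjOn θ X) {s : Store V m}
    {ℓ : Letter V n} (hs : ∀ i, s i ∈ X) (hℓ : ∀ j, ℓ j ∈ X) {g : Guard n m}
    (hg : g.Sat s ℓ) (a : Action n m) (lab : List LabelCode) (u : List (List ℕ)) :
    run (labelCode (g, a) :: lab) (tuple θ s) (tuple θ ℓ :: u) =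
      run lab (tuple θ (a.run ℓ s)) u := by
  have : advance (some (tuple θ s, tuple θ ℓ :: u)) (labelCode (g, a)) =
      some (perform (tuple θ ℓ) a.code (tuple θ s), u) := if_pos ((holds_iff hθ hs hℓ g).2 hg)
  rw [run, List.foldl_cons, this, perform_tuple, run]

theorem foldl_advance_none (lab : List LabelCode) : lab.foldl advance none = none := by
  induction lab with
  | nil => rfl
  | cons l lab ih => exact ih

theorem run_of_acceptsWith {θ : V → ℕ} {X : Set V} (hθ : Set.InjOn θ X) {s s' : Store V m}
    {lab : List (Label n m)} {v : List (Letter V n)} (h : AcceptsWith s lab v s')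
    (hs : ∀ i, s i ∈ X) (hv : ∀ ℓ ∈ v, ∀ j, ℓ j ∈ X) (u : List (List ℕ)) :
    run (lab.map labelCode) (tuple θ s) (v.map (tuple θ) ++ u) = some (tuple θ s', u) := by
  induction lab generalizing s v with
  | nil =>
    cases v with
    | nil => obtain rfl : s = s' := h; rfl
    | cons => exact h.elim
  | cons l lab ih =>
    obtain ⟨g, a⟩ := l
    cases v with
    | nil => exact h.elim
    | cons ℓ v =>
      have hℓ := hv ℓ (by simp)
      rw [List.map_cons, List.map_cons, List.cons_append, run_cons hθ hs hℓ h.1]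
      exact ih h.2 (Action.run_mem hs hℓ a) fun ℓ' h => hv ℓ' (by simp [h])

theorem acceptsWith_of_run {θ : V → ℕ} {X : Set V} (hθ : Set.InjOn θ X) {s : Store V m}
    {lab : List (Label n m)} {u : List (Letter V n)} (hs : ∀ i, s i ∈ X)
    (hu : ∀ ℓ ∈ u, ∀ j, ℓ j ∈ X) {r : List ℕ × List (List ℕ)}
    (h : run (lab.map labelCode) (tuple θ s) (u.map (tuple θ)) = some r) :
    ∃ v s' u', u = v ++ u' ∧ AcceptsWith s lab v s' ∧ r = (tuple θ s', u'.map (tuple θ)) := by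
  induction lab generalizing s u with
  | nil =>
    cases h
    exact ⟨[], s, u, rfl, rfl, rfl⟩
  | cons l lab ih =>
    obtain ⟨g, a⟩ := l
    cases u with
    | nil =>
      rw [List.map_cons, run, List.foldl_cons, List.map_nil,
        show advance (some (tuple θ s, [])) (labelCode (g, a)) = none from rfl,
        foldl_advance_none] at h
      cases h
    | cons ℓ u =>
      have hℓ := hu ℓ (by simp)
      by_cases hg : g.Sat s ℓ
      · rw [List.map_cons, List.map_cons, run_cons hθ hs hℓ hg] at h
        obtain ⟨v, s', u', rfl, h1, rfl⟩ := ih (Action.run_mem hs hℓ a)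
          (fun ℓ' h => hu ℓ' (by simp [h])) h
        exact ⟨ℓ :: v, s', u', rfl, ⟨hg, h1⟩, rfl⟩
      · rw [List.map_cons, List.map_cons, run, List.foldl_cons,
          show advance (some (tuple θ s, tuple θ ℓ :: u.map (tuple θ))) (labelCode (g, a)) = none
            from if_neg (mt (holds_iff hθ hs hℓ g).1 hg), foldl_advance_none] at h
        cases h

/-! #### Correctness for automata -/

theorem mem_succ {a : Input} {x y : Node} : y ∈ succ a x ↔
    ((x.2.2.2 = true ∨ depth a ≤ x.2.2.1.length) ∧ (y ∈ standard a x ∨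
      (a.1 = true ∧ standard a x = [] ∧ x.2.2.1 ≠ []) ∧
        y = (x.1, x.2.1, x.2.2.1.tail, x.2.2.2))) ∨
    (x.2.2.2 = false ∧ (y = (x.1, x.2.1, x.2.2.1, true) ∨
      x.2.2.1.length < depth a ∧ ∃ ℓ ∈ letters a, y = (x.1, x.2.1, x.2.2.1 ++ [ℓ], false))) := by
  simp only [succ, List.mem_append]
  refine or_congr ?_ ?_
  · split_ifs with h1 h2 <;> simp_all
  · split_ifs with h1 h2
    · simp only [List.mem_cons, List.mem_map, h1, h2, true_and]
      exact or_congr Iff.rfl (exists_congr fun ℓ => and_congr Iff.rfl eq_comm)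
    · simp [h1, h2]
    · simp [h1]

theorem mem_letters {a : Input} {ℓ : List ℕ} :
    ℓ ∈ letters a ↔ ℓ.length = a.2.1.1 ∧ ∀ v ∈ ℓ, v ∈ pool a := by
  rw [letters]
  generalize a.2.1.1 = k
  induction k generalizing ℓ with
  | zero =>
    rw [Function.iterate_zero, id, List.mem_singleton, List.length_eq_zero_iff]
    exact ⟨fun h => ⟨h, by simp [h]⟩, fun h => h.1⟩
  | succ k ih =>
    rw [Function.iterate_succ_apply', List.mem_flatMap]
    simp only [ih, List.mem_map]
    constructor
    · rintro ⟨ℓ', ⟨h1, h2⟩, v, h3, rfl⟩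
      exact ⟨by simp [h1], by simpa using ⟨h3, h2⟩⟩
    · rintro ⟨h1, h2⟩
      cases ℓ with
      | nil => cases h1
      | cons v ℓ =>
        exact ⟨ℓ, ⟨by simpa using h1, fun w hw => h2 w (by simp [hw])⟩, v, h2 v (by simp), rfl⟩

/-- The input `a` describes the automaton `A`, with states numbered by `e`. -/
structure Describes (a : Input) (A : HighAutomaton V n m) (e : A.Q → ℕ) : Prop where
  injective : Function.Injective e
  arity : a.2.1.1 = n
  registers : a.2.1.2.1 = m
  mem_trans : ∀ t, t ∈ trans a ↔ ∃ q lab q', (q, lab, q') ∈ A.δ ∧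
    t = (e q, lab.map labelCode, e q')
  mem_final : ∀ k, k ∈ a.2.2.2.2.2 ↔ ∃ q ∈ A.F, e q = k

namespace Describes

variable {a : Input} {A : HighAutomaton V n m} {e : A.Q → ℕ}

theorem length_le (h : Describes a A e) {q q' : A.Q} {lab : List (Label n m)}
    (hq : (q, lab, q') ∈ A.δ) : lab.length ≤ depth a := by
  have h1 := (h.mem_trans _).2 ⟨q, lab, q', hq, rfl⟩
  have h2 : ∀ (l : List (ℕ × List LabelCode × ℕ)) t, t ∈ l →
      t.2.1.length ≤ (l.flatMap fun t => t.2.1).length := by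
    intro l t ht
    induction l with
    | nil => cases ht
    | cons t' l ih =>
      rw [List.flatMap_cons, List.length_append]
      rcases List.mem_cons.1 ht with rfl | ht
      · exact Nat.le_add_right _ _
      · exact (ih ht).trans (Nat.le_add_left _ _)
  have h3 := h2 _ _ h1
  rw [List.length_map] at h3
  exact h3.trans (Nat.le_succ _)

/-- A high-level configuration with a buffer and a flag, written out. -/
def _root_.TOPL.Written.node (e : A.Q → ℕ) (θ : V → ℕ) (q : A.Q) (s : Store V m)
    (u : List (Letter V n)) (fl : Bool) : Node :=
  (e q, tuple θ s, u.map (tuple θ), fl)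

theorem mem_standard_node (h : Describes a A e) {θ : V → ℕ} {X : Set V} (hθ : Set.InjOn θ X)
    {q : A.Q} {s : Store V m} {u : List (Letter V n)} {fl : Bool} (hs : ∀ i, s i ∈ X)
    (hu : ∀ ℓ ∈ u, ∀ j, ℓ j ∈ X) {y : Node} :
    y ∈ standard a (node e θ q s u fl) ↔ ∃ lab q' v s' u', (q, lab, q') ∈ A.δ ∧
      AcceptsWith s lab v s' ∧ u = v ++ u' ∧ y = node e θ q' s' u' fl := by
  rw [mem_standard]
  constructor
  · rintro ⟨lab, h1, h2, h3⟩
    obtain ⟨q₁, lab, q', h4, h5⟩ := (h.mem_trans _).1 h1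
    simp only [node, Prod.mk.injEq] at h5
    obtain ⟨h6, rfl, h7⟩ := h5
    obtain rfl := h.injective h6
    obtain ⟨v, s', u', rfl, h8, h9⟩ := acceptsWith_of_run hθ hs hu h2
    refine ⟨lab, q', v, s', u', h4, h8, rfl, ?_⟩
    obtain ⟨_, _, _, _⟩ := y
    simp only [Prod.mk.injEq] at h9
    simp_all [node]
  · rintro ⟨lab, q', v, s', u', h1, h2, rfl, rfl⟩
    refine ⟨lab.map labelCode, (h.mem_trans _).2 ⟨q, lab, q', h1, rfl⟩, ?_, rfl⟩
    rw [node, List.map_append]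
    exact run_of_acceptsWith hθ h2 hs (fun ℓ hℓ => hu ℓ (by simp [hℓ])) _

theorem standard_node_eq_nil_iff (h : Describes a A e) {θ : V → ℕ} {X : Set V}
    (hθ : Set.InjOn θ X) {q : A.Q} {s : Store V m} {u : List (Letter V n)} {fl : Bool}
    (hs : ∀ i, s i ∈ X) (hu : ∀ ℓ ∈ u, ∀ j, ℓ j ∈ X) :
    standard a (node e θ q s u fl) = [] ↔ ¬ A.Enabled q s u := by
  rw [List.eq_nil_iff_forall_not_mem, HighAutomaton.Enabled]
  simp only [h.mem_standard_node hθ hs hu]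
  constructor
  · rintro H ⟨lab, q', v, s', u', h1, h2, h3⟩
    exact H _ ⟨lab, q', v, s', u', h1, h2, h3, rfl⟩
  · rintro H y ⟨lab, q', v, s', u', h1, h2, h3, -⟩
    exact H ⟨lab, q', v, s', u', h1, h2, h3⟩

/-- What the written automaton accepts is accepted, if `θ` is the inverse of a naming. -/
theorem exists_lacc (h : Describes a A e) {name : ℕ → V} {θ : V → ℕ}
    (hθ : ∀ k, θ (name k) = k) {x y : Node}
    (hxy : Relation.ReflTransGen (fun x y => y ∈ succ a x) x y) (hy : Final a y) {q : A.Q}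
    {s : Store V m} {u : List (Letter V n)} {fl : Bool} (hx : x = node e θ q s u fl)
    (hs : ∀ i, s i ∈ Set.range name) (hu : ∀ ℓ ∈ u, ∀ j, ℓ j ∈ Set.range name) :
    ∃ w, A.LAcc a.1 (depth a) q s u fl w := by
  have hinj : Set.InjOn θ (Set.range name) := by
    rintro _ ⟨k, rfl⟩ _ ⟨k', rfl⟩ h
    rw [hθ, hθ] at h
    rw [h]
  induction hxy using Relation.ReflTransGen.head_induction_on generalizing q s u fl with
  | refl =>
    subst hx
    obtain ⟨⟨_, h1, rfl⟩, h2, h3⟩ := hy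
    obtain ⟨q', h4, h5⟩ := (h.mem_final _).1 h1
    obtain rfl := h.injective h5
    obtain rfl : u = [] := by simpa [node] using h2
    obtain rfl : fl = true := h3
    exact ⟨[], .fin h4⟩
  | head h1 _ ih =>
    subst hx
    rcases mem_succ.1 h1 with ⟨h2, h3 | ⟨⟨h3, h4, h5⟩, rfl⟩⟩ | ⟨h2, rfl | ⟨h3, ℓ, h4, rfl⟩⟩
    · obtain ⟨lab, q', v, s', u', h4, h5, rfl, rfl⟩ :=
        (h.mem_standard_node hinj hs hu).1 h3
      obtain ⟨w, hw⟩ := ih rfl (h5.mem hs fun ℓ hℓ => hu ℓ (by simp [hℓ]))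
        fun ℓ hℓ => hu ℓ (by simp [hℓ])
      exact ⟨w, .std (by simpa [node] using h2) h4 h5 hw⟩
    · cases u with
      | nil => exact (h5 rfl).elim
      | cons ℓ u =>
        obtain ⟨w, hw⟩ := ih (q := q) (s := s) (u := u) (fl := fl) rfl hs
          fun ℓ hℓ => hu ℓ (by simp [hℓ])
        exact ⟨w, .skip h3 (by simpa [node] using h2)
          ((h.standard_node_eq_nil_iff hinj hs hu).1 h4) hw⟩
    · obtain rfl : fl = false := h2
      obtain ⟨w, hw⟩ := ih (q := q) (s := s) (u := u) (fl := true) rfl hs hu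
      have := (hw.acc fun _ _ _ => h.length_le).1 rfl
      subst this
      exact ⟨[], .close hw⟩
    · obtain rfl : fl = false := h2
      obtain ⟨h5, -⟩ := mem_letters.1 h4
      rw [h.arity] at h5
      let ℓ' : Letter V n := fun j => name (ℓ[j.val]'(h5 ▸ j.2))
      have hℓ : tuple θ ℓ' = ℓ := by
        apply List.ext_getElem
        · simp [tuple, h5]
        · intro i h1 h2
          simp [tuple, ℓ', hθ]
      obtain ⟨w, hw⟩ := ih (q := q) (s := s) (u := u ++ [ℓ']) (fl := false)
        (by simp [node, hℓ]) hs fun ℓ hℓ j => by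
          rcases List.mem_append.1 hℓ with hℓ | hℓ
          · exact hu ℓ hℓ j
          · obtain rfl := List.mem_singleton.1 hℓ
            exact ⟨_, rfl⟩
      exact ⟨ℓ' :: w, .read (by simpa [node] using h3) hw⟩

end Describes

/-! ### Renaming the values of a run into the pool -/

/-- The values in a store and a buffer. -/
def values (s : Store V m) (u : List (Letter V n)) : List V :=
  List.ofFn s ++ u.flatMap List.ofFn

theorem length_values (s : Store V m) (u : List (Letter V n)) :
    (values s u).length = m + u.length * n := by
  simp [values, List.length_flatMap]

theorem mem_values {s : Store V m} {u : List (Letter V n)} {v : V} :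
    v ∈ values s u ↔ (∃ i, s i = v) ∨ ∃ ℓ ∈ u, ∃ j, ℓ j = v := by
  simp [values, List.mem_ofFn]

/-- Since `P` has room for all of `l'`, the image of `l` is enlarged inside `P` to a set of the
right size, and the injection is extended to a bijection onto it. Values that have been forgotten
are not in `l`, so their numbers may be used again. -/
theorem exists_extension {θ : V → ℕ} {l l' : List V} (hl : l ⊆ l')
    (hθ : Set.InjOn θ {v | v ∈ l}) {P : Finset ℕ} (hP : ∀ v ∈ l, θ v ∈ P)
    (hcard : l'.length ≤ P.card) : ∃ θ' : V → ℕ, Set.InjOn θ' {v | v ∈ l'} ∧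
      (∀ v ∈ l', θ' v ∈ P) ∧ ∀ v ∈ l, θ' v = θ v := by
  classical
  have h1 : (l.toFinset.image θ).card ≤ l'.toFinset.card :=
    Finset.card_image_le.trans (Finset.card_le_card fun v hv => by
      simpa using hl (by simpa using hv))
  obtain ⟨t, h2, h3, h4⟩ := Finset.exists_subsuperset_card_eq
    (s := l.toFinset.image θ) (t := P) (fun x hx => by
      obtain ⟨v, hv, rfl⟩ := Finset.mem_image.1 hx
      exact hP v (by simpa using hv)) h1 ((List.toFinset_card_le l').trans hcard)
  obtain ⟨g, hg⟩ := Finset.exists_equiv_extend_of_card_eq (α := l'.toFinset) (t := t)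
    ((Fintype.card_coe _).trans h4.symm) (s := Finset.univ.filter fun v => v.1 ∈ l) (f := fun v => θ v.1)
    (fun x hx => by
      obtain ⟨v, hv, rfl⟩ := Finset.mem_image.1 hx
      exact h2 (Finset.mem_image_of_mem _ (by simpa using hv)))
    (fun v hv w hw h => Subtype.ext (hθ (by simpa using hv) (by simpa using hw) h))
  have h5 : ∀ v ∈ l', v ∈ l'.toFinset := fun v hv => by simpa using hv
  refine ⟨fun v => if hv : v ∈ l'.toFinset then g ⟨v, hv⟩ else 0, fun v hv w hw h => ?_,
    fun v hv => ?_, fun v hv => ?_⟩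
  · simp only [dif_pos (h5 v hv), dif_pos (h5 w hw)] at h
    simpa using g.injective (Subtype.ext h)
  · simp only [dif_pos (h5 v hv)]
    exact h3 (g _).2
  · simp only [dif_pos (h5 v (hl hv))]
    exact hg ⟨v, _⟩ (by simpa using hv)

namespace Describes

variable {a : Input} {A : HighAutomaton V n m} {e : A.Q → ℕ}

/-- What is accepted is accepted by the written automaton, with values in the pool. -/
theorem exists_final (h : Describes a A e) {q : A.Q} {s : Store V m} {u : List (Letter V n)}
    {fl : Bool} {w : List (Letter V n)} (hacc : A.LAcc a.1 (depth a) q s u fl w) {θ : V → ℕ}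
    (hθ : Set.InjOn θ {v | v ∈ values s u})
    (hfl : fl = false → u.length ≤ depth a ∧ ∀ v ∈ values s u, θ v ∈ pool a) :
    ∃ y, Relation.ReflTransGen (fun x y => y ∈ succ a x) (node e θ q s u fl) y ∧ Final a y := by
  induction hacc generalizing θ with
  | @fin q s hq =>
    exact ⟨_, .refl, ⟨e q, (h.mem_final _).2 ⟨q, hq, rfl⟩, rfl⟩, rfl, rfl⟩
  | @close q s u _ ih =>
    obtain ⟨y, h1, h2⟩ := ih hθ (by simp)
    exact ⟨y, .head (mem_succ.2 (.inr ⟨rfl, .inl rfl⟩)) h1, h2⟩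
  | @read q s u ℓ w hu _ ih =>
    obtain ⟨-, hpool⟩ := hfl rfl
    have hsub : values s u ⊆ values s (u ++ [ℓ]) := by
      intro v hv
      rw [mem_values] at hv ⊢
      exact hv.imp_right fun ⟨ℓ', h1, h2⟩ => ⟨ℓ', by simp [h1], h2⟩
    -- The renaming is changed to accommodate the new letter. It agrees with the old one on the
    -- current values, so the written node stays the same.
    obtain ⟨θ', h1, h2, h3⟩ := exists_extension (P := (pool a).toFinset) hsub hθ
      (fun v hv => by simpa using hpool v hv) (by
        rw [length_values]
        -- After reading, the store and the buffer hold at most `m + depth a * n` values; the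
        -- interval in the pool alone has that many.
        have h4 : Finset.range (a.2.1.2.1 + depth a * a.2.1.1) ⊆ (pool a).toFinset := by
          intro k hk
          simp only [List.mem_toFinset, pool]
          exact List.mem_append_right _ (by simpa using hk)
        have h5 := Finset.card_le_card h4
        rw [Finset.card_range, h.registers, h.arity] at h5
        refine le_trans ?_ h5
        gcongr
        simpa using hu)
    obtain ⟨y, h4, h5⟩ := ih h1 fun _ => ⟨by simpa using hu, fun v hv => by simpa using h2 v hv⟩
    refine ⟨y, .head (mem_succ.2 (.inr ⟨rfl, .inr ⟨by simpa [node] using hu, tuple θ' ℓ, ?_,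
      rfl⟩⟩)) ?_, h5⟩
    · rw [mem_letters]
      refine ⟨by simp [tuple, h.arity], fun v hv => ?_⟩
      obtain ⟨j, rfl⟩ := List.mem_ofFn.1 hv
      simpa using h2 (ℓ j) (mem_values.2 (.inr ⟨ℓ, by simp, j, rfl⟩))
    · have h6 : tuple θ s = tuple θ' s := by
        simp only [tuple]
        congr 1
        funext i
        exact (h3 _ (mem_values.2 (.inl ⟨i, rfl⟩))).symm
      have h7 : u.map (tuple θ) = u.map (tuple θ') := by
        refine List.map_congr_left fun ℓ' hℓ => ?_
        simp only [tuple]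
        congr 1
        funext j
        exact (h3 _ (mem_values.2 (.inr ⟨ℓ', hℓ, j, rfl⟩))).symm
      simpa [node, h6, h7] using h4
  | @std q q' s s' lab v u fl w hr hδ hv _ ih =>
    have hs : ∀ i, s i ∈ {x | x ∈ values s (v ++ u)} := fun i => mem_values.2 (.inl ⟨i, rfl⟩)
    have hvu : ∀ ℓ ∈ v ++ u, ∀ j, ℓ j ∈ {x | x ∈ values s (v ++ u)} := fun ℓ hℓ j =>
      mem_values.2 (.inr ⟨ℓ, hℓ, j, rfl⟩)
    have hsub : ∀ x ∈ values s' u, x ∈ values s (v ++ u) := by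
      intro x hx
      rcases mem_values.1 hx with ⟨i, rfl⟩ | ⟨ℓ, h1, j, rfl⟩
      · exact hv.mem hs (fun ℓ hℓ => hvu ℓ (by simp [hℓ])) i
      · exact hvu ℓ (by simp [h1]) j
    obtain ⟨y, h1, h2⟩ := ih (hθ.mono hsub) fun h => ⟨by have := (hfl h).1; simp at this; omega,
      fun x hx => (hfl h).2 x (hsub x hx)⟩
    exact ⟨y, .head (mem_succ.2 (.inl ⟨by simpa [node] using hr, .inl
      ((h.mem_standard_node hθ hs hvu).2 ⟨lab, q', v, s', u, hδ, hv, rfl, rfl⟩)⟩)) h1, h2⟩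
  | @skip q s ℓ u fl w hb hr hen _ ih =>
    have hsub : ∀ x ∈ values s u, x ∈ values s (ℓ :: u) := by
      intro x hx
      rw [mem_values] at hx ⊢
      exact hx.imp_right fun ⟨ℓ', h1, h2⟩ => ⟨ℓ', by simp [h1], h2⟩
    obtain ⟨y, h1, h2⟩ := ih (hθ.mono hsub) fun h => ⟨by have := (hfl h).1; simp at this; omega,
      fun x hx => (hfl h).2 x (hsub x hx)⟩
    refine ⟨y, .head (mem_succ.2 (.inl ⟨by simpa [node] using hr, .inr ⟨⟨hb, ?_, by simp [node]⟩,
      rfl⟩⟩)) h1, h2⟩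
    exact (h.standard_node_eq_nil_iff hθ (fun i => mem_values.2 (.inl ⟨i, rfl⟩))
      (fun ℓ hℓ j => mem_values.2 (.inr ⟨ℓ, hℓ, j, rfl⟩))).2 hen

end Describes

end Written

/-! ### Decidable problems -/

open Written

/-- A description of an automaton, with or without skipping, gives a numbering of its states. -/
theorem describes_of_hasCode {V : Type*} {n m : ℕ} {A : HighAutomaton V n m} {name : ℕ → V}
    {c : AutomatonCode (List LabelCode)} (h : A.HasCode name n (List.map labelCode) c)
    {θ : V → ℕ} (hθ : ∀ k, θ (name k) = k) (b : Bool) :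
    ∃ e : A.Q → ℕ, Describes (b, c) A e ∧ c.2.1 = e A.q₀ ∧ c.2.2.1 = tuple θ A.s₀ ∧
      ∀ i, A.s₀ i ∈ Set.range name := by
  obtain ⟨k, e, s, δ, F, h1, h2, h3, rfl⟩ := h
  refine ⟨fun q => (e q).val, ⟨fun q q' h => e.injective (Fin.ext h), rfl, rfl, fun t => ?_,
    fun k => ?_⟩, rfl, ?_, fun i => ⟨_, h1 i⟩⟩
  · simp only [Written.trans, List.mem_map, h2]
    constructor
    · rintro ⟨⟨q, lab, q'⟩, h, rfl⟩
      exact ⟨q, lab, q', h, rfl⟩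
    · rintro ⟨q, lab, q', h, rfl⟩
      exact ⟨_, h, rfl⟩
  · simp only [List.mem_map, h3]
  · simp only [tuple]
    congr 1
    funext i
    rw [← h1, hθ]

/-- For emptiness the search starts with an empty buffer and reads letters over the pool. For
membership it starts with the whole word in the buffer and the flag set, so no letter is read and
the pool plays no role. -/
theorem exists_computable_acc {V : Type*} (name : ℕ → V) (hname : Function.Injective name)
    (b : Bool) :
    (∃ f : AutomatonCode (List LabelCode) → Bool, Computable f ∧
      ∀ (n m : ℕ) (A : HighAutomaton V n m) c, A.HasCode name n (List.map labelCode) c →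
        (f c = true ↔ ∀ w, ¬ A.Acc b A.q₀ A.s₀ w)) ∧
    ∃ f : AutomatonCode (List LabelCode) × List (List ℕ) → Bool, Computable f ∧
      ∀ (n m : ℕ) (A : HighAutomaton V n m) c u w, A.HasCode name n (List.map labelCode) c →
        WordDescribes name u w → (f (c, u) = true ↔ A.Acc b A.q₀ A.s₀ w) := by
  have hθ := Function.leftInverse_invFun hname
  set θ := Function.invFun name
  have hinj : Set.InjOn θ (Set.range name) := by
    rintro _ ⟨k, rfl⟩ _ ⟨k', rfl⟩ h
    rw [hθ, hθ] at h
    rw [h]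
  constructor
  · obtain ⟨f, hf, hf'⟩ := exists_computable_reachable
      (α := AutomatonCode (List LabelCode)) (β := Node)
      (init := fun c => (c.2.1, c.2.2.1, [], false)) (succ := fun c => succ (b, c))
      (fin := fun c => Final (b, c))
      (.pair (Primrec.fst.comp .snd) (.pair (Primrec.fst.comp (Primrec.snd.comp .snd))
        (.pair (.const _) (.const _))))
      (primrec_succ.comp (Primrec.pair (.const b) .fst) .snd)
      (PrimrecRel.comp primrec_final (Primrec.pair (.const b) .fst) Primrec.snd)
      (fun c => finite_reachable _ _)
    refine ⟨fun c => !f c, Primrec.not.to_comp.comp hf, fun n m A c hc => ?_⟩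
    obtain ⟨e, he, h1, h2, h3⟩ := describes_of_hasCode hc hθ b
    rw [Bool.not_eq_true', ← Bool.not_eq_true, hf', ← not_exists, not_iff_not, h1, h2]
    constructor
    · rintro ⟨y, hy, hy'⟩
      obtain ⟨w, hw⟩ := he.exists_lacc hθ hy hy' (q := A.q₀) (s := A.s₀) (u := []) (fl := false)
        rfl h3 (by simp)
      exact ⟨w, by simpa using (hw.acc fun _ _ _ => he.length_le).2⟩
    · rintro ⟨w, hw⟩
      refine he.exists_final (θ := θ) (u := []) (hw.lacc (b := b) (Nat.succ_pos _)
        (fun _ _ _ => he.length_le) rfl (by simp) (by simp)) (hinj.mono ?_) fun _ =>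
        ⟨by simp, fun v hv => ?_⟩
      · intro v hv
        rcases mem_values.1 hv with ⟨i, rfl⟩ | ⟨ℓ, h, -⟩
        · exact h3 i
        · cases h
      · rcases mem_values.1 hv with ⟨i, rfl⟩ | ⟨ℓ, h, -⟩
        · refine List.mem_append_left _ ?_
          change _ ∈ c.2.2.1
          rw [h2]
          exact List.mem_ofFn.2 ⟨i, rfl⟩
        · cases h
  · obtain ⟨f, hf, hf'⟩ := exists_computable_reachable
      (α := AutomatonCode (List LabelCode) × List (List ℕ)) (β := Node)
      (init := fun x => (x.1.2.1, x.1.2.2.1, x.2, true)) (succ := fun x => succ (b, x.1))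
      (fin := fun x => Final (b, x.1))
      (.pair (Primrec.fst.comp (Primrec.snd.comp .fst)) (.pair (Primrec.fst.comp
        (Primrec.snd.comp (Primrec.snd.comp .fst))) (.pair .snd (.const _))))
      (primrec_succ.comp (Primrec.pair (.const b) (Primrec.fst.comp .fst)) .snd)
      (PrimrecRel.comp primrec_final (Primrec.pair (.const b) (Primrec.fst.comp .fst))
        Primrec.snd)
      (fun c => finite_reachable _ _)
    refine ⟨f, hf, fun n m A c u w hc hw => ?_⟩
    obtain ⟨e, he, h1, h2, h3⟩ := describes_of_hasCode hc hθ b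
    have hu : u = w.map (tuple θ) := by
      have := congrArg (List.map (List.map θ)) hw
      rw [List.map_map, List.map_map] at this
      have h4 : (List.map θ ∘ List.map name) = id := by
        funext l
        simp [Function.comp_def, hθ _]
      rw [h4, List.map_id] at this
      rw [this]
      refine List.map_congr_left fun ℓ _ => ?_
      simp [tuple, List.map_ofFn, Function.comp_def]
    have hw' : ∀ ℓ ∈ w, ∀ j, ℓ j ∈ Set.range name := by
      intro ℓ hℓ j
      have h4 : List.ofFn ℓ ∈ u.map (List.map name) := by
        rw [hw]
        exact List.mem_map.2 ⟨ℓ, hℓ, rfl⟩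
      obtain ⟨l, -, h5⟩ := List.mem_map.1 h4
      have h6 : ℓ j ∈ l.map name := by
        rw [h5]
        exact List.mem_ofFn.2 ⟨j, rfl⟩
      obtain ⟨k, -, hk⟩ := List.mem_map.1 h6
      exact ⟨k, hk⟩
    rw [hf']
    simp only [h1, h2, hu]
    constructor
    · rintro ⟨y, hy, hy'⟩
      obtain ⟨w', hw''⟩ := he.exists_lacc hθ hy hy' (q := A.q₀) (s := A.s₀) (u := w)
        (fl := true) rfl h3 hw'
      have := hw''.acc fun _ _ _ => he.length_le
      simpa [this.1 rfl] using this.2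
    · intro hacc
      refine he.exists_final (θ := θ) (u := w) (hacc.lacc (w := []) (b := b) (Nat.succ_pos _)
        (fun _ _ _ => he.length_le) (by simp) (by simp) (.inr rfl)) (hinj.mono ?_) (by simp)
      intro v hv
      rcases mem_values.1 hv with ⟨i, rfl⟩ | ⟨ℓ, h, j, rfl⟩
      · exact h3 i
      · exact hw' ℓ h j

theorem decidable_low {V : Type*} (name : ℕ → V) (hname : Function.Injective name) :
    EmptinessDecidable (LowDescribes name) ∧ MembershipDecidable name (LowDescribes name) := by
  obtain ⟨⟨f, hf, hf'⟩, g, hg, hg'⟩ := exists_computable_acc name hname false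
  constructor
  · refine ⟨fun c => f (singletonLabels c), hf.comp primrec_singletonLabels.to_comp, ?_⟩
    rintro n c _ ⟨m, A, hA, rfl⟩
    rw [hf' n m _ _ (LowAutomaton.toHigh_hasCode hA)]
    exact forall_congr' fun w => not_congr (LowAutomaton.mem_language_iff A w).symm
  · refine ⟨fun x => g (singletonLabels x.1, x.2),
      hg.comp ((primrec_singletonLabels.comp .fst).pair .snd).to_comp, ?_⟩
    rintro n c _ u w ⟨m, A, hA, rfl⟩ hu
    rw [hg' n m _ _ _ w (LowAutomaton.toHigh_hasCode hA) hu]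
    exact (LowAutomaton.mem_language_iff A w).symm

theorem decidable_high {V : Type*} (name : ℕ → V) (hname : Function.Injective name) :
    EmptinessDecidable (HighDescribes name) ∧
      MembershipDecidable name (HighDescribes name) := by
  obtain ⟨⟨f, hf, hf'⟩, g, hg, hg'⟩ := exists_computable_acc name hname true
  constructor
  · refine ⟨f, hf, ?_⟩
    rintro n c _ ⟨m, A, hA, rfl⟩
    rw [hf' n m _ _ hA]
    exact forall_congr' fun w => not_congr (HighAutomaton.mem_language_iff A w).symm
  · refine ⟨g, hg, ?_⟩
    rintro n c _ u w ⟨m, A, hA, rfl⟩ hu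
    rw [hg' n m _ _ _ w hA hu]
    exact (HighAutomaton.mem_language_iff A w).symm

end TOPL

/-! ### The theorem -/

theorem theorem1 (V : Type*) [Infinite V] :
    -- the emptiness and the membership problems are decidable
    (∀ name : ℕ → V, Function.Injective name →
      (TOPL.EmptinessDecidable (TOPL.LowDescribes name) ∧
        TOPL.MembershipDecidable name (TOPL.LowDescribes name)) ∧
      (TOPL.EmptinessDecidable (TOPL.HighDescribes name) ∧
        TOPL.MembershipDecidable name (TOPL.HighDescribes name))) ∧
    -- inclusion, equivalence and universality are undecidable, for every arity `n ≥ 1`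
    (∀ name : ℕ → V, Function.Injective name → ∀ n : ℕ, 1 ≤ n →
      (¬ TOPL.InclusionDecidable (TOPL.LowDescribes name n) ∧
        ¬ TOPL.EquivalenceDecidable (TOPL.LowDescribes name n) ∧
        ¬ TOPL.UniversalityDecidable (TOPL.LowDescribes name n)) ∧
      (¬ TOPL.InclusionDecidable (TOPL.HighDescribes name n) ∧
        ¬ TOPL.EquivalenceDecidable (TOPL.HighDescribes name n) ∧
        ¬ TOPL.UniversalityDecidable (TOPL.HighDescribes name n))) ∧
    -- closure under union, intersection, concatenation and Kleene star
    (∀ n : ℕ, TOPL.ClosedUnderRegularOperations (TOPL.lowLanguages V n) ∧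
      TOPL.ClosedUnderRegularOperations (TOPL.highLanguages V n)) ∧
    -- no closure under complementation, for every arity `n ≥ 1`
    (∀ n : ℕ, 1 ≤ n → ¬ TOPL.ClosedUnderComplement (TOPL.lowLanguages V n) ∧
      ¬ TOPL.ClosedUnderComplement (TOPL.highLanguages V n)) := by

  refine ⟨fun name hname => ?_, fun name hname n hn => ?_, fun n => ?_, fun n hn => ?_⟩
  · exact ⟨TOPL.decidable_low name hname, TOPL.decidable_high name hname⟩
  · exact TOPL.undecidable name hname hn
  · rw [TOPL.highLanguages_eq_lowLanguages]
    exact ⟨TOPL.closedUnderRegularOperations_lowLanguages V n,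
      TOPL.closedUnderRegularOperations_lowLanguages V n⟩
  · rw [TOPL.highLanguages_eq_lowLanguages]
    exact ⟨TOPL.not_closedUnderComplement_lowLanguages hn,
      TOPL.not_closedUnderComplement_lowLanguages hn⟩
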